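/- **Conventions.** Minkowski space has signature $(+,-,-,-)$ with metric $\eta$, and $(xy)=x^\mu y_\mu$. Fix $\kappa>0$, set $m_s=\kappa/\sqrt{s(s+1)}$, and call $s\to\infty$ with $m=m_s$ the Pauli–Lubanski limit. Let $H_m=\{p:\ p^2=m^2,\ p^0>0\}$ with measure $d\mu_m(p)=(2\pi)^{-3}d^4p\,\delta(p^2-m^2)\theta(p^0)$. For spacelike $e$ let $(I_eX)(x)=\int_0^\infty X(x+te)\,dt$ and $(J_e)_\mu{}^\nu=\delta_\mu^\nu+I_e e^\nu\partial_\mu$. In momentum space these are $I_e(p)=\frac{i}{(ep)_+}$ and $J_e(p)_\mu{}^\nu=\delta_\mu^\nu-p_\mu\frac{e^\nu}{(ep)_+}$. Let $E_e=(J_e\otimes J_e)\eta$ and, for $v\in\mathbb R^4$, $E_e(v)=v^\mu v^\nu (E_e)_{\mu\nu}$. For a tensor $X$ of rank $r$ write $X(v)=v^{\mu_1}\cdots v^{\mu_r}X_{\mu_1\dots\mu_r}$. Let $$\gamma^r_k=\frac{1}{4^kk!}\frac{r!}{(r-2k)!}\frac1{(1-r)_k}\quad(2k\le r),\qquad N_0^{(s,r)}=\Big[\tbinom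 sr\frac{\Gamma(\frac12+s)\Gamma(1+r)}{\Gamma(\frac12+\frac{r+s}2)\Gamma(1+\frac{r+s}2)}\Big]^{1/2}.$$ A hermitean free field is given by its intertwiner $u_n(e,p)$, the coefficient of $a_n^*(p)e^{ipx}$. The two-point kernel of two such fields $X,Y$ is $M^{X,Y}(p)=\sum_n\overline{u^X_n(p)}\,u^Y_n(p)$ (an integral if the label $n$ is continuous), so that $(\Omega,X(x)Y(y)\Omega)=\int d\mu_m(p)\,e^{-ip(x-y)}M^{X,Y}(p)$. **Massive fields.** For mass $m>0$ and spin $s$, the Proca field $A^{\mathrm P(s)}$ has intertwiner $(B_pE_3)^{\otimes s}T_n$. Here $B_p$ is any proper orthochronous Lorentz transformation with $B_p(m,0,0,0)^t=p$, $E_3:\mathbb R^3\to\mathbb R^4$ is the spatial embedding, and $(T_n)$ is any orthonormal basis of the symmetric traceless tensors in $(\mathbb R^3)^{\otimes s}$. Let $F^{\mathrm P(s)}_{[\mu_1\nu_1]\dots[\mu_s\nu_s]}$ be its total field strength (the curl in every index), and $$a^{(s,s)}_{\mu_1\dots\mu_s}=(I_e)^sF^{\mathrm P(s)}_{[\mu_1\nu_1]\dots[\mu_s\nu_s]}e^{\nu_1}\cdots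 e^{\nu_s},\qquad -m\,a^{(s,r)}_{\mu_1\dots\mu_r}=\partial^\mu a^{(s,r+1)}_{\mu\mu_1\dots\mu_r}\quad(0\le r<s),$$ $$A^{(s,r)}(e,x,v)=N_0^{(s,r)}\sum_{2k\le r}\gamma^r_k\,(-E_e(v))^k\,a^{(s,r-2k)}(e,x,v)\qquad(r\le s).$$ **Infinite-spin fields.** For $p\in H_0$ let $B_p$ be any proper orthochronous Lorentz transformation with $B_p(1,0,0,1)^t=p$. For $\vec k\in\kappa S^1\subset\mathbb R^2$ let $E_p(\vec k)=B_p(0,k^1,k^2,0)^t$, let $\mu_\kappa$ be the normalized rotation-invariant measure on $\kappa S^1$, and $$u^{\kappa(0)}(e,p)(\vec k)=e^{-i\kappa\frac{\sqrt{-e^2}}{(ep)_+}}e^{-i\frac{(eE_p(\vec k))}{(ep)_+}},\qquad u^{\kappa(r)}(e,p)(\vec k)=(-\kappa)^{-r}(J_e(p)E_p(\vec k))^{\otimes r}u^{\kappa(0)}(e,p)(\vec k).$$ $\Phi^{\kappa(r)}(e,x)$ is the field with the intertwiner $$U^{\kappa(r)}=2^{r/2}\Big(S_r\sum_{2k\le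 r}\gamma^r_k\,(J_e(p)^{\otimes2}\eta\circ\eta^t)^{\otimes k}\Big)u^{\kappa(r)},$$ where $S_r$ is the symmetrization, $\eta^t$ contracts a pair of indices, and $J_e(p)^{\otimes 2}\eta=E_e(p)$ restores the pair. **Statement.** Let $r,r'\ge0$, $v,v'\in\mathbb R^4$, and let $M_s(e,e',p)$ and $M(e,e',p)$ be the two-point kernels of the pairs of fields $$(1-m_s\sqrt{-e^2}\,I_{-e})^sA^{(s,r)}(-e,\cdot,v),\quad(1-m_s\sqrt{-e'^2}\,I_{e'})^sA^{(s,r')}(e',\cdot,v')$$ and $$\Phi^{\kappa(r)}(-e,\cdot,v),\quad\Phi^{\kappa(r')}(e',\cdot,v'),$$ respectively. Then, in the Pauli–Lubanski limit, the fields $(1-m\sqrt{-e^2}I_e)^sA^{(s,r)}$ converge to the fields $\Phi^{\kappa(r)}$ in the sense that their two-point kernels (which determine the free fields up to unitary equivalence) converge: 1. *(pointwise)* If $e,e'$ are spacelike, $p\in H_0$, $(ep)\ne0\ne(e'p)$, and $p_s\in H_{m_s}$ (for all large $s$) with $p_s\to p$, then $M_s(e,e',p_s)\to M(e,e',p)$.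 2. *(with test functions)* Let $f(e,e',p)$ be smooth and compactly supported, with $e,e'$ spacelike on its support, and with $(ep)\neq0\ne(e'p)$ at every point of its support with $p^2=0$, $p^0\ge0$ (so that $q_e(p)=\frac{e}{(ep)}$, $q_{e'}(p)=\frac{e'}{(e'p)}$ and $(q_e-q_{e'})^2$ are bounded there). Then $$\int d^4e\,d^4e'\int d\mu_{m_s}(p)\,f\,M_s\ \longrightarrow\ \int d^4e\,d^4e'\int d\mu_0(p)\,f\,M ,$$ where the integrals on the left (for all large $s$) and on the right converge absolutely. Moreover, $N_0^{(s,r)}/N_0^{(s,0)}\to2^{r/2}$ as $s\to\infty$. -/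

import Mathlib

open Filter Topology Complex
open scoped ContDiff

namespace PauliLubanski

noncomputable section

/-! Minkowski space, signature (+,-,-,-).  A vector is given by its contravariant components. -/

/-- Four-vectors. -/
abbrev Vec := Fin 4 → ℝ

/-- The Minkowski metric `η = diag(1,-1,-1,-1)`. -/
def eta : Matrix (Fin 4) (Fin 4) ℝ := Matrix.diagonal ![1, -1, -1, -1]

/-- The covariant components `x_μ = η_{μν} x^ν`. -/
def lower (x : Vec) : Vec := Matrix.mulVec eta x

/-- The Minkowski product `(xy) = x^μ y_μ`. -/
def mink (x y : Vec) : ℝ := ∑ μ, x μ * lower y μ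

/-- Proper orthochronous Lorentz transformations. -/
def IsLorentz (L : Matrix (Fin 4) (Fin 4) ℝ) : Prop :=
  L.transpose * eta * L = eta ∧ L.det = 1 ∧ 0 < L 0 0

/-- The mass shell `H_m = {p : p² = m², p⁰ > 0}`, for `m ≥ 0`. -/
def massShell (m : ℝ) : Set Vec := {p | mink p p = m ^ 2 ∧ 0 < p 0}

/-- A family of standard boosts for mass `m > 0`: `B_p (m,0,0,0) = p`. -/
def IsMassiveBoost (m : ℝ) (B : Vec → Matrix (Fin 4) (Fin 4) ℝ) : Prop :=
  ∀ p ∈ massShell m, IsLorentz (B p) ∧ Matrix.mulVec (B p) ![m, 0, 0, 0] = p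

/-- A family of standard boosts for mass `0`: `B_p (1,0,0,1) = p`. -/
def IsMasslessBoost (B : Vec → Matrix (Fin 4) (Fin 4) ℝ) : Prop :=
  ∀ p ∈ massShell 0, IsLorentz (B p) ∧ Matrix.mulVec (B p) ![1, 0, 0, 1] = p

/-- Complex covariant tensors of rank `r`, by components. -/
abbrev Tensor (r : ℕ) := (Fin r → Fin 4) → ℂ

/-- `X(v) = v^{μ₁} ⋯ v^{μᵣ} X_{μ₁⋯μᵣ}`. -/
def Tensor.eval {r : ℕ} (X : Tensor r) (v : Vec) : ℂ :=
  ∑ μ : Fin r → Fin 4, (∏ i, (v (μ i) : ℂ)) * X μ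

/-- The projection `S_r` onto symmetric tensors. -/
def symmetrize {r : ℕ} (X : Tensor r) : Tensor r := fun μ =>
  ((r.factorial : ℂ))⁻¹ * ∑ σ : Equiv.Perm (Fin r), X (μ ∘ σ)

/-! A free field `∫ dμ_m(p) ∑_n [u_n(e,p) a_n^*(p) e^{ipx} + h.c.]` is given by its intertwiner `u`.
On intertwiners a derivative `∂_μ` acts as multiplication by `i p_μ`, and the string integration
`(I_e X)(x) = ∫_0^∞ X(x + s e) ds` as multiplication by `i / (ep)_+`.  The distribution `1/(ep)_+`
is the function `1/(ep)` off the zeros of `(ep)`; intertwiners are only evaluated there. -/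

/-- String integration in momentum space. -/
def stringInt (e p : Vec) : ℂ := I / (mink e p : ℂ)

/-- `J_e(p)_μ{}^ν = δ_μ^ν - p_μ e^ν / (ep)`. -/
def J (e p : Vec) (μ ν : Fin 4) : ℝ :=
  (if μ = ν then 1 else 0) - lower p μ * e ν / mink e p

/-- `E_e(p)_{μμ'} = J_e(p)_μ{}^ν J_e(p)_{μ'}{}^{ν'} η_{νν'}`. -/
def EE (e p : Vec) (μ μ' : Fin 4) : ℝ :=
  ∑ ν, ∑ ν', J e p μ ν * J e p μ' ν' * eta ν ν'

/-- `E_e(v) = v^μ v^{μ'} E_e(p)_{μμ'}`. -/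
def EEval (e p v : Vec) : ℝ := ∑ μ, ∑ μ', v μ * v μ' * EE e p μ μ'

/-- `γ^r_k = r! / (4^k k! (r-2k)! (1-r)_k)`, used for `2k ≤ r`. -/
def gammaCoeff (r k : ℕ) : ℝ :=
  1 / (4 ^ k * (k.factorial : ℝ)) * ((r.factorial : ℝ) / ((r - 2 * k).factorial : ℝ))
    * (1 / (ascPochhammer ℝ k).eval (1 - (r : ℝ)))

/-! Massive fields of spin `s`. -/

/-- Symmetric traceless real tensors of rank `s` over `ℝ³`, the spin `s` representation space of
the little group `SO(3)`, with the standard inner product. -/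
def STF (s : ℕ) : Submodule ℝ (EuclideanSpace ℝ (Fin s → Fin 3)) where
  carrier := {t | (∀ (σ : Equiv.Perm (Fin s)) (a : Fin s → Fin 3), t (a ∘ σ) = t a) ∧
    ∀ i j : Fin s, i ≠ j → ∀ a : Fin s → Fin 3,
      ∑ c : Fin 3, t (Function.update (Function.update a i c) j c) = 0}
  add_mem' := by
    rintro x y ⟨hx, hx'⟩ ⟨hy, hy'⟩
    refine ⟨fun σ a => ?_, fun i j hij a => ?_⟩
    · simp [hx σ a, hy σ a]
    · simp [Finset.sum_add_distrib, hx' i j hij a, hy' i j hij a]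
  zero_mem' := by simp
  smul_mem' := by
    rintro c x ⟨hx, hx'⟩
    refine ⟨fun σ a => ?_, fun i j hij a => ?_⟩
    · simp [hx σ a]
    · simp [← Finset.mul_sum, hx' i j hij a]

/-- The component `(B_p E_3)^{⊗s} t` (covariant indices) of the Proca intertwiner, with `L = B_p`
and `E_3 : ℝ³ → ℝ⁴` the embedding as spatial vectors. -/
def proca (s : ℕ) (L : Matrix (Fin 4) (Fin 4) ℝ) (t : EuclideanSpace ℝ (Fin s → Fin 3)) :
    Tensor s := fun μ =>
  ∑ a : Fin s → Fin 3, (∏ i, (((eta * L) (μ i) (a i).succ : ℝ) : ℂ)) * ((t a : ℝ) : ℂ)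

/-- The total field strength `F_{[μ₁ν₁]⋯[μₛνₛ]}`: the curl `∂_μ X_ν - ∂_ν X_μ` in every index. -/
def fieldStrength {s : ℕ} (p : Vec) (X : Tensor s) (μ ν : Fin s → Fin 4) : ℂ :=
  ∑ l : Fin s → Fin 4, (∏ i,
    (I * (lower p (μ i) : ℂ) * (if ν i = l i then 1 else 0)
      - I * (lower p (ν i) : ℂ) * (if μ i = l i then 1 else 0))) * X l

/-- `a^{(s,s)}_{μ₁⋯μₛ} = (I_e)^s F_{[μ₁ν₁]⋯[μₛνₛ]} e^{ν₁} ⋯ e^{νₛ}`. -/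
def stringPotential {s : ℕ} (e p : Vec) (X : Tensor s) : Tensor s := fun μ =>
  stringInt e p ^ s * ∑ ν : Fin s → Fin 4, fieldStrength p X μ ν * ∏ i, (e (ν i) : ℂ)

/-- One step of `-m a^{(s,r)}_{μ₁⋯μᵣ} = ∂^μ a^{(s,r+1)}_{μμ₁⋯μᵣ}`. -/
def descend {r : ℕ} (m : ℝ) (p : Vec) (X : Tensor (r + 1)) : Tensor r := fun μ =>
  -(1 / (m : ℂ)) * ∑ l : Fin 4, I * (p l : ℂ) * X (Fin.cons l μ)

/-- `a^{(s,r)}`, for `r ≤ s` (set to `0` for `r > s`), as obtained from the Proca amplitude `X` by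
the descending recursion starting at `a^{(s,s)}`. -/
def escort (s r : ℕ) (m : ℝ) (e p : Vec) (X : Tensor s) : Tensor r :=
  if h : r ≤ s then
    Nat.decreasingInduction (motive := fun k _ => Tensor k)
      (fun _ _ Y => descend m p Y) (stringPotential e p X) h
  else 0

/-- The normalization constants `N_0^{(s,r)}`. -/
def N0 (s r : ℕ) : ℝ :=
  Real.sqrt ((s.choose r : ℝ) * (Real.Gamma (1 / 2 + s) * Real.Gamma (1 + r)
    / (Real.Gamma (1 / 2 + (r + s) / 2) * Real.Gamma (1 + (r + s) / 2))))

/-- `A^{(s,r)}(e,v) = N_0^{(s,r)} ∑_{2k ≤ r} γ^r_k (-E_e(v))^k a^{(s,r-2k)}(e,v)`. -/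
def fieldA (s r : ℕ) (m : ℝ) (e p v : Vec) (X : Tensor s) : ℂ :=
  (N0 s r : ℂ) * ∑ k ∈ Finset.range (r / 2 + 1),
    (gammaCoeff r k : ℂ) * (-(EEval e p v : ℂ)) ^ k * (escort s (r - 2 * k) m e p X).eval v

/-- The intertwiner component, for a polarization tensor `t` and the boost `L = B_p`, of
`(1 - m √(-e²) I_e)^s A^{(s,r)}(e,v)`. -/
def massiveIntertwiner (s r : ℕ) (m : ℝ) (L : Matrix (Fin 4) (Fin 4) ℝ)
    (t : EuclideanSpace ℝ (Fin s → Fin 3)) (e p v : Vec) : ℂ :=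
  (1 - (m : ℂ) * (Real.sqrt (-mink e e) : ℂ) * stringInt e p) ^ s
    * fieldA s r m e p v (proca s L t)

/-- The kernel `∑_n conj(u_n(e,p,v)) u'_n(e',p,v')` of the two-point function of the fields
`(1 - m √(-e²) I_e)^s A^{(s,r)}(e,v)` and `(1 - m √(-e'²) I_{e'})^s A^{(s,r')}(e',v')`. -/
def massiveKernel {ι : Type} [Fintype ι] (s r r' : ℕ) (m : ℝ)
    (B : Vec → Matrix (Fin 4) (Fin 4) ℝ) (T : ι → STF s) (e e' p v v' : Vec) : ℂ :=
  ∑ n : ι, (starRingEnd ℂ) (massiveIntertwiner s r m (B p) (T n : EuclideanSpace ℝ _) e p v)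
    * massiveIntertwiner s r' m (B p) (T n : EuclideanSpace ℝ _) e' p v'

/-! Infinite-spin fields.  The boost `L = B_p` is kept as an argument; `k ∈ κS¹ ⊆ ℝ²`. -/

/-- `E_p(k) = B_p (0,k¹,k²,0)`. -/
def Ep (L : Matrix (Fin 4) (Fin 4) ℝ) (k : Fin 2 → ℝ) : Vec :=
  Matrix.mulVec L ![0, k 0, k 1, 0]

/-- The standard intertwiner
`u^{κ(0)}(e,p)(k) = exp(-iκ √(-e²)/(ep)) exp(-i (e E_p(k))/(ep))`. -/
def u0 (κ : ℝ) (L : Matrix (Fin 4) (Fin 4) ℝ) (e p : Vec) (k : Fin 2 → ℝ) : ℂ :=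
  Complex.exp (-I * (κ : ℂ) * ((Real.sqrt (-mink e e) / mink e p : ℝ) : ℂ))
    * Complex.exp (-I * ((mink e (Ep L k) / mink e p : ℝ) : ℂ))

/-- `u^{κ(r)}(e,p)(k) = (-κ)^{-r} (J_e(p) E_p(k))^{⊗r} u^{κ(0)}(e,p)(k)`. -/
def ur (r : ℕ) (κ : ℝ) (L : Matrix (Fin 4) (Fin 4) ℝ) (e p : Vec) (k : Fin 2 → ℝ) : Tensor r :=
  fun μ => ((-κ : ℝ) : ℂ)⁻¹ ^ r
    * (∏ i, ((∑ ν, J e p (μ i) ν * lower (Ep L k) ν : ℝ) : ℂ)) * u0 κ L e p k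

/-- `(J_e^{⊗2} η) ∘ η^t` acting on the indices in the positions `i`, `j`: contraction with `η`,
then multiplication by `E_e(p)`. -/
def pairOp {r : ℕ} (e p : Vec) (i j : Fin r) (X : Tensor r) : Tensor r := fun μ =>
  (EE e p (μ i) (μ j) : ℂ) *
    ∑ a : Fin 4, ∑ b : Fin 4, (eta a b : ℂ) * X (Function.update (Function.update μ i a) j b)

/-- `(J_e^{⊗2} η ∘ η^t)^{⊗k}` acting on the first `2k` indices, for `2k ≤ r`. -/
def pairOps {r : ℕ} (e p : Vec) (X : Tensor r) : ℕ → Tensor r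
  | 0 => X
  | k + 1 =>
    if h : 2 * k + 1 < r then
      pairOp e p ⟨2 * k, Nat.lt_of_succ_lt h⟩ ⟨2 * k + 1, h⟩ (pairOps e p X k)
    else 0

/-- The intertwiner of `Φ^{κ(r)}`. -/
def Ur (r : ℕ) (κ : ℝ) (L : Matrix (Fin 4) (Fin 4) ℝ) (e p : Vec) (k : Fin 2 → ℝ) : Tensor r :=
  (((2 : ℝ) ^ ((r : ℝ) / 2) : ℝ) : ℂ) • symmetrize (∑ j ∈ Finset.range (r / 2 + 1),
    (gammaCoeff r j : ℂ) • pairOps e p (ur r κ L e p k) j)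

/-- The kernel `∫ dμ_κ(k) conj(U(e,p,v)(k)) U'(e',p,v')(k)` of the two-point function of
`Φ^{κ(r)}(e,v)` and `Φ^{κ(r')}(e',v')`; `μ_κ` is the normalized invariant measure on `κS¹`. -/
def infiniteSpinKernel (r r' : ℕ) (κ : ℝ) (B : Vec → Matrix (Fin 4) (Fin 4) ℝ)
    (e e' p v v' : Vec) : ℂ :=
  (1 / (2 * Real.pi) : ℝ) * ∫ φ in (0 : ℝ)..(2 * Real.pi),
    (starRingEnd ℂ) ((Ur r κ (B p) e p ![κ * Real.cos φ, κ * Real.sin φ]).eval v)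
      * (Ur r' κ (B p) e' p ![κ * Real.cos φ, κ * Real.sin φ]).eval v'

/-! The limit, and smearing with test functions. -/

/-- The mass `m = κ / √(s(s+1))` of the Pauli-Lubanski limit. -/
def plMass (κ : ℝ) (s : ℕ) : ℝ := κ / Real.sqrt (s * (s + 1))

/-- The energy `√(m² + |k|²)`. -/
def energy (m : ℝ) (k : Fin 3 → ℝ) : ℝ := Real.sqrt (m ^ 2 + ∑ i, k i ^ 2)

/-- The point of the mass shell over the three-momentum `k`. -/
def onShell (m : ℝ) (k : Fin 3 → ℝ) : Vec := Fin.cons (energy m k) k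

/-- The integrand, in `(e, e', k)`, of the pairing of a kernel `M(e,e',p)` with a test function `f`
with respect to `d⁴e d⁴e' dμ_m(p)`, where
`dμ_m(p) = (2π)^{-3} d⁴p δ(p²-m²) θ(p⁰) = (2π)^{-3} d³k / (2 √(m²+|k|²))`. -/
def smearIntegrand (m : ℝ) (f : Vec × Vec × Vec → ℂ) (M : Vec → Vec → Vec → ℂ)
    (z : Vec × Vec × (Fin 3 → ℝ)) : ℂ :=
  (1 / ((2 * Real.pi) ^ 3 * (2 * energy m z.2.2)) : ℝ)
    * f (z.1, z.2.1, onShell m z.2.2) * M z.1 z.2.1 (onShell m z.2.2)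

/-- Test functions: smooth, compactly supported, supported on spacelike `e`, `e'`, and such that on
the support `q_e = e/(ep)` and `q_{e'} = e'/(e'p)` are defined (hence bounded) for all `p` on the
closed forward light cone. -/
structure IsTestFunction (f : Vec × Vec × Vec → ℂ) : Prop where
  smooth : ContDiff ℝ ∞ f
  compact : HasCompactSupport f
  spacelike : ∀ z ∈ tsupport f, mink z.1 z.1 < 0 ∧ mink z.2.1 z.2.1 < 0
  regular : ∀ z ∈ tsupport f, mink z.2.2 z.2.2 = 0 → 0 ≤ z.2.2 0 →
    mink z.1 z.2.2 ≠ 0 ∧ mink z.2.1 z.2.2 ≠ 0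

end

end PauliLubanski

namespace PauliLubanski

noncomputable section

/-! ### Averages over the circle -/

/-- The average of `f` over `[0, 2π]`. -/
def circAvg (f : ℝ → ℂ) : ℂ := ((1 / (2 * Real.pi) : ℝ) : ℂ) * ∫ φ in (0 : ℝ)..(2 * Real.pi), f φ

/-- The point `exp(iφ)` of the unit circle. -/
def phase (φ : ℝ) : ℂ := Complex.exp (φ * I)

lemma phase_ne_zero (φ : ℝ) : phase φ ≠ 0 := Complex.exp_ne_zero _

lemma norm_phase (φ : ℝ) : ‖phase φ‖ = 1 := Complex.norm_exp_ofReal_mul_I φ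

@[fun_prop]
lemma continuous_phase : Continuous phase := by unfold phase; fun_prop

lemma phase_zpow (φ : ℝ) (n : ℤ) : phase φ ^ n = Complex.exp ((n * I) * φ) := by
  rw [phase, ← Complex.exp_int_mul]; ring_nf

lemma phase_eq (φ : ℝ) : phase φ = Real.cos φ + Real.sin φ * I := by
  rw [phase, Complex.exp_mul_I]; simp

lemma phase_inv_eq (φ : ℝ) : (phase φ)⁻¹ = Real.cos φ - Real.sin φ * I := by
  rw [phase, ← Complex.exp_neg, ← neg_mul, Complex.exp_mul_I]; simp; ring

lemma circAvg_congr {f g : ℝ → ℂ} (h : ∀ φ, f φ = g φ) : circAvg f = circAvg g := by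
  rw [funext h]

lemma circAvg_const_mul (c : ℂ) (f : ℝ → ℂ) : circAvg (fun φ => c * f φ) = c * circAvg f := by
  simp only [circAvg, intervalIntegral.integral_const_mul]; ring

lemma circAvg_const (c : ℂ) : circAvg (fun _ => c) = c := by
  have : (Real.pi : ℂ) ≠ 0 := by exact_mod_cast Real.pi_ne_zero
  simp [circAvg]
  field_simp

lemma circAvg_finset_sum {α : Type*} (s : Finset α) (f : α → ℝ → ℂ)
    (hf : ∀ i ∈ s, Continuous (f i)) :
    circAvg (fun φ => ∑ i ∈ s, f i φ) = ∑ i ∈ s, circAvg (f i) := by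
  simp only [circAvg]
  rw [intervalIntegral.integral_finsetSum, Finset.mul_sum]
  exact fun i hi => (hf i hi).intervalIntegrable _ _

lemma circAvg_phase_zpow (n : ℤ) : circAvg (fun φ => phase φ ^ n) = if n = 0 then 1 else 0 := by
  split_ifs with h
  · simp [h, circAvg_const]
  · have hn : (n : ℂ) * I ≠ 0 := by simp [h]
    simp only [circAvg, phase_zpow]
    rw [integral_exp_mul_complex hn]
    have : (n : ℂ) * I * ((2 * Real.pi : ℝ) : ℂ) = n * (2 * Real.pi * I) := by push_cast; ring
    rw [this, Complex.exp_int_mul_two_pi_mul_I]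
    simp

lemma circAvg_sum_zpow {α : Type*} (s : Finset α) (c : α → ℂ) (n : α → ℤ) :
    circAvg (fun φ => ∑ i ∈ s, c i * phase φ ^ n i) = ∑ i ∈ s, if n i = 0 then c i else 0 := by
  rw [circAvg_finset_sum]
  · refine Finset.sum_congr rfl fun i _ => ?_
    rw [circAvg_const_mul, circAvg_phase_zpow]
    simp
  · intro i _
    exact continuous_const.mul (continuous_phase.zpow₀ _ fun φ => Or.inl (phase_ne_zero φ))

lemma norm_circAvg_le {f : ℝ → ℂ} {C : ℝ} (h : ∀ φ, ‖f φ‖ ≤ C) : ‖circAvg f‖ ≤ C := by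
  have h1 := intervalIntegral.norm_integral_le_of_norm_le_const (a := 0) (b := 2 * Real.pi)
    (f := f) (C := C) fun φ _ => h φ
  have hpi := Real.pi_pos
  rw [sub_zero, abs_of_pos (by positivity)] at h1
  rw [circAvg, norm_mul, Complex.norm_real, Real.norm_of_nonneg (by positivity)]
  calc 1 / (2 * Real.pi) * ‖∫ φ in (0 : ℝ)..(2 * Real.pi), f φ‖
      ≤ 1 / (2 * Real.pi) * (C * (2 * Real.pi)) := by gcongr
    _ = C := by field_simp

lemma tendsto_circAvg {ι : Type*} {l : Filter ι} [l.IsCountablyGenerated] {F : ι → ℝ → ℂ}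
    {f : ℝ → ℂ} (C : ℝ) (hF : ∀ᶠ n in l, Continuous (F n)) (hC : ∀ᶠ n in l, ∀ φ, ‖F n φ‖ ≤ C)
    (h : ∀ φ, Tendsto (fun n => F n φ) l (𝓝 (f φ))) :
    Tendsto (fun n => circAvg (F n)) l (𝓝 (circAvg f)) := by
  refine Tendsto.const_mul _ ?_
  refine intervalIntegral.tendsto_integral_filter_of_dominated_convergence (fun _ => C) ?_ ?_ ?_ ?_
  · filter_upwards [hF] with n hn using hn.aestronglyMeasurable
  · filter_upwards [hC] with n hn using Filter.Eventually.of_forall fun φ _ => hn φ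
  · simp
  · exact Filter.Eventually.of_forall fun φ _ => h φ

lemma continuous_circAvg {X : Type*} [TopologicalSpace X] {f : X → ℝ → ℂ}
    (hf : Continuous (Function.uncurry f)) : Continuous fun x => circAvg (f x) :=
  continuous_const.mul
    (intervalIntegral.continuous_parametric_intervalIntegral_of_continuous' hf _ _)

lemma circAvg_swap {f : ℝ → ℝ → ℂ} (hf : Continuous (Function.uncurry f)) :
    circAvg (fun x => circAvg (fun y => f x y)) = circAvg (fun y => circAvg (fun x => f x y)) := by
  simp only [circAvg, intervalIntegral.integral_const_mul]
  congr 2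
  have h2 : (0 : ℝ) ≤ 2 * Real.pi := by positivity
  simp only [intervalIntegral.integral_of_le h2]
  refine MeasureTheory.integral_integral_swap ?_
  rw [MeasureTheory.Measure.prod_restrict]
  have : MeasureTheory.IntegrableOn (Function.uncurry f)
      (Set.Icc (0 : ℝ) (2 * Real.pi) ×ˢ Set.Icc (0 : ℝ) (2 * Real.pi))
      (MeasureTheory.volume.prod MeasureTheory.volume) :=
    hf.continuousOn.integrableOn_compact (isCompact_Icc.prod isCompact_Icc)
  exact this.mono_set (Set.prod_mono Set.Ioc_subset_Icc_self Set.Ioc_subset_Icc_self)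

/-! ### The trinomial sum of Laplace's integral -/

/-- `∑_j s! / ((s-2j)! j!²) A^{s-2j} d^j`, the constant term of `(A + c ζ + c' ζ⁻¹)^s` for
`c c' = d`. -/
def leg {R : Type*} [CommSemiring R] (s : ℕ) (A d : R) : R :=
  ∑ j ∈ Finset.range (s / 2 + 1), ((s.choose (2 * j) * (2 * j).choose j : ℕ) : R)
    * (A ^ (s - 2 * j) * d ^ j)

lemma sum_range_half {M : Type*} [AddCommMonoid M] (s : ℕ) (f : ℕ → ℕ → M) :
    ∑ m ∈ Finset.range (s + 1), ∑ i ∈ Finset.range (m + 1), (if 2 * i = m then f m i else 0)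
      = ∑ j ∈ Finset.range (s / 2 + 1), f (2 * j) j := by
  have h1 : ∀ m ∈ Finset.range (s + 1),
      ∑ i ∈ Finset.range (m + 1), (if 2 * i = m then f m i else 0)
        = ∑ i ∈ Finset.range (s + 1), (if 2 * i = m then f m i else 0) := by
    intro m hm
    rw [Finset.mem_range] at hm
    refine Finset.sum_subset (Finset.range_mono (by omega)) fun i _ hi => if_neg ?_
    rw [Finset.mem_range] at hi
    omega
  rw [Finset.sum_congr rfl h1, Finset.sum_comm]
  simp only [Finset.sum_ite_eq, Finset.mem_range]
  rw [← Finset.sum_filter]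
  refine Finset.sum_congr ?_ fun _ _ => rfl
  ext i
  simp only [Finset.mem_filter, Finset.mem_range]
  omega

lemma circAvg_trinomial {R : Type*} [CommRing R] [Algebra ℂ R] (Λ : R →ₗ[ℂ] ℂ) (s : ℕ)
    (Y a b : R) :
    circAvg (fun φ => Λ ((Y + phase φ • a + (phase φ)⁻¹ • b) ^ s)) = Λ (leg s Y (a * b)) := by
  have key : ∀ φ, Λ ((Y + phase φ • a + (phase φ)⁻¹ • b) ^ s)
      = ∑ x ∈ (Finset.range (s + 1)).sigma fun m => Finset.range (m + 1),
        Λ (a ^ x.2 * b ^ (x.1 - x.2) * (x.1.choose x.2 : R) * Y ^ (s - x.1) * (s.choose x.1 : R))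
          * phase φ ^ (2 * (x.2 : ℤ) - x.1) := by
    intro φ
    rw [add_assoc, add_comm Y, add_pow, Finset.sum_sigma, map_sum]
    refine Finset.sum_congr rfl fun m _ => ?_
    rw [add_pow, Finset.sum_mul, Finset.sum_mul, map_sum]
    refine Finset.sum_congr rfl fun i hi => ?_
    rw [Finset.mem_range] at hi
    have hz : phase φ ^ (2 * (i : ℤ) - m) = phase φ ^ i * (phase φ)⁻¹ ^ (m - i) := by
      rw [inv_pow, ← zpow_natCast, ← zpow_natCast, ← zpow_neg, ← zpow_add₀ (phase_ne_zero φ)]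
      congr 1
      push_cast [Nat.le_of_lt_succ hi]
      ring
    rw [hz, mul_comm (Λ _)]
    refine Eq.trans (congrArg Λ ?_) (Λ.map_smul (phase φ ^ i * (phase φ)⁻¹ ^ (m - i)) _)
    rw [smul_pow, smul_pow]
    simp only [Algebra.smul_def, map_mul]
    ring
  rw [circAvg_congr key, circAvg_sum_zpow, Finset.sum_sigma, leg, map_sum]
  have h2 : ∀ m i : ℕ, (2 * (i : ℤ) - m = 0) = (2 * i = m) := fun m i => by
    simp only [eq_iff_iff]; omega
  simp only [h2]
  rw [sum_range_half s fun m i =>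
    Λ (a ^ i * b ^ (m - i) * (m.choose i : R) * Y ^ (s - m) * (s.choose m : R))]
  refine Finset.sum_congr rfl fun j _ => ?_
  rw [show 2 * j - j = j by omega]
  congr 1
  push_cast
  ring

lemma circAvg_trinomial' (s : ℕ) (Y a b : ℂ) :
    circAvg (fun φ => (Y + phase φ * a + (phase φ)⁻¹ * b) ^ s) = leg s Y (a * b) :=
  circAvg_trinomial LinearMap.id s Y a b

/-- The value `binom(2s,s) / 2^s = (2s-1)!! / s!`. -/
def legNorm (s : ℕ) : ℝ := (2 * s).choose s / 2 ^ s

lemma legNorm_pos (s : ℕ) : 0 < legNorm s := by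
  have := Nat.choose_pos (show s ≤ 2 * s by omega)
  unfold legNorm
  positivity

lemma leg_one_quarter (s : ℕ) : leg s (1 : ℂ) (1 / 4) = legNorm s := by
  have h := circAvg_trinomial' s 1 (1 / 2) (1 / 2)
  rw [show (1 / 2 * (1 / 2) : ℂ) = 1 / 4 by norm_num] at h
  rw [← h]
  have key : ∀ φ, (1 + phase φ * (1 / 2) + (phase φ)⁻¹ * (1 / 2)) ^ s
      = ∑ m ∈ Finset.range (2 * s + 1), ((2 * s).choose m / 2 ^ s : ℂ)
        * phase φ ^ ((m : ℤ) - s) := by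
    intro φ
    have h0 := phase_ne_zero φ
    have : (1 + phase φ * (1 / 2) + (phase φ)⁻¹ * (1 / 2))
        = (phase φ + 1) ^ 2 * (2⁻¹ * (phase φ)⁻¹) := by field_simp; ring
    rw [this, mul_pow, ← pow_mul, add_pow, Finset.sum_mul]
    refine Finset.sum_congr rfl fun m _ => ?_
    rw [zpow_sub₀ h0, zpow_natCast, zpow_natCast, mul_pow, inv_pow, inv_pow]
    simp only [one_pow]
    field_simp
  rw [circAvg_congr key, circAvg_sum_zpow]
  have h2 : ∀ m : ℕ, ((m : ℤ) - s = 0) = (s = m) := fun m => by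
    simp only [eq_iff_iff]; omega
  simp only [h2]
  rw [Finset.sum_ite_eq, if_pos (Finset.mem_range.2 (by omega)), legNorm]
  push_cast
  ring

lemma leg_mul {R : Type*} [CommSemiring R] (s : ℕ) (c A d : R) :
    leg s (c * A) (c ^ 2 * d) = c ^ s * leg s A d := by
  rw [leg, leg, Finset.mul_sum]
  refine Finset.sum_congr rfl fun j hj => ?_
  rw [Finset.mem_range] at hj
  obtain ⟨k, hk⟩ : ∃ k, s = k + 2 * j := ⟨s - 2 * j, by omega⟩
  rw [show s - 2 * j = k by omega, mul_pow, mul_pow, ← pow_mul, hk, pow_add]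
  ring

lemma leg_sq_quarter {R : Type*} [CommRing R] [Algebra ℂ R] (s : ℕ) (Y : R) :
    leg s Y (algebraMap ℂ R (1 / 4) * Y ^ 2) = algebraMap ℂ R (legNorm s) * Y ^ s := by
  have h := leg_mul s Y 1 (algebraMap ℂ R (1 / 4))
  rw [mul_one, mul_comm (Y ^ 2)] at h
  rw [h, mul_comm, ← leg_one_quarter, leg, leg, map_sum]
  simp only [map_mul, map_pow, map_natCast, map_one]

/-! ### Symmetric traceless tensors -/

/-- The full contraction of a tensor with the vectors `x i`. -/
def pairing {s : ℕ} (t : (Fin s → Fin 3) → ℂ) (x : Fin s → Fin 3 → ℂ) : ℂ :=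
  ∑ a, (∏ i, x i (a i)) * t a

/-- Complex symmetric traceless tensors. -/
def IsSTF {s : ℕ} (t : (Fin s → Fin 3) → ℂ) : Prop :=
  (∀ (σ : Equiv.Perm (Fin s)) (a : Fin s → Fin 3), t (a ∘ σ) = t a) ∧
    ∀ i j : Fin s, i ≠ j → ∀ a : Fin s → Fin 3,
      ∑ c : Fin 3, t (Function.update (Function.update a i c) j c) = 0

lemma isSTF_of_mem {s : ℕ} {t : EuclideanSpace ℝ (Fin s → Fin 3)} (ht : t ∈ STF s) :
    IsSTF fun a => ((t a : ℝ) : ℂ) := by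
  refine ⟨fun σ a => congrArg _ (ht.1 σ a), fun i j hij a => ?_⟩
  have := congrArg (fun r : ℝ => (r : ℂ)) (ht.2 i j hij a)
  simpa using this

/-- The multiplicities of the values of a word. -/
def content {s : ℕ} (a : Fin s → Fin 3) : Fin 3 →₀ ℕ := ∑ i, Finsupp.single (a i) 1

lemma content_apply {s : ℕ} (a : Fin s → Fin 3) (c : Fin 3) :
    content a c = Fintype.card {i // a i = c} := by
  simp only [content, Finsupp.finsetSum_apply, Finsupp.single_apply]
  rw [Finset.sum_boole, Fintype.card_subtype]
  simp

lemma exists_perm_of_content_eq {s : ℕ} {a b : Fin s → Fin 3} (h : content a = content b) :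
    ∃ σ : Equiv.Perm (Fin s), a = b ∘ σ := by
  have e : ∀ c, Nonempty ({i // a i = c} ≃ {i // b i = c}) := fun c => by
    rw [← Fintype.card_eq, ← content_apply, ← content_apply, h]
  refine ⟨Equiv.ofFiberEquiv fun c => (e c).some, funext fun i => ?_⟩
  exact (Equiv.ofFiberEquiv_map (fun c => (e c).some) i).symm

lemma content_update {s : ℕ} (a : Fin s → Fin 3) (i : Fin s) (c : Fin 3) :
    content (Function.update a i c) + Finsupp.single (a i) 1
      = content a + Finsupp.single c 1 := by
  have h : ∀ b : Fin s → Fin 3, content b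
      = Finsupp.single (b i) 1 + ∑ j ∈ Finset.univ.erase i, Finsupp.single (b j) 1 := fun b =>
    (Finset.add_sum_erase _ _ (Finset.mem_univ i)).symm
  rw [h (Function.update a i c), h a]
  have : ∑ j ∈ Finset.univ.erase i, Finsupp.single (Function.update a i c j) 1
      = ∑ j ∈ Finset.univ.erase i, Finsupp.single (a j) (1 : ℕ) :=
    Finset.sum_congr rfl fun j hj => by rw [Function.update_of_ne (Finset.ne_of_mem_erase hj)]
  rw [this, Function.update_self]
  abel

open Classical in
/-- The linear functional on polynomials whose values on monomials are the components of `t`. -/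
def polyFunctional {s : ℕ} (t : (Fin s → Fin 3) → ℂ) : MvPolynomial (Fin 3) ℂ →ₗ[ℂ] ℂ :=
  (MvPolynomial.basisMonomials (Fin 3) ℂ).constr ℂ fun m =>
    if h : ∃ a : Fin s → Fin 3, content a = m then t h.choose else 0

lemma polyFunctional_monomial {s : ℕ} {t : (Fin s → Fin 3) → ℂ} (ht : IsSTF t)
    (a : Fin s → Fin 3) : polyFunctional t (MvPolynomial.monomial (content a) 1) = t a := by
  have h : ∃ b : Fin s → Fin 3, content b = content a := ⟨a, rfl⟩
  obtain ⟨σ, hσ⟩ := exists_perm_of_content_eq h.choose_spec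
  have := (MvPolynomial.basisMonomials (Fin 3) ℂ).constr_basis ℂ
    (fun m => if h : ∃ a : Fin s → Fin 3, content a = m then t h.choose else 0) (content a)
  rw [MvPolynomial.coe_basisMonomials] at this
  rw [polyFunctional, this, dif_pos h, hσ, ht.1]

lemma polyFunctional_monomial_of_not {s : ℕ} (t : (Fin s → Fin 3) → ℂ) {m : Fin 3 →₀ ℕ}
    (h : ¬ ∃ a : Fin s → Fin 3, content a = m) :
    polyFunctional t (MvPolynomial.monomial m 1) = 0 := by
  have := (MvPolynomial.basisMonomials (Fin 3) ℂ).constr_basis ℂ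
    (fun m => if h : ∃ a : Fin s → Fin 3, content a = m then t h.choose else 0) m
  rw [MvPolynomial.coe_basisMonomials] at this
  rw [polyFunctional, this, dif_neg h]

/-- The linear form with coefficients `x`. -/
def linForm (x : Fin 3 → ℂ) : MvPolynomial (Fin 3) ℂ := ∑ c, x c • MvPolynomial.X c

lemma linForm_add (x y : Fin 3 → ℂ) : linForm (x + y) = linForm x + linForm y := by
  simp [linForm, add_smul, Finset.sum_add_distrib]

lemma linForm_smul (c : ℂ) (x : Fin 3 → ℂ) : linForm (c • x) = c • linForm x := by
  simp [linForm, mul_smul, Finset.smul_sum]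

/-- The quadratic form `∑ X_c²`. -/
def quadForm : MvPolynomial (Fin 3) ℂ := ∑ c, MvPolynomial.X c ^ 2

lemma polyFunctional_prod {s : ℕ} {t : (Fin s → Fin 3) → ℂ} (ht : IsSTF t)
    (x : Fin s → Fin 3 → ℂ) : polyFunctional t (∏ i, linForm (x i)) = pairing t x := by
  simp only [linForm]
  rw [Finset.prod_univ_sum, Fintype.piFinset_univ, map_sum, pairing]
  refine Finset.sum_congr rfl fun a _ => ?_
  rw [Finset.prod_smul, LinearMap.map_smul, smul_eq_mul, ← polyFunctional_monomial ht a, content,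
    MvPolynomial.monomial_sum_one]
  rfl

lemma polyFunctional_quadForm_mul {s : ℕ} {t : (Fin s → Fin 3) → ℂ} (ht : IsSTF t)
    (q : MvPolynomial (Fin 3) ℂ) : polyFunctional t (quadForm * q) = 0 := by
  suffices h : polyFunctional t ∘ₗ LinearMap.mulLeft ℂ quadForm = 0 from LinearMap.congr_fun h q
  refine (MvPolynomial.basisMonomials (Fin 3) ℂ).ext fun m => ?_
  have h1 : quadForm * MvPolynomial.monomial m (1 : ℂ)
      = ∑ c, MvPolynomial.monomial (Finsupp.single c 2 + m) 1 := by
    rw [quadForm, Finset.sum_mul]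
    refine Finset.sum_congr rfl fun c _ => ?_
    rw [MvPolynomial.X_pow_eq_monomial, MvPolynomial.monomial_mul, one_mul]
  simp only [MvPolynomial.coe_basisMonomials, LinearMap.coe_comp, Function.comp_apply,
    LinearMap.mulLeft_apply, LinearMap.zero_apply, h1, map_sum]
  by_cases h : ∃ c, ∃ a : Fin s → Fin 3, content a = Finsupp.single c 2 + m
  · obtain ⟨c, a, ha⟩ := h
    have hcard : 1 < Fintype.card {i // a i = c} := by
      rw [← content_apply, ha]; simp; omega
    obtain ⟨⟨i, hi⟩, ⟨j, hj⟩, hij⟩ := Fintype.one_lt_card_iff.1 hcard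
    have hij : i ≠ j := fun h => hij (by simp [h])
    rw [← ht.2 i j hij a]
    refine Finset.sum_congr rfl fun d _ => ?_
    rw [← polyFunctional_monomial ht]
    refine congrArg (fun k => polyFunctional t (MvPolynomial.monomial k 1)) ?_
    have e1 := content_update a i d
    have e2 := content_update (Function.update a i d) j d
    rw [Function.update_of_ne hij.symm, hj] at e2
    rw [hi] at e1
    have e3 : Finsupp.single c 2 = Finsupp.single c 1 + Finsupp.single c (1 : ℕ) := by
      rw [← Finsupp.single_add]
    have e4 : Finsupp.single d 2 = Finsupp.single d 1 + Finsupp.single d (1 : ℕ) := by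
      rw [← Finsupp.single_add]
    refine add_right_cancel (b := Finsupp.single c 1 + Finsupp.single c (1 : ℕ)) ?_
    calc Finsupp.single d 2 + m + (Finsupp.single c 1 + Finsupp.single c 1)
        = content a + Finsupp.single d 1 + Finsupp.single d 1 := by rw [ha, e3, e4]; abel
      _ = content (Function.update a i d) + Finsupp.single d 1 + Finsupp.single c 1 := by
        rw [← e1]; abel
      _ = content (Function.update (Function.update a i d) j d)
          + (Finsupp.single c 1 + Finsupp.single c 1) := by rw [← e2]; abel
  · push Not at h
    exact Finset.sum_eq_zero fun c _ => polyFunctional_monomial_of_not t fun ⟨a, ha⟩ => h c a ha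

lemma leg_sub_dvd {R : Type*} [CommRing R] (s : ℕ) (A d d' : R) :
    d - d' ∣ leg s A d - leg s A d' := by
  rw [leg, leg, ← Finset.sum_sub_distrib]
  refine Finset.dvd_sum fun j _ => ?_
  rw [← mul_sub, ← mul_sub]
  exact ((sub_dvd_pow_sub_pow d d' j).mul_left _).mul_left _

/-! ### Orthonormal frames and null vectors -/

/-- The rows `y`, `u`, `w` form a complex orthogonal matrix. -/
def IsFrame (y u w : Fin 3 → ℂ) : Prop :=
  ∀ c d, y c * y d + u c * u d + w c * w d = if c = d then 1 else 0

lemma isFrame_reflection (n : Fin 3 → ℂ) (k : ℂ) (hk : k * (n 0 ^ 2 + n 1 ^ 2 + n 2 ^ 2) = 2) :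
    IsFrame (fun c => (if c = 2 then 1 else 0) - k * n 2 * n c)
      (fun c => (if c = 0 then 1 else 0) - k * n 0 * n c)
      (fun c => (if c = 1 then 1 else 0) - k * n 1 * n c) := by
  intro c d
  fin_cases c <;> fin_cases d <;> simp <;>
  [linear_combination k * n 0 * n 0 * hk; linear_combination k * n 0 * n 1 * hk;
   linear_combination k * n 0 * n 2 * hk; linear_combination k * n 1 * n 0 * hk;
   linear_combination k * n 1 * n 1 * hk; linear_combination k * n 1 * n 2 * hk;
   linear_combination k * n 2 * n 0 * hk; linear_combination k * n 2 * n 1 * hk;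
   linear_combination k * n 2 * n 2 * hk]

lemma exists_isFrame (y : Fin 3 → ℂ) (hy : y ⬝ᵥ y = 1) : ∃ u w, IsFrame y u w := by
  simp only [dotProduct, Fin.sum_univ_three] at hy
  by_cases h : y 2 = 1
  · have hk := isFrame_reflection ![y 0, y 1, y 2 + 1] (1 / 2) (by
      simp; rw [h] at hy ⊢; linear_combination hy / 2)
    obtain ⟨u, w, hf⟩ : ∃ u w, IsFrame (-y) u w := by
      suffices e : -y = _ by rw [e]; exact ⟨_, _, hk⟩
      ext c
      fin_cases c <;> simp [h] <;> ring
    exact ⟨u, w, fun c d => by simpa using hf c d⟩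
  · have h' : 1 - y 2 ≠ 0 := fun h' => h (by linear_combination -h')
    have hk := isFrame_reflection ![y 0, y 1, y 2 - 1] (1 / (1 - y 2)) (by
      simp; field_simp; linear_combination hy)
    suffices e : y = _ by rw [e]; exact ⟨_, _, hk⟩
    ext c
    fin_cases c <;> simp <;> field_simp <;> ring

lemma IsFrame.matrix {y u w : Fin 3 → ℂ} (h : IsFrame y u w) :
    Matrix.of ![y, u, w] * (Matrix.of ![y, u, w]).transpose = 1 := by
  rw [mul_eq_one_comm]
  ext c d
  have := h c d
  simp only [Matrix.mul_apply, Fin.sum_univ_three, Matrix.transpose_apply, Matrix.of_apply,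
    Matrix.one_apply]
  simpa using this

lemma IsFrame.dot {y u w : Fin 3 → ℂ} (h : IsFrame y u w) :
    y ⬝ᵥ y = 1 ∧ u ⬝ᵥ u = 1 ∧ w ⬝ᵥ w = 1 ∧ y ⬝ᵥ u = 0 ∧ y ⬝ᵥ w = 0 ∧ u ⬝ᵥ w = 0 := by
  have e := h.matrix
  have f : ∀ i j, (Matrix.of ![y, u, w] i) ⬝ᵥ (Matrix.of ![y, u, w] j)
      = (1 : Matrix (Fin 3) (Fin 3) ℂ) i j := fun i j => by rw [← e]; rfl
  exact ⟨f 0 0, f 1 1, f 2 2, f 0 1, f 0 2, f 1 2⟩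

/-- The null vector `y + i (cos φ u + sin φ w)`. -/
def nullVec (y u w : Fin 3 → ℂ) (φ : ℝ) : Fin 3 → ℂ :=
  y + phase φ • ((I / 2) • (u - I • w)) + (phase φ)⁻¹ • ((I / 2) • (u + I • w))

lemma IsFrame.nullVec_null {y u w : Fin 3 → ℂ} (h : IsFrame y u w) (φ : ℝ) :
    ∑ c, nullVec y u w φ c * nullVec y u w φ c = 0 := by
  obtain ⟨h1, h2, h3, h4, h5, h6⟩ := h.dot
  have hz : phase φ * (phase φ)⁻¹ = 1 := mul_inv_cancel₀ (phase_ne_zero φ)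
  have hI : I ^ 2 + 1 = 0 := by rw [Complex.I_sq]; ring
  change nullVec y u w φ ⬝ᵥ nullVec y u w φ = 0
  simp only [nullVec, add_dotProduct, dotProduct_add, sub_dotProduct, dotProduct_sub,
    smul_dotProduct, dotProduct_smul, smul_eq_mul, dotProduct_comm u y, dotProduct_comm w y,
    dotProduct_comm w u, h1, h2, h3, h4, h5, h6]
  generalize phase φ = z at *
  generalize z⁻¹ = z' at *
  linear_combination ((z ^ 2 + z' ^ 2) * I ^ 2 / 4 + z * z' / 2 * (2 - I ^ 2)) * hI - hz

lemma IsFrame.dot_mul_dot {y u w : Fin 3 → ℂ} (h : IsFrame y u w) (x : Fin 3 → ℂ) :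
    (x ⬝ᵥ u) ^ 2 + (x ⬝ᵥ w) ^ 2 = x ⬝ᵥ x - (x ⬝ᵥ y) ^ 2 := by
  simp only [dotProduct, Fin.sum_univ_three]
  have e00 := h 0 0; have e01 := h 0 1; have e02 := h 0 2
  have e11 := h 1 1; have e12 := h 1 2; have e22 := h 2 2
  simp at e00 e01 e02 e11 e12 e22
  linear_combination x 0 ^ 2 * e00 + x 1 ^ 2 * e11 + x 2 ^ 2 * e22 + 2 * x 0 * x 1 * e01
    + 2 * x 0 * x 2 * e02 + 2 * x 1 * x 2 * e12

lemma IsFrame.linForm_sq {y u w : Fin 3 → ℂ} (h : IsFrame y u w) :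
    linForm u ^ 2 + linForm w ^ 2 = quadForm - linForm y ^ 2 := by
  have key : ∀ c d, (MvPolynomial.C (y c) * MvPolynomial.C (y d)
      + MvPolynomial.C (u c) * MvPolynomial.C (u d)
      + MvPolynomial.C (w c) * MvPolynomial.C (w d) : MvPolynomial (Fin 3) ℂ)
      = (if c = d then 1 else 0 : MvPolynomial (Fin 3) ℂ) := by
    intro c d
    rw [← map_mul, ← map_mul, ← map_mul, ← map_add, ← map_add, h c d]
    split_ifs <;> simp
  have e00 := key 0 0; have e01 := key 0 1; have e02 := key 0 2
  have e11 := key 1 1; have e12 := key 1 2; have e22 := key 2 2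
  simp at e00 e01 e02 e11 e12 e22
  simp only [linForm, quadForm, Fin.sum_univ_three, MvPolynomial.smul_eq_C_mul]
  generalize (MvPolynomial.X 0 : MvPolynomial (Fin 3) ℂ) = X0
  generalize (MvPolynomial.X 1 : MvPolynomial (Fin 3) ℂ) = X1
  generalize (MvPolynomial.X 2 : MvPolynomial (Fin 3) ℂ) = X2
  linear_combination X0 ^ 2 * e00 + X1 ^ 2 * e11 + X2 ^ 2 * e22 + 2 * X0 * X1 * e01
    + 2 * X0 * X2 * e02 + 2 * X1 * X2 * e12

/-! ### The addition theorem -/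

lemma pairing_nullVec_circAvg {s : ℕ} {t : (Fin s → Fin 3) → ℂ} (ht : IsSTF t)
    {y u w : Fin 3 → ℂ} (h : IsFrame y u w) :
    circAvg (fun φ => pairing t fun _ => nullVec y u w φ)
      = legNorm s * pairing t fun _ => y := by
  have h1 : ∀ φ, pairing t (fun _ => nullVec y u w φ) = polyFunctional t
      ((linForm y + phase φ • linForm ((I / 2) • (u - I • w))
        + (phase φ)⁻¹ • linForm ((I / 2) • (u + I • w))) ^ s) := by
    intro φ
    rw [← polyFunctional_prod ht, Finset.prod_const, Finset.card_univ, Fintype.card_fin, nullVec,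
      linForm_add, linForm_add, linForm_smul (phase φ), linForm_smul (phase φ)⁻¹]
  rw [circAvg_congr h1, circAvg_trinomial]
  have h2 : linForm ((I / 2) • (u - I • w)) * linForm ((I / 2) • (u + I • w))
      = algebraMap ℂ _ (1 / 4) * linForm y ^ 2 - algebraMap ℂ _ (1 / 4) * quadForm := by
    have e := h.linForm_sq
    have hI : (algebraMap ℂ (MvPolynomial (Fin 3) ℂ) I) ^ 2 = -1 := by
      rw [← map_pow, Complex.I_sq, map_neg, map_one]
    have e2 : algebraMap ℂ (MvPolynomial (Fin 3) ℂ) (I / 2)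
        = algebraMap ℂ _ (1 / 2) * algebraMap ℂ _ I := by rw [← map_mul]; congr 1; ring
    have e3 : (algebraMap ℂ (MvPolynomial (Fin 3) ℂ) (1 / 2)) ^ 2 = algebraMap ℂ _ (1 / 4) := by
      rw [← map_pow]; congr 1; norm_num
    rw [linForm_smul, linForm_smul, sub_eq_add_neg, linForm_add, linForm_add, ← neg_smul,
      linForm_smul, linForm_smul]
    simp only [Algebra.smul_def, map_neg]
    rw [e2, ← e3]
    generalize algebraMap ℂ (MvPolynomial (Fin 3) ℂ) I = J at *
    generalize algebraMap ℂ (MvPolynomial (Fin 3) ℂ) (1 / 2) = K at *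
    linear_combination (K ^ 2 * linForm u ^ 2 - K ^ 2 * linForm w ^ 2 * (J ^ 2 - 1)) * hI
      - K ^ 2 * e
  have h3 := leg_sub_dvd s (linForm y) (algebraMap ℂ _ (1 / 4) * linForm y ^ 2
    - algebraMap ℂ _ (1 / 4) * quadForm) (algebraMap ℂ _ (1 / 4) * linForm y ^ 2)
  obtain ⟨q, hq⟩ := h3
  rw [h2, sub_eq_iff_eq_add.1 hq, map_add, leg_sq_quarter,
    ← Algebra.smul_def (legNorm s : ℂ) (linForm y ^ s), LinearMap.map_smul, smul_eq_mul]
  have h4 : (algebraMap ℂ (MvPolynomial (Fin 3) ℂ) (1 / 4) * linForm y ^ 2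
      - algebraMap ℂ _ (1 / 4) * quadForm - algebraMap ℂ _ (1 / 4) * linForm y ^ 2) * q
      = quadForm * (-algebraMap ℂ _ (1 / 4) * q) := by ring
  rw [h4, polyFunctional_quadForm_mul ht, zero_add, ← polyFunctional_prod ht, Finset.prod_const,
    Finset.card_univ, Fintype.card_fin]

lemma isSTF_null_pow (s : ℕ) {ν : Fin 3 → ℂ} (hν : ∑ c, ν c * ν c = 0) :
    IsSTF fun a : Fin s → Fin 3 => ∏ i, ν (a i) := by
  refine ⟨fun σ a => Equiv.prod_comp σ fun i => ν (a i), fun i j hij a => ?_⟩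
  have h : ∀ c, ∏ l, ν (Function.update (Function.update a i c) j c l)
      = ν c * ν c * ∏ l ∈ (Finset.univ.erase i).erase j, ν (a l) := by
    intro c
    rw [← Finset.mul_prod_erase _ _ (Finset.mem_univ i),
      ← Finset.mul_prod_erase _ _ (Finset.mem_erase.2 ⟨hij.symm, Finset.mem_univ j⟩),
      Function.update_self, Function.update_of_ne hij, Function.update_self, mul_assoc]
    congr 2
    refine Finset.prod_congr rfl fun l hl => ?_
    rw [Finset.mem_erase, Finset.mem_erase] at hl
    rw [Function.update_of_ne hl.1, Function.update_of_ne hl.2.1]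
  simp only [h, ← Finset.sum_mul, hν, zero_mul]

lemma continuous_nullVec (y u w : Fin 3 → ℂ) : Continuous (nullVec y u w) := by
  unfold nullVec
  have : Continuous fun φ => (phase φ)⁻¹ := continuous_phase.inv₀ phase_ne_zero
  fun_prop

lemma isSTF_circAvg {s : ℕ} {t : ℝ → (Fin s → Fin 3) → ℂ} (ht : ∀ φ, IsSTF (t φ))
    (hc : ∀ a, Continuous fun φ => t φ a) : IsSTF fun a => circAvg fun φ => t φ a := by
  refine ⟨fun σ a => circAvg_congr fun φ => (ht φ).1 σ a, fun i j hij a => ?_⟩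
  rw [← circAvg_finset_sum _ _ fun c _ => hc _]
  simp only [(ht _).2 i j hij a]
  exact circAvg_const 0

lemma sum_projection_real {s : ℕ} {ι : Type} [Fintype ι] (T : OrthonormalBasis ι ℝ (STF s))
    {t : EuclideanSpace ℝ (Fin s → Fin 3)} (ht : t ∈ STF s) (b : Fin s → Fin 3) :
    ∑ n, (T n : EuclideanSpace ℝ (Fin s → Fin 3)) b
      * ∑ a, (T n : EuclideanSpace ℝ (Fin s → Fin 3)) a * t a = t b := by
  have h := T.sum_repr' ⟨t, ht⟩
  have h2 := congrArg (fun v : STF s => (v : EuclideanSpace ℝ (Fin s → Fin 3)) b) h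
  simp only [Submodule.coe_sum, Submodule.coe_smul, Submodule.coe_inner,
    PiLp.inner_apply, RCLike.inner_apply, conj_trivial, WithLp.ofLp_sum, WithLp.ofLp_smul,
    Finset.sum_apply, Pi.smul_apply, smul_eq_mul] at h2
  rw [← h2]
  refine Finset.sum_congr rfl fun n _ => ?_
  rw [mul_comm]
  congr 1
  exact Finset.sum_congr rfl fun a _ => mul_comm _ _

/-- The complexified components of a real tensor. -/
def complexify {s : ℕ} (t : STF s) : (Fin s → Fin 3) → ℂ :=
  fun a => (((t : EuclideanSpace ℝ (Fin s → Fin 3)) a : ℝ) : ℂ)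

lemma sum_projection {s : ℕ} {ι : Type} [Fintype ι] (T : OrthonormalBasis ι ℝ (STF s))
    {t : (Fin s → Fin 3) → ℂ} (ht : IsSTF t) (b : Fin s → Fin 3) :
    ∑ n, complexify (T n) b * ∑ a, complexify (T n) a * t a = t b := by
  have hre : (WithLp.toLp 2 fun a => (t a).re) ∈ STF s :=
    ⟨fun σ a => congrArg Complex.re (ht.1 σ a), fun i j hij a => by
      have := congrArg Complex.re (ht.2 i j hij a)
      simpa using this⟩
  have him : (WithLp.toLp 2 fun a => (t a).im) ∈ STF s :=
    ⟨fun σ a => congrArg Complex.im (ht.1 σ a), fun i j hij a => by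
      have := congrArg Complex.im (ht.2 i j hij a)
      simpa using this⟩
  have h1 := sum_projection_real T hre b
  have h2 := sum_projection_real T him b
  apply Complex.ext
  · simpa [complexify] using h1
  · simpa [complexify] using h2

lemma pairing_const_smul {s : ℕ} (t : (Fin s → Fin 3) → ℂ) (c : ℂ) (y : Fin 3 → ℂ) :
    pairing t (fun _ => c • y) = c ^ s * pairing t fun _ => y := by
  simp only [pairing, Pi.smul_apply, smul_eq_mul, Finset.prod_mul_distrib, Finset.prod_const,
    Finset.card_univ, Fintype.card_fin, Finset.mul_sum, mul_assoc]

lemma sum_prod_eq_dotProduct_pow {s : ℕ} (x y : Fin 3 → ℂ) :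
    ∑ a : Fin s → Fin 3, (∏ i, x (a i)) * ∏ i, y (a i) = (x ⬝ᵥ y) ^ s := by
  simp only [← Finset.prod_mul_distrib]
  rw [← Fintype.piFinset_univ, Finset.sum_prod_piFinset Finset.univ fun _ c => x c * y c]
  simp [dotProduct]

lemma sum_pairing_mul_stf {s : ℕ} {ι : Type} [Fintype ι] (T : OrthonormalBasis ι ℝ (STF s))
    (x : Fin 3 → ℂ) {t : (Fin s → Fin 3) → ℂ} (ht : IsSTF t) :
    ∑ n, pairing (complexify (T n)) (fun _ => x) * ∑ a, complexify (T n) a * t a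
      = ∑ a, (∏ i, x (a i)) * t a := by
  simp only [pairing, Finset.sum_mul]
  rw [Finset.sum_comm]
  refine Finset.sum_congr rfl fun b _ => ?_
  rw [← sum_projection T ht b, Finset.mul_sum]
  exact Finset.sum_congr rfl fun n _ => mul_assoc _ _ _

theorem sum_pairing_mul_pairing {s : ℕ} {ι : Type} [Fintype ι]
    (T : OrthonormalBasis ι ℝ (STF s)) (x y : Fin 3 → ℂ) :
    legNorm s * ∑ n, pairing (complexify (T n)) (fun _ => x)
        * pairing (complexify (T n)) (fun _ => y)
      = leg s (x ⬝ᵥ y) (((x ⬝ᵥ y) ^ 2 - (x ⬝ᵥ x) * (y ⬝ᵥ y)) / 4) := by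
  have hT : ∀ n, IsSTF (complexify (T n)) := fun n => isSTF_of_mem (T n).2
  by_cases hy : y ⬝ᵥ y = 0
  · have h := sum_pairing_mul_stf T x (isSTF_null_pow s hy)
    rw [sum_prod_eq_dotProduct_pow] at h
    have h2 := leg_sq_quarter (R := ℂ) s (x ⬝ᵥ y)
    simp only [Algebra.algebraMap_self, RingHom.id_apply] at h2
    rw [hy, mul_zero, sub_zero, div_eq_inv_mul, ← one_div, h2, ← h]
    simp only [pairing, mul_comm]
  · obtain ⟨c, hc⟩ := IsAlgClosed.exists_pow_nat_eq (y ⬝ᵥ y) (n := 2) (by norm_num)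
    have hc0 : c ≠ 0 := fun h => hy (by rw [← hc, h]; ring)
    obtain ⟨y', rfl⟩ : ∃ y', y = c • y' := ⟨c⁻¹ • y, by rw [smul_smul, mul_inv_cancel₀ hc0, one_smul]⟩
    have hy' : y' ⬝ᵥ y' = 1 := by
      rw [smul_dotProduct, dotProduct_smul, smul_eq_mul, smul_eq_mul] at hc
      have : c ^ 2 * (y' ⬝ᵥ y' - 1) = 0 := by linear_combination -hc
      simpa [hc0, sub_eq_zero] using this
    obtain ⟨u, w, hf⟩ := exists_isFrame y' hy'
    have hcont : ∀ a : Fin s → Fin 3, Continuous fun φ => ∏ i, nullVec y' u w φ (a i) := fun a =>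
      continuous_finsetProd _ fun i _ =>
        (continuous_apply (a i)).comp (continuous_nullVec y' u w)
    have hH := isSTF_circAvg (fun φ => isSTF_null_pow s (hf.nullVec_null φ)) hcont
    have h := sum_pairing_mul_stf T x hH
    have h1 : ∀ n, ∑ a, complexify (T n) a * circAvg (fun φ => ∏ i, nullVec y' u w φ (a i))
        = legNorm s * pairing (complexify (T n)) fun _ => y' := by
      intro n
      rw [← pairing_nullVec_circAvg (hT n) hf]
      simp only [pairing, ← circAvg_const_mul]
      rw [← circAvg_finset_sum]
      · simp only [mul_comm]
      · exact fun a _ => continuous_const.mul (hcont a)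
    have h2 : ∑ a : Fin s → Fin 3, (∏ i, x (a i)) * circAvg (fun φ => ∏ i, nullVec y' u w φ (a i))
        = leg s (x ⬝ᵥ y') (((x ⬝ᵥ y') ^ 2 - (x ⬝ᵥ x)) / 4) := by
      simp only [← circAvg_const_mul]
      rw [← circAvg_finset_sum Finset.univ
        (fun a φ => (∏ i, x (a i)) * ∏ i, nullVec y' u w φ (a i))
        fun a _ => continuous_const.mul (hcont a)]
      simp only [sum_prod_eq_dotProduct_pow, nullVec, dotProduct_add, dotProduct_smul, smul_eq_mul]
      rw [circAvg_trinomial']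
      congr 1
      simp only [dotProduct_sub, dotProduct_smul, smul_eq_mul]
      have e := hf.dot_mul_dot x
      have hI := Complex.I_sq
      linear_combination ((x ⬝ᵥ u) ^ 2 / 4 - (x ⬝ᵥ w) ^ 2 * (I ^ 2 - 1) / 4) * hI - e / 4
    simp only [h1] at h
    rw [h2] at h
    rw [dotProduct_smul, dotProduct_smul, smul_dotProduct, hy', smul_eq_mul, smul_eq_mul,
      smul_eq_mul, show ((c * (x ⬝ᵥ y')) ^ 2 - x ⬝ᵥ x * (c * (c * 1))) / 4
        = c ^ 2 * (((x ⬝ᵥ y') ^ 2 - (x ⬝ᵥ x)) / 4) by ring, leg_mul, ← h, Finset.mul_sum,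
      Finset.mul_sum]
    refine Finset.sum_congr rfl fun n _ => ?_
    rw [pairing_const_smul]
    ring

/-! ### Polarization -/

/-- The contraction of a symmetric tensor of rank `s` with `s - k` copies of `x` and `k` copies
of `w`. -/
def polar {s : ℕ} (t : (Fin s → Fin 3) → ℂ) (k : ℕ) (x w : Fin 3 → ℂ) : ℂ :=
  polyFunctional t (linForm x ^ (s - k) * linForm w ^ k)

lemma polar_eq_pairing {s : ℕ} {t : (Fin s → Fin 3) → ℂ} (ht : IsSTF t) {k : ℕ} (hk : k ≤ s)
    (x w : Fin 3 → ℂ) :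
    polar t k x w = pairing t fun i => if (i : ℕ) < k then w else x := by
  rw [← polyFunctional_prod ht, polar]
  congr 1
  simp only [apply_ite linForm]
  rw [Finset.prod_ite, Finset.prod_const, Finset.prod_const, mul_comm]
  have h1 : (Finset.univ.filter fun i : Fin s => (i : ℕ) < k).card = k := by
    rw [Fin.card_filter_val_lt, min_eq_right hk]
  have h2 := Finset.card_filter_add_card_filter_not (s := (Finset.univ : Finset (Fin s)))
    (fun i : Fin s => (i : ℕ) < k)
  rw [h1, Finset.card_univ, Fintype.card_fin] at h2
  rw [h1, show (Finset.univ.filter fun i : Fin s => ¬ (i : ℕ) < k).card = s - k by omega]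

lemma pairing_add_smul {s : ℕ} {t : (Fin s → Fin 3) → ℂ} (ht : IsSTF t) (x w : Fin 3 → ℂ)
    (c : ℂ) : pairing t (fun _ => x + c • w)
      = ∑ k ∈ Finset.range (s + 1), (s.choose k : ℂ) * polar t k x w * c ^ k := by
  rw [← polyFunctional_prod ht, Finset.prod_const, Finset.card_univ, Fintype.card_fin, linForm_add,
    linForm_smul, add_comm, add_pow, map_sum]
  refine Finset.sum_congr rfl fun k _ => ?_
  have : (c • linForm w) ^ k * linForm x ^ (s - k) * (s.choose k : MvPolynomial (Fin 3) ℂ)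
      = (c ^ k * (s.choose k : ℂ)) • (linForm x ^ (s - k) * linForm w ^ k) := by
    rw [smul_pow, mul_smul, Algebra.smul_def, Algebra.smul_def (s.choose k : ℂ), map_natCast,
      Algebra.smul_def]
    ring
  rw [this, LinearMap.map_smul, smul_eq_mul, polar]
  ring

lemma circAvg_pairing {s k : ℕ} (hk : k ≤ s) {t : (Fin s → Fin 3) → ℂ} (ht : IsSTF t)
    (x w : Fin 3 → ℂ) (c : ℂ) :
    circAvg (fun α => phase α ^ (-(k : ℤ)) * pairing t fun _ => x + (phase α * c) • w)
      = (s.choose k : ℂ) * c ^ k * polar t k x w := by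
  have h : ∀ α, phase α ^ (-(k : ℤ)) * pairing t (fun _ => x + (phase α * c) • w)
      = ∑ j ∈ Finset.range (s + 1), ((s.choose j : ℂ) * polar t j x w * c ^ j)
        * phase α ^ ((j : ℤ) - k) := by
    intro α
    rw [pairing_add_smul ht, Finset.mul_sum]
    refine Finset.sum_congr rfl fun j _ => ?_
    rw [sub_eq_neg_add, zpow_add₀ (phase_ne_zero α), zpow_natCast, mul_pow]
    ring
  rw [circAvg_congr h, circAvg_sum_zpow]
  have h2 : ∀ j : ℕ, ((j : ℤ) - k = 0) = (k = j) := fun j => by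
    simp only [eq_iff_iff]; omega
  simp only [h2]
  rw [Finset.sum_ite_eq, if_pos (Finset.mem_range.2 (by omega))]
  ring

lemma conj_polar {s : ℕ} (t : STF s) {k : ℕ} (hk : k ≤ s) (x w : Fin 3 → ℝ) :
    (starRingEnd ℂ) (polar (complexify t) k (fun a => x a) fun a => w a)
      = polar (complexify t) k (fun a => x a) fun a => w a := by
  rw [polar_eq_pairing (show IsSTF (complexify t) from isSTF_of_mem t.2) hk]
  simp only [pairing, map_sum, map_mul, map_prod, complexify, Complex.conj_ofReal]
  refine Finset.sum_congr rfl fun a _ => ?_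
  congr 1
  refine Finset.prod_congr rfl fun i _ => ?_
  split_ifs <;> simp

/-! ### Lorentz transformations -/

/-- The products of `u` with the columns of `L`. -/
def rowVec (L : Matrix (Fin 4) (Fin 4) ℝ) (u : Vec) (ν : Fin 4) : ℝ := ∑ μ, u μ * (eta * L) μ ν

lemma eta_sq : eta * eta = 1 := by
  rw [eta, Matrix.diagonal_mul_diagonal, ← Matrix.diagonal_one]
  congr 1
  ext i
  fin_cases i <;> simp

lemma mink_eq (x y : Vec) : mink x y = x 0 * y 0 - x 1 * y 1 - x 2 * y 2 - x 3 * y 3 := by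
  simp [mink, lower, eta, Matrix.mulVec_diagonal, Fin.sum_univ_four]
  ring

lemma mink_eq_dot (x y : Vec) : mink x y = x ⬝ᵥ Matrix.mulVec eta y := rfl

lemma mink_comm (x y : Vec) : mink x y = mink y x := by rw [mink_eq, mink_eq]; ring

lemma rowVec_eq (L : Matrix (Fin 4) (Fin 4) ℝ) (u : Vec) :
    rowVec L u = Matrix.vecMul u (eta * L) := rfl

lemma mink_mulVec (L : Matrix (Fin 4) (Fin 4) ℝ) (u x : Vec) :
    mink u (Matrix.mulVec L x) = ∑ ν, rowVec L u ν * x ν := by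
  change _ = rowVec L u ⬝ᵥ x
  rw [mink_eq_dot, Matrix.mulVec_mulVec, Matrix.dotProduct_mulVec, rowVec_eq]

lemma IsLorentz.mul_inv {L : Matrix (Fin 4) (Fin 4) ℝ} (hL : IsLorentz L) :
    L * (eta * L.transpose * eta) = 1 := by
  rw [mul_eq_one_comm, Matrix.mul_assoc, Matrix.mul_assoc, ← Matrix.mul_assoc L.transpose, hL.1,
    eta_sq]

lemma IsLorentz.mink_rowVec {L : Matrix (Fin 4) (Fin 4) ℝ} (hL : IsLorentz L) (u u' : Vec) :
    mink (rowVec L u) (rowVec L u') = mink u u' := by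
  rw [mink_eq_dot, mink_eq_dot, rowVec_eq, rowVec_eq, ← Matrix.dotProduct_mulVec,
    ← Matrix.mulVec_transpose, Matrix.mulVec_mulVec, Matrix.mulVec_mulVec]
  congr 2
  rw [Matrix.transpose_mul, show eta.transpose = eta from Matrix.diagonal_transpose _]
  calc _ = eta * (L * (eta * L.transpose * eta)) := by simp only [Matrix.mul_assoc]
    _ = eta := by rw [hL.mul_inv, Matrix.mul_one]

lemma IsLorentz.rowVec_mulVec {L : Matrix (Fin 4) (Fin 4) ℝ} (hL : IsLorentz L) (x : Vec) :
    rowVec L (Matrix.mulVec L x) = Matrix.vecMul x eta := by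
  rw [rowVec_eq, Matrix.vecMul_mulVec, ← Matrix.mul_assoc, hL.1]

lemma massive_boost_rowVec {L : Matrix (Fin 4) (Fin 4) ℝ} {m : ℝ} {p : Vec}
    (hp : Matrix.mulVec L ![m, 0, 0, 0] = p) (u : Vec) : mink u p = rowVec L u 0 * m := by
  rw [← hp, mink_mulVec]
  simp [Fin.sum_univ_four]

/-- The vector `e / (ep)`. -/
def qv (e p : Vec) : Vec := (mink e p)⁻¹ • e

/-- The vector `v - (vp) e / (ep)`, orthogonal to `p`. -/
def tv (e p v : Vec) : Vec := v - mink v p • qv e p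

lemma mink_smul_left (c : ℝ) (x y : Vec) : mink (c • x) y = c * mink x y := by
  simp only [mink_eq, Pi.smul_apply, smul_eq_mul]; ring

lemma mink_sub_left (x y z : Vec) : mink (x - y) z = mink x z - mink y z := by
  simp only [mink_eq, Pi.sub_apply]; ring

lemma mink_neg_left (x y : Vec) : mink (-x) y = -mink x y := by
  simp only [mink_eq, Pi.neg_apply]; ring

lemma mink_neg_right (x y : Vec) : mink x (-y) = -mink x y := by
  simp only [mink_eq, Pi.neg_apply]; ring

lemma qv_neg (e p : Vec) : qv (-e) p = qv e p := by
  rw [qv, qv, mink_neg_left, inv_neg, neg_smul_neg]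

lemma tv_neg (e p v : Vec) : tv (-e) p v = tv e p v := by rw [tv, tv, qv_neg]

lemma mink_qv {e p : Vec} (h : mink e p ≠ 0) : mink (qv e p) p = 1 := by
  rw [qv, mink_smul_left, inv_mul_cancel₀ h]

lemma mink_tv {e p : Vec} (h : mink e p ≠ 0) (v : Vec) : mink (tv e p v) p = 0 := by
  rw [tv, mink_sub_left, mink_smul_left, mink_qv h]; ring

/-- The spatial components in the rest frame. -/
def spatial (L : Matrix (Fin 4) (Fin 4) ℝ) (u : Vec) : Fin 3 → ℝ := fun a => rowVec L u a.succ

/-- The complexified spatial components in the rest frame. -/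
def cspatial (L : Matrix (Fin 4) (Fin 4) ℝ) (u : Vec) : Fin 3 → ℂ :=
  fun a => (spatial L u a : ℂ)

lemma cspatial_dot {L : Matrix (Fin 4) (Fin 4) ℝ} (hL : IsLorentz L) {m : ℝ} (hm : m ≠ 0) {p : Vec}
    (hp : Matrix.mulVec L ![m, 0, 0, 0] = p) (u u' : Vec) :
    cspatial L u ⬝ᵥ cspatial L u' = ((-mink u u' + mink u p * mink u' p / m ^ 2 : ℝ) : ℂ) := by
  have h1 := hL.mink_rowVec u u'
  rw [mink_eq] at h1
  have h2 : spatial L u ⬝ᵥ spatial L u' = -mink u u' + mink u p * mink u' p / m ^ 2 := by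
    rw [massive_boost_rowVec hp, massive_boost_rowVec hp, ← h1]
    simp [dotProduct, spatial, Fin.sum_univ_three]
    field_simp
    ring
  rw [← h2]
  simp [dotProduct, cspatial]

lemma sum_mul_J (e p v : Vec) (ν : Fin 4) : ∑ μ, v μ * J e p μ ν = tv e p v ν := by
  simp only [J, tv, qv, mul_sub, Finset.sum_sub_distrib, mul_ite, mul_one, mul_zero,
    Finset.sum_ite_eq', Finset.mem_univ, if_true, Pi.sub_apply, Pi.smul_apply, smul_eq_mul]
  congr 1
  change _ = (∑ μ, v μ * lower p μ) * _
  rw [Finset.sum_mul]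
  exact Finset.sum_congr rfl fun μ _ => by rw [div_eq_mul_inv]; ring

lemma EEval_eq (e p v : Vec) : EEval e p v = mink (tv e p v) (tv e p v) := by
  have h : mink (tv e p v) (tv e p v) = ∑ ν, ∑ ν', tv e p v ν * (eta ν ν' * tv e p v ν') := by
    simp only [mink, lower, Matrix.mulVec, dotProduct, Finset.mul_sum]
  rw [h, EEval]
  simp only [← sum_mul_J, EE, Finset.mul_sum, Finset.sum_mul]
  simp only [Fin.sum_univ_four]
  ring

/-! ### The massive string-localized potentials -/

lemma prod_sum_sum {s : ℕ} (f : Fin s → Fin 4 → Fin 4 → ℂ) :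
    ∏ i, ∑ ν, ∑ l, f i ν l = ∑ ν : Fin s → Fin 4, ∑ l : Fin s → Fin 4, ∏ i, f i (ν i) (l i) := by
  rw [Finset.prod_univ_sum, Fintype.piFinset_univ]
  refine Finset.sum_congr rfl fun ν _ => ?_
  rw [Finset.prod_univ_sum, Fintype.piFinset_univ]

/-- The vectors `J_μ{}^ν (B E_3)_{ν a}`. -/
def potentialVec (L : Matrix (Fin 4) (Fin 4) ℝ) (e p : Vec) (μ : Fin 4) : Fin 3 → ℂ :=
  fun a => ((∑ ν, J e p μ ν * (eta * L) ν a.succ : ℝ) : ℂ)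

lemma potentialVec_eq (L : Matrix (Fin 4) (Fin 4) ℝ) {e p : Vec} (h : mink e p ≠ 0) (μ : Fin 4)
    (a : Fin 3) : potentialVec L e p μ a = stringInt e p * ∑ ν, ∑ l,
      ((I * (lower p μ : ℂ) * (if ν = l then 1 else 0)
        - I * (lower p ν : ℂ) * (if μ = l then 1 else 0)) * (((eta * L) l a.succ : ℝ) : ℂ)
        * (e ν : ℂ)) := by
  have h' : (mink e p : ℂ) ≠ 0 := by exact_mod_cast h
  have h1 : ∑ ν, ∑ l, ((I * (lower p μ : ℂ) * (if ν = l then 1 else 0)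
        - I * (lower p ν : ℂ) * (if μ = l then 1 else 0)) * (((eta * L) l a.succ : ℝ) : ℂ)
        * (e ν : ℂ)) = I * (lower p μ * ∑ ν, e ν * (eta * L) ν a.succ : ℝ)
        - I * (mink e p * (eta * L) μ a.succ : ℝ) := by
    simp only [sub_mul, Finset.sum_sub_distrib, mul_ite, ite_mul, mul_zero, zero_mul, mul_one,
      Finset.sum_ite_eq, Finset.mem_univ, if_true, mink]
    push_cast
    simp only [Finset.mul_sum, Finset.sum_mul]
    congr 1
    · exact Finset.sum_congr rfl fun _ _ => by ring
    · exact Finset.sum_congr rfl fun _ _ => by ring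
  have h2 : ∑ ν, J e p μ ν * (eta * L) ν a.succ
      = (eta * L) μ a.succ - lower p μ * (∑ ν, e ν * (eta * L) ν a.succ) / mink e p := by
    simp only [J, sub_mul, Finset.sum_sub_distrib, ite_mul, one_mul, zero_mul, Finset.sum_ite_eq,
      Finset.mem_univ, if_true, Finset.mul_sum, Finset.sum_div]
    congr 1
    exact Finset.sum_congr rfl fun _ _ => by ring
  rw [h1, potentialVec, h2, stringInt]
  push_cast
  field_simp
  linear_combination ((mink e p : ℂ) * ((eta * L) μ a.succ : ℂ)
    - (lower p μ : ℂ) * ∑ ν, (e ν : ℂ) * ((eta * L) ν a.succ : ℂ)) * Complex.I_sq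

lemma stringPotential_proca {s : ℕ} (t : STF s) (L : Matrix (Fin 4) (Fin 4) ℝ) {e p : Vec}
    (h : mink e p ≠ 0) (μ : Fin s → Fin 4) :
    stringPotential e p (proca s L (t : EuclideanSpace ℝ (Fin s → Fin 3))) μ
      = polyFunctional (complexify t) (∏ i, linForm (potentialVec L e p (μ i))) := by
  rw [polyFunctional_prod (show IsSTF (complexify t) from isSTF_of_mem t.2), pairing]
  simp only [potentialVec_eq L h, Finset.prod_mul_distrib, Finset.prod_const, Finset.card_univ,
    Fintype.card_fin, prod_sum_sum]
  simp only [stringPotential, fieldStrength, proca, Finset.mul_sum, Finset.sum_mul]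
  rw [Finset.sum_comm (γ := Fin s → Fin 3)]
  refine Finset.sum_congr rfl fun ν _ => ?_
  rw [Finset.sum_comm (γ := Fin s → Fin 3)]
  exact Finset.sum_congr rfl fun l _ => Finset.sum_congr rfl fun a _ => by
    simp only [complexify]; ring

lemma escort_self (s : ℕ) (m : ℝ) (e p : Vec) (X : Tensor s) :
    escort s s m e p X = stringPotential e p X := by
  rw [escort, dif_pos le_rfl, Nat.decreasingInduction_self]

lemma escort_of_lt {s r : ℕ} (h : r < s) (m : ℝ) (e p : Vec) (X : Tensor s) :
    escort s r m e p X = descend m p (escort s (r + 1) m e p X) := by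
  rw [escort, escort, dif_pos h.le, dif_pos (Nat.succ_le_of_lt h),
    Nat.decreasingInduction_succ_left _ _ h]

lemma sum_mul_potentialVec (L : Matrix (Fin 4) (Fin 4) ℝ) (e p v : Vec) :
    ∑ μ, (v μ : ℂ) • potentialVec L e p μ = cspatial L (tv e p v) := by
  ext a
  simp only [Finset.sum_apply, Pi.smul_apply, smul_eq_mul, potentialVec, cspatial, spatial, rowVec,
    ← sum_mul_J, Finset.sum_mul, ← Complex.ofReal_mul, ← Complex.ofReal_sum, Finset.mul_sum]
  rw [Finset.sum_comm]
  simp only [mul_assoc]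

lemma sum_smul_linForm {α : Type*} (S : Finset α) (c : α → ℂ) (x : α → Fin 3 → ℂ) :
    ∑ i ∈ S, c i • linForm (x i) = linForm (∑ i ∈ S, c i • x i) := by
  simp only [linForm, Finset.smul_sum, Finset.sum_apply, Finset.sum_smul, Pi.smul_apply,
    smul_smul, smul_eq_mul]
  rw [Finset.sum_comm]

lemma cspatial_tv_self {L : Matrix (Fin 4) (Fin 4) ℝ} {m : ℝ} {e p : Vec}
    (hp : Matrix.mulVec L ![m, 0, 0, 0] = p) (hL : IsLorentz L) :
    cspatial L (tv e p p) = -((m : ℂ) ^ 2) • cspatial L (qv e p) := by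
  have h0 : ∀ ν, rowVec L p ν = Matrix.vecMul ![m, 0, 0, 0] eta ν := fun ν => by
    rw [← hL.rowVec_mulVec, hp]
  have hpp : mink p p = m ^ 2 := by
    rw [massive_boost_rowVec hp, h0, eta]
    simp [Matrix.vecMul_diagonal]
    ring
  ext a
  have h1 : rowVec L p a.succ = 0 := by
    rw [h0, eta]
    fin_cases a <;> simp [Matrix.vecMul_diagonal]
  have h2 : rowVec L (tv e p p) a.succ = rowVec L p a.succ - m ^ 2 * rowVec L (qv e p) a.succ := by
    simp only [rowVec, tv, hpp, Pi.sub_apply, Pi.smul_apply, smul_eq_mul, sub_mul,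
      Finset.sum_sub_distrib, Finset.mul_sum, mul_assoc]
  simp [cspatial, spatial, h2, h1]

lemma mul_mul_eq_smul_sum {R α : Type*} [CommRing R] [Algebra ℂ R] [Fintype α] (A Q : R) {Z : R}
    (c : ℂ) (d : α → ℂ) (W : α → R) (h : Z = c • ∑ l, d l • W l) :
    A * (Z * Q) = c • ∑ l, d l • (A * (W l * Q)) := by
  rw [h, smul_mul_assoc, mul_smul_comm, Finset.sum_mul, Finset.mul_sum]
  simp only [smul_mul_assoc, mul_smul_comm]

lemma escort_proca {s : ℕ} (t : STF s) {L : Matrix (Fin 4) (Fin 4) ℝ} {m : ℝ}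
    (hm : m ≠ 0) {e p : Vec} (hp : Matrix.mulVec L ![m, 0, 0, 0] = p) (hL : IsLorentz L)
    (h : mink e p ≠ 0) {r : ℕ} (hr : r ≤ s) : ∀ μ : Fin r → Fin 4,
    escort s r m e p (proca s L (t : EuclideanSpace ℝ (Fin s → Fin 3))) μ
      = polyFunctional (complexify t) ((linForm ((I * m) • cspatial L (qv e p))) ^ (s - r)
        * ∏ i, linForm (potentialVec L e p (μ i))) := by
  have hm' : (m : ℂ) ≠ 0 := by exact_mod_cast hm
  induction hr using Nat.decreasingInduction with
  | self => intro μ; rw [escort_self, stringPotential_proca t L h]; simp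
  | of_succ r hr ih =>
    intro μ
    rw [escort_of_lt hr, descend]
    simp only [ih, Fin.prod_univ_succ, Fin.cons_zero, Fin.cons_succ]
    rw [show s - r = s - (r + 1) + 1 by omega]
    have hz : (I * m) • cspatial L (qv e p)
        = -(1 / (m : ℂ)) • ∑ l, (I * p l : ℂ) • potentialVec L e p l := by
      have h1 : ∑ l, (I * p l : ℂ) • potentialVec L e p l = I • cspatial L (tv e p p) := by
        rw [← sum_mul_potentialVec, Finset.smul_sum]
        simp only [smul_smul]
      rw [h1, cspatial_tv_self hp hL, smul_smul, smul_smul]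
      congr 1
      field_simp
    have hz2 := congrArg linForm hz
    rw [linForm_smul (-(1 / (m : ℂ))), ← sum_smul_linForm] at hz2
    rw [pow_succ, mul_assoc]
    generalize hZ : linForm ((I * m) • cspatial L (qv e p)) = Z at hz2 ⊢
    generalize ∏ i, linForm (potentialVec L e p (μ i)) = Q
    rw [mul_mul_eq_smul_sum (Z ^ (s - (r + 1))) Q _ _ _ hz2, LinearMap.map_smul, smul_eq_mul,
      map_sum]
    simp only [LinearMap.map_smul, smul_eq_mul]

lemma escort_eval {s : ℕ} (t : STF s) {L : Matrix (Fin 4) (Fin 4) ℝ} {m : ℝ}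
    (hm : m ≠ 0) {e p : Vec} (hp : Matrix.mulVec L ![m, 0, 0, 0] = p) (hL : IsLorentz L)
    (h : mink e p ≠ 0) {r : ℕ} (hr : r ≤ s) (v : Vec) :
    (escort s r m e p (proca s L (t : EuclideanSpace ℝ (Fin s → Fin 3)))).eval v
      = I ^ (s - r) * polar (complexify t) r (m • cspatial L (qv e p)) (cspatial L (tv e p v)) := by
  rw [Tensor.eval, polar]
  simp only [escort_proca t hm hp hL h hr]
  have h1 : linForm (cspatial L (tv e p v)) ^ r
      = ∑ μ : Fin r → Fin 4,
        (∏ i, (v (μ i) : ℂ)) • (∏ i, linForm (potentialVec L e p (μ i))) := by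
    have hr : ∀ q : MvPolynomial (Fin 3) ℂ, q ^ r = ∏ _i : Fin r, q := fun q => by simp
    rw [← sum_mul_potentialVec, ← sum_smul_linForm, hr, Finset.prod_univ_sum,
      Fintype.piFinset_univ]
    simp only [Finset.prod_smul]
  have h2 : linForm ((I * m) • cspatial L (qv e p)) ^ (s - r)
      = I ^ (s - r) • linForm (m • cspatial L (qv e p)) ^ (s - r) := by
    rw [← smul_pow, ← linForm_smul, mul_smul]
    rfl
  rw [h1, Finset.mul_sum, map_sum, Finset.mul_sum]
  refine Finset.sum_congr rfl fun μ _ => ?_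
  rw [h2, mul_smul_comm, LinearMap.map_smul, smul_mul_assoc, LinearMap.map_smul, smul_eq_mul,
    smul_eq_mul]
  ring

/-! ### The massive two-point kernel -/

/-- The Minkowski product of `κ u + x w` and `κ u' + y w'`. -/
def gram (κ : ℝ) (x y : ℂ) (u w u' w' : Vec) : ℂ :=
  (κ ^ 2 * mink u u' : ℝ) + x * (κ * mink w u' : ℝ) + y * (κ * mink u w' : ℝ)
    + x * y * (mink w w' : ℝ)

/-- The trinomial sum as a function of the rescaled Minkowski products. -/
def legScaled (s : ℕ) (a b c : ℂ) : ℂ :=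
  leg s (1 - a / s ^ 2) ((b - 2 * a + c + (a ^ 2 - b * c) / s ^ 2) / (4 * s ^ 2))

/-- The Taylor coefficient of order `(k, k')` of `F` along `κ q_e + x v_e`, `κ q_{e'} + y v'_{e'}`. -/
def taylorCoeff (k k' : ℕ) (κ : ℝ) (F : ℂ → ℂ → ℂ → ℂ) (e e' p v v' : Vec) : ℂ :=
  circAvg fun α => circAvg fun β => phase α ^ (-(k : ℤ)) * phase β ^ (-(k' : ℤ)) *
    F (gram κ (phase α) (phase β) (qv e p) (tv e p v) (qv e' p) (tv e' p v'))
      (gram κ (phase α) (phase α) (qv e p) (tv e p v) (qv e p) (tv e p v))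
      (gram κ (phase β) (phase β) (qv e' p) (tv e' p v') (qv e' p) (tv e' p v'))

/-- The common form of the massive and of the infinite-spin kernels. -/
def kernelForm (r r' : ℕ) (c c' : ℕ → ℂ) (κ : ℝ) (F : ℂ → ℂ → ℂ → ℂ) (e e' p v v' : Vec) : ℂ :=
  ∑ k ∈ Finset.range (r / 2 + 1), ∑ k' ∈ Finset.range (r' / 2 + 1),
    c k * c' k' * ((-EEval e p v : ℝ) : ℂ) ^ k * ((-EEval e' p v' : ℝ) : ℂ) ^ k'
      * taylorCoeff (r - 2 * k) (r' - 2 * k') κ F e e' p v v'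

lemma sum_pairing_massive {s : ℕ} (hs : s ≠ 0) {ι : Type} [Fintype ι]
    (T : OrthonormalBasis ι ℝ (STF s)) {L : Matrix (Fin 4) (Fin 4) ℝ} (hL : IsLorentz L) {m : ℝ}
    (hm : m ≠ 0) {e e' p : Vec} (hp : Matrix.mulVec L ![m, 0, 0, 0] = p) (he : mink e p ≠ 0)
    (he' : mink e' p ≠ 0) (v v' : Vec) (x y : ℂ) :
    legNorm s * ∑ n, pairing (complexify (T n)) (fun _ =>
          m • cspatial L (qv e p) + (x * (1 / s)) • cspatial L (tv e p v))
        * pairing (complexify (T n)) (fun _ =>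
          m • cspatial L (qv e' p) + (y * (1 / s)) • cspatial L (tv e' p v'))
      = legScaled s (gram (s * m) x y (qv e p) (tv e p v) (qv e' p) (tv e' p v'))
        (gram (s * m) x x (qv e p) (tv e p v) (qv e p) (tv e p v))
        (gram (s * m) y y (qv e' p) (tv e' p v') (qv e' p) (tv e' p v')) := by
  have hs' : (s : ℂ) ≠ 0 := by exact_mod_cast hs
  have hm' : (m : ℂ) ≠ 0 := by exact_mod_cast hm
  have key : ∀ (f f' w w' : Vec) (x y : ℂ), mink f p ≠ 0 → mink f' p ≠ 0 →
      (m • cspatial L (qv f p) + (x * (1 / s)) • cspatial L (tv f p w))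
        ⬝ᵥ (m • cspatial L (qv f' p) + (y * (1 / s)) • cspatial L (tv f' p w'))
      = 1 - gram (s * m) x y (qv f p) (tv f p w) (qv f' p) (tv f' p w') / s ^ 2 := by
    intro f f' w w' x y hf hf'
    simp only [add_dotProduct, dotProduct_add, smul_dotProduct, dotProduct_smul,
      cspatial_dot hL hm hp, mink_qv hf, mink_qv hf', mink_tv hf, mink_tv hf', gram, smul_eq_mul,
      Complex.real_smul]
    push_cast
    field_simp
    ring
  rw [sum_pairing_mul_pairing, key e e' v v' x y he he', key e e v v x x he he,
    key e' e' v' v' y y he' he', legScaled]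
  congr 1
  field_simp
  ring

lemma circAvg_sum_mul {α : Type*} [Fintype α] (c : α → ℂ) (f : α → ℝ → ℂ)
    (hf : ∀ i, Continuous (f i)) :
    circAvg (fun φ => ∑ i, c i * f i φ) = ∑ i, c i * circAvg (f i) := by
  rw [circAvg_finset_sum _ (fun i φ => c i * f i φ) fun i _ => continuous_const.mul (hf i)]
  simp only [circAvg_const_mul]

lemma taylorCoeff_massive {s : ℕ} (hs : s ≠ 0) {ι : Type} [Fintype ι]
    (T : OrthonormalBasis ι ℝ (STF s)) {L : Matrix (Fin 4) (Fin 4) ℝ} (hL : IsLorentz L) {m : ℝ}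
    (hm : m ≠ 0) {e e' p : Vec} (hp : Matrix.mulVec L ![m, 0, 0, 0] = p) (he : mink e p ≠ 0)
    (he' : mink e' p ≠ 0) (v v' : Vec) {k k' : ℕ} (hk : k ≤ s) (hk' : k' ≤ s) :
    taylorCoeff k k' (s * m) (legScaled s) e e' p v v'
      = legNorm s * ((s.choose k : ℂ) * (1 / s) ^ k) * ((s.choose k' : ℂ) * (1 / s) ^ k')
        * ∑ n, polar (complexify (T n)) k (m • cspatial L (qv e p)) (cspatial L (tv e p v))
          * polar (complexify (T n)) k' (m • cspatial L (qv e' p)) (cspatial L (tv e' p v')) := by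
  have hT : ∀ n, IsSTF (complexify (T n)) := fun n => isSTF_of_mem (T n).2
  have hc : ∀ (n : ι) (k : ℕ) (x w : Fin 3 → ℂ), Continuous fun α =>
      phase α ^ (-(k : ℤ)) * pairing (complexify (T n)) fun _ => x + (phase α * (1 / s)) • w := by
    intro n k x w
    refine (continuous_phase.zpow₀ _ fun φ => Or.inl (phase_ne_zero φ)).mul ?_
    simp only [pairing, Pi.add_apply, Pi.smul_apply, smul_eq_mul]
    fun_prop
  simp only [taylorCoeff, ← sum_pairing_massive hs T hL hm hp he he']
  have h1 : ∀ α β, phase α ^ (-(k : ℤ)) * phase β ^ (-(k' : ℤ)) * (legNorm s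
      * ∑ n, pairing (complexify (T n)) (fun _ =>
          m • cspatial L (qv e p) + (phase α * (1 / s)) • cspatial L (tv e p v))
        * pairing (complexify (T n)) (fun _ =>
          m • cspatial L (qv e' p) + (phase β * (1 / s)) • cspatial L (tv e' p v')))
      = legNorm s * ∑ n, (phase α ^ (-(k : ℤ)) * pairing (complexify (T n)) (fun _ =>
          m • cspatial L (qv e p) + (phase α * (1 / s)) • cspatial L (tv e p v)))
        * (phase β ^ (-(k' : ℤ)) * pairing (complexify (T n)) (fun _ =>
          m • cspatial L (qv e' p) + (phase β * (1 / s)) • cspatial L (tv e' p v'))) := by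
    intro α β
    simp only [Finset.mul_sum]
    exact Finset.sum_congr rfl fun n _ => by ring
  simp only [h1, circAvg_const_mul]
  rw [mul_assoc, mul_assoc]
  congr 1
  have h2 : ∀ α, circAvg (fun β => ∑ n, (phase α ^ (-(k : ℤ)) * pairing (complexify (T n)) (fun _ =>
          m • cspatial L (qv e p) + (phase α * (1 / s)) • cspatial L (tv e p v)))
        * (phase β ^ (-(k' : ℤ)) * pairing (complexify (T n)) (fun _ =>
          m • cspatial L (qv e' p) + (phase β * (1 / s)) • cspatial L (tv e' p v'))))
      = ∑ n, ((s.choose k' : ℂ) * (1 / s) ^ k'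
          * polar (complexify (T n)) k' (m • cspatial L (qv e' p)) (cspatial L (tv e' p v')))
        * (phase α ^ (-(k : ℤ)) * pairing (complexify (T n)) (fun _ =>
          m • cspatial L (qv e p) + (phase α * (1 / s)) • cspatial L (tv e p v))) := by
    intro α
    rw [circAvg_sum_mul _ _ fun n => hc n k' _ _]
    refine Finset.sum_congr rfl fun n _ => ?_
    rw [circAvg_pairing hk' (hT n), mul_comm]
  simp only [h2]
  rw [circAvg_sum_mul _ _ fun n => hc n k _ _, Finset.mul_sum, Finset.mul_sum]
  refine Finset.sum_congr rfl fun n _ => ?_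
  rw [circAvg_pairing hk (hT n)]
  ring

/-! ### The normalization constants -/

lemma Gamma_nat_add_half' (s : ℕ) :
    Real.Gamma (1 / 2 + s) = ((2 * s).factorial : ℝ) * √Real.pi / (4 ^ s * s.factorial) := by
  have h := Real.Gamma_mul_Gamma_add_half (1 / 2 + s)
  have h1 : (1 / 2 + s : ℝ) + 1 / 2 = s + 1 := by ring
  have h2 : 2 * (1 / 2 + s : ℝ) = (2 * s : ℕ) + 1 := by push_cast; ring
  have h3 : (2 : ℝ) ^ (1 - (((2 * s : ℕ) : ℝ) + 1)) = (4 ^ s)⁻¹ := by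
    rw [show (1 - (((2 * s : ℕ) : ℝ) + 1)) = -((2 * s : ℕ) : ℝ) by ring, Real.rpow_neg (by norm_num),
      Real.rpow_natCast, pow_mul]
    norm_num
  rw [h1, h2, Real.Gamma_nat_eq_factorial, Real.Gamma_nat_eq_factorial, h3] at h
  have h4 : (s.factorial : ℝ) ≠ 0 := by exact_mod_cast s.factorial_ne_zero
  rw [eq_div_iff (by positivity), mul_comm (4 ^ s : ℝ), ← mul_assoc, h]
  field_simp

lemma N0_sq {s r : ℕ} (hr : r ≤ s) : N0 s r ^ 2
    = legNorm s * (2 ^ r * ((s.factorial : ℝ) / (s - r).factorial)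
      * ((s.factorial : ℝ) / (s + r).factorial)) := by
  have h := Real.Gamma_mul_Gamma_add_half (1 / 2 + (r + s) / 2)
  have h1 : (1 / 2 + (r + s) / 2 : ℝ) + 1 / 2 = 1 + (r + s) / 2 := by ring
  have h2 : 2 * (1 / 2 + (r + s) / 2 : ℝ) = (s + r : ℕ) + 1 := by push_cast; ring
  have h3 : (2 : ℝ) ^ (1 - (((s + r : ℕ) : ℝ) + 1)) = (2 ^ (s + r))⁻¹ := by
    rw [show (1 - (((s + r : ℕ) : ℝ) + 1)) = -((s + r : ℕ) : ℝ) by ring, Real.rpow_neg (by norm_num),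
      Real.rpow_natCast]
  rw [h1, h2, Real.Gamma_nat_eq_factorial, h3] at h
  have hf : ∀ n : ℕ, (n.factorial : ℝ) ≠ 0 := fun n => by exact_mod_cast n.factorial_ne_zero
  have hpi : √Real.pi ≠ 0 := by positivity
  rw [N0, Real.sq_sqrt]
  · rw [h, Gamma_nat_add_half', add_comm (1 : ℝ) r, Real.Gamma_nat_eq_factorial, legNorm,
      Nat.cast_choose ℝ hr, Nat.cast_choose ℝ (show s ≤ 2 * s by omega),
      show 2 * s - s = s by omega, show (4 : ℝ) ^ s = 2 ^ s * 2 ^ s by rw [← mul_pow]; norm_num,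
      pow_add]
    have := hf s; have := hf r; have := hf (s - r); have := hf (s + r); have := hf (2 * s)
    field_simp
  · rw [h, Gamma_nat_add_half', add_comm (1 : ℝ) r, Real.Gamma_nat_eq_factorial]
    positivity

lemma N0_zero_sq (s : ℕ) : N0 s 0 ^ 2 = legNorm s := by
  have := N0_sq (Nat.zero_le s)
  have hf : (s.factorial : ℝ) ≠ 0 := by exact_mod_cast s.factorial_ne_zero
  rw [this]
  simp [hf]

lemma N0_zero_ne_zero (s : ℕ) : N0 s 0 ≠ 0 := fun h => by
  have := N0_zero_sq s
  rw [h] at this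
  have := legNorm_pos s
  norm_num at *
  linarith

/-- The massive coefficients of the common form of the kernels. -/
def massiveCoeff (s r k : ℕ) : ℝ :=
  N0 s r / N0 s 0 * gammaCoeff r k * (s ^ (r - 2 * k) / s.choose (r - 2 * k))

/-- The factor `1 - i m √(-e²) / (ep)`. -/
def stringFactor (m : ℝ) (e p : Vec) : ℂ := 1 - I * ((m * (√(-mink e e) / mink e p) : ℝ) : ℂ)

lemma fieldA_proca {s r : ℕ} (hr : r ≤ s) (t : STF s) {L : Matrix (Fin 4) (Fin 4) ℝ} {m : ℝ}
    (hm : m ≠ 0) {e p : Vec} (hp : Matrix.mulVec L ![m, 0, 0, 0] = p) (hL : IsLorentz L)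
    (h : mink e p ≠ 0) (v : Vec) :
    fieldA s r m e p v (proca s L (t : EuclideanSpace ℝ (Fin s → Fin 3)))
      = N0 s r * ∑ k ∈ Finset.range (r / 2 + 1), (gammaCoeff r k : ℂ)
        * ((-EEval e p v : ℝ) : ℂ) ^ k * (I ^ (s - (r - 2 * k)) *
          polar (complexify t) (r - 2 * k) (m • cspatial L (qv e p)) (cspatial L (tv e p v))) := by
  rw [fieldA]
  congr 1
  refine Finset.sum_congr rfl fun k _ => ?_
  rw [escort_eval t hm hp hL h (by omega)]
  push_cast
  rfl

lemma conj_polar_massive {s k : ℕ} (hk : k ≤ s) (t : STF s) (L : Matrix (Fin 4) (Fin 4) ℝ) (m : ℝ)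
    (u w : Vec) : (starRingEnd ℂ) (polar (complexify t) k (m • cspatial L u) (cspatial L w))
      = polar (complexify t) k (m • cspatial L u) (cspatial L w) := by
  have : m • cspatial L u = fun a => (((m • spatial L u) a : ℝ) : ℂ) := by
    ext a; simp [cspatial]
  rw [this]
  exact conj_polar t hk _ _

lemma massiveKernel_eq {s r r' : ℕ} (hs : s ≠ 0) (hr : r ≤ s) (hr' : r' ≤ s) {m : ℝ} (hm : 0 < m)
    {B : Vec → Matrix (Fin 4) (Fin 4) ℝ} (hB : IsMassiveBoost m B) {ι : Type} [Fintype ι]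
    (T : OrthonormalBasis ι ℝ (STF s)) {e e' p : Vec} (hp : p ∈ massShell m) (he : mink e p ≠ 0)
    (he' : mink e' p ≠ 0) (v v' : Vec) :
    massiveKernel s r r' m B T (-e) e' p v v'
      = stringFactor m e p ^ s * stringFactor m e' p ^ s
        * kernelForm r r' (fun k => massiveCoeff s r k * I ^ (r - 2 * k))
          (fun k => massiveCoeff s r' k * (-I) ^ (r' - 2 * k)) (s * m) (legScaled s)
          e e' p v v' := by
  obtain ⟨hL, hLp⟩ := hB p hp
  have hm0 := hm.ne'
  have hen : mink (-e) p ≠ 0 := by rwa [mink_neg_left, neg_ne_zero]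
  have h1 : ∀ n, (starRingEnd ℂ) (massiveIntertwiner s r m (B p)
        (T n : EuclideanSpace ℝ _) (-e) p v)
      = stringFactor m e p ^ s * (N0 s r * ∑ k ∈ Finset.range (r / 2 + 1), (gammaCoeff r k : ℂ)
        * ((-EEval e p v : ℝ) : ℂ) ^ k * ((-I) ^ (s - (r - 2 * k)) * polar (complexify (T n))
          (r - 2 * k) (m • cspatial (B p) (qv e p)) (cspatial (B p) (tv e p v)))) := by
    intro n
    rw [massiveIntertwiner, fieldA_proca hr (T n) hm0 hLp hL hen]
    simp only [map_mul, map_pow, map_sub, map_one, map_sum, Complex.conj_ofReal, Complex.conj_I,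
      qv_neg, tv_neg, EEval_eq]
    have hf : 1 - (m : ℂ) * (√(-mink (-e) (-e)) : ℂ) * (starRingEnd ℂ) (stringInt (-e) p)
        = stringFactor m e p := by
      rw [stringFactor, stringInt, map_div₀, Complex.conj_I, Complex.conj_ofReal, mink_neg_left,
        mink_neg_left, mink_neg_right]
      push_cast
      ring_nf
    rw [hf]
    refine congrArg (fun z => stringFactor m e p ^ s * (N0 s r * z))
      (Finset.sum_congr rfl fun k _ => ?_)
    rw [conj_polar_massive (by omega)]
  have h2 : ∀ n, massiveIntertwiner s r' m (B p) (T n : EuclideanSpace ℝ _) e' p v'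
      = stringFactor m e' p ^ s * (N0 s r' * ∑ k ∈ Finset.range (r' / 2 + 1), (gammaCoeff r' k : ℂ)
        * ((-EEval e' p v' : ℝ) : ℂ) ^ k * (I ^ (s - (r' - 2 * k)) * polar (complexify (T n))
          (r' - 2 * k) (m • cspatial (B p) (qv e' p)) (cspatial (B p) (tv e' p v')))) := by
    intro n
    rw [massiveIntertwiner, fieldA_proca hr' (T n) hm0 hLp hL he']
    congr 2
    rw [stringFactor, stringInt]
    push_cast
    ring
  simp only [massiveKernel, h1, h2, kernelForm]
  have h3 : ∀ a b : ℂ, ∀ f g : ι → ℂ, ∑ n, (stringFactor m e p ^ s * (a * f n))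
      * (stringFactor m e' p ^ s * (b * g n)) = stringFactor m e p ^ s * stringFactor m e' p ^ s
        * (a * b * ∑ n, f n * g n) := by
    intro a b f g
    simp only [Finset.mul_sum]
    exact Finset.sum_congr rfl fun n _ => by ring
  rw [h3]
  congr 1
  simp only [Finset.sum_mul_sum]
  rw [Finset.sum_comm, Finset.mul_sum]
  refine Finset.sum_congr rfl fun k _ => ?_
  rw [Finset.sum_comm, Finset.mul_sum]
  refine Finset.sum_congr rfl fun k' _ => ?_
  rw [taylorCoeff_massive hs T hL hm0 hLp he he' v v' (show r - 2 * k ≤ s by omega)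
    (show r' - 2 * k' ≤ s by omega)]
  simp only [Finset.mul_sum]
  refine Finset.sum_congr rfl fun n _ => ?_
  have hN : (N0 s 0 : ℂ) ≠ 0 := by exact_mod_cast N0_zero_ne_zero s
  have hc1 : (s.choose (r - 2 * k) : ℂ) ≠ 0 := by
    exact_mod_cast (Nat.choose_pos (show r - 2 * k ≤ s by omega)).ne'
  have hc2 : (s.choose (r' - 2 * k') : ℂ) ≠ 0 := by
    exact_mod_cast (Nat.choose_pos (show r' - 2 * k' ≤ s by omega)).ne'
  have hs' : (s : ℂ) ≠ 0 := by exact_mod_cast hs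
  have hI1 : ∀ j ≤ s, (-I) ^ (s - j) = (-I) ^ s * I ^ j := by
    intro j hj
    have : (-I) ^ s = (-I) ^ (s - j) * (-I) ^ j := by rw [← pow_add]; congr 1; omega
    rw [this, mul_assoc, ← mul_pow]
    simp
  have hI2 : ∀ j ≤ s, I ^ (s - j) = I ^ s * (-I) ^ j := by
    intro j hj
    have : I ^ s = I ^ (s - j) * I ^ j := by rw [← pow_add]; congr 1; omega
    rw [this, mul_assoc, ← mul_pow]
    simp
  have hI3 : (-I) ^ s * I ^ s = 1 := by rw [← mul_pow]; simp
  rw [hI1 _ (show r - 2 * k ≤ s by omega), hI2 _ (show r' - 2 * k' ≤ s by omega), ← N0_zero_sq s,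
    massiveCoeff, massiveCoeff]
  push_cast
  simp only [one_div, inv_pow]
  field_simp
  linear_combination ((N0 s r : ℂ) * N0 s r' * gammaCoeff r k * gammaCoeff r' k'
    * (-(EEval e p v : ℂ)) ^ k * (-(EEval e' p v' : ℂ)) ^ k'
    * polar (complexify (T n)) (r - 2 * k) (m • cspatial (B p) (qv e p))
      (cspatial (B p) (tv e p v))
    * polar (complexify (T n)) (r' - 2 * k') (m • cspatial (B p) (qv e' p))
      (cspatial (B p) (tv e' p v'))) * hI3

/-! ### Asymptotics of the normalization constants -/

lemma tendsto_descFactorial_div_pow (k : ℕ) :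
    Tendsto (fun s : ℕ => (s.descFactorial k : ℝ) / (s : ℝ) ^ k) atTop (𝓝 1) := by
  have h := isEquivalent_descFactorial k
  refine (Asymptotics.isEquivalent_iff_tendsto_one ?_).1 h
  filter_upwards [eventually_gt_atTop 0] with s hs
  have : (0 : ℝ) < s := by exact_mod_cast hs
  positivity

lemma tendsto_N0_div_N0 (r : ℕ) :
    Tendsto (fun s : ℕ => N0 s r / N0 s 0) atTop (𝓝 ((2 : ℝ) ^ ((r : ℝ) / 2))) := by
  have h1 := tendsto_descFactorial_div_pow r
  have h2 := (tendsto_add_atTop_iff_nat r).2 h1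
  have h3 : Tendsto (fun s : ℕ => ((s : ℝ) / ((s + r : ℕ) : ℝ)) ^ r) atTop (𝓝 1) := by
    have := (tendsto_natCast_div_add_atTop (𝕜 := ℝ) (r : ℝ)).pow r
    simpa using this
  have h4 := ((h1.div h2 one_ne_zero).mul h3).const_mul ((2 : ℝ) ^ r)
  have h5 := (Real.continuous_sqrt.tendsto _).comp h4
  have e : √((2 : ℝ) ^ r * (1 / 1 * 1)) = (2 : ℝ) ^ ((r : ℝ) / 2) := by
    rw [div_one, mul_one, mul_one, ← Real.rpow_natCast, Real.sqrt_eq_rpow,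
      ← Real.rpow_mul (by norm_num)]
    ring_nf
  rw [e] at h5
  refine h5.congr' ?_
  filter_upwards [eventually_ge_atTop (r + 1)] with s hs
  have hf : ∀ n : ℕ, (n.factorial : ℝ) ≠ 0 := fun n => by exact_mod_cast n.factorial_ne_zero
  have hN : ∀ r, 0 ≤ N0 s r := fun r => Real.sqrt_nonneg _
  have hs0 : (s : ℝ) ≠ 0 := by exact_mod_cast (by omega : s ≠ 0)
  have hsr0 : ((s + r : ℕ) : ℝ) ≠ 0 := by exact_mod_cast (by omega : s + r ≠ 0)
  rw [Function.comp_apply, ← Real.sqrt_sq (div_nonneg (hN r) (hN 0))]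
  congr 1
  have hl := (legNorm_pos s).ne'
  have d1 : (s.descFactorial r : ℝ) = s.factorial / (s - r).factorial := by
    rw [eq_div_iff (hf _), mul_comm]
    exact_mod_cast Nat.factorial_mul_descFactorial (show r ≤ s by omega)
  have d2 : ((s + r).descFactorial r : ℝ) = (s + r).factorial / s.factorial := by
    rw [eq_div_iff (hf _), mul_comm]
    have := Nat.factorial_mul_descFactorial (show r ≤ s + r by omega)
    rw [Nat.add_sub_cancel] at this
    exact_mod_cast this
  rw [Pi.div_apply, div_pow (N0 s r), N0_sq (show r ≤ s by omega), N0_zero_sq, d1, d2, div_pow]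
  have := hf s; have := hf (s - r); have := hf (s + r)
  field_simp

lemma tendsto_pow_div_choose (k : ℕ) :
    Tendsto (fun s : ℕ => (s : ℝ) ^ k / s.choose k) atTop (𝓝 k.factorial) := by
  have h := ((tendsto_descFactorial_div_pow k).inv₀ one_ne_zero).const_mul (k.factorial : ℝ)
  rw [inv_one, mul_one] at h
  refine h.congr' ?_
  filter_upwards [eventually_ge_atTop k] with s hs
  have : (s.descFactorial k : ℝ) = k.factorial * s.choose k := by
    exact_mod_cast Nat.descFactorial_eq_factorial_mul_choose s k
  have hk : (k.factorial : ℝ) ≠ 0 := by exact_mod_cast k.factorial_ne_zero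
  have hc : (s.choose k : ℝ) ≠ 0 := by exact_mod_cast (Nat.choose_pos hs).ne'
  rw [this]
  field_simp

/-- The limits of the coefficients `massiveCoeff`. -/
def limitCoeff (r k : ℕ) : ℝ :=
  (2 : ℝ) ^ ((r : ℝ) / 2) * gammaCoeff r k * (r - 2 * k).factorial

lemma tendsto_massiveCoeff (r k : ℕ) :
    Tendsto (fun s => massiveCoeff s r k) atTop (𝓝 (limitCoeff r k)) :=
  ((tendsto_N0_div_N0 r).mul_const _).mul (tendsto_pow_div_choose _)

/-! ### The Bessel function -/

/-- `∑_j d^j / j!²`, that is, the Bessel function `J_0(x)` at `d = -x²/4`. -/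
def bessel (d : ℂ) : ℂ := ∑' j : ℕ, d ^ j / (j.factorial : ℂ) ^ 2

lemma leg_zero_even (j : ℕ) (d : ℂ) :
    leg (2 * j) 0 d = ((2 * j).choose j : ℂ) * d ^ j := by
  rw [leg, Finset.sum_eq_single j]
  · simp
  · intro i hi hij
    rw [Finset.mem_range] at hi
    rw [zero_pow (by omega)]
    ring
  · intro h
    exact absurd (Finset.mem_range.2 (by omega)) h

lemma leg_zero_odd (j : ℕ) (d : ℂ) : leg (2 * j + 1) 0 d = 0 := by
  rw [leg]
  refine Finset.sum_eq_zero fun i hi => ?_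
  rw [Finset.mem_range] at hi
  rw [zero_pow (by omega)]
  ring

lemma hasSum_circAvg {F : ℕ → ℝ → ℂ} {f : ℝ → ℂ} {b : ℕ → ℝ} (hF : ∀ n, Continuous (F n))
    (hb : Summable b) (hle : ∀ n φ, ‖F n φ‖ ≤ b n) (h : ∀ φ, HasSum (fun n => F n φ) (f φ)) :
    HasSum (fun n => circAvg (F n)) (circAvg f) := by
  refine HasSum.mul_left _ ?_
  refine intervalIntegral.hasSum_integral_of_dominated_convergence (fun n _ => b n) ?_ ?_ ?_ ?_ ?_
  · exact fun n => (hF n).aestronglyMeasurable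
  · exact fun n => Filter.Eventually.of_forall fun φ _ => hle n φ
  · exact Filter.Eventually.of_forall fun φ _ => hb
  · simp
  · exact Filter.Eventually.of_forall fun φ _ => h φ

lemma circAvg_zpow_mul_exp (n : ℕ) (c : ℂ) :
    circAvg (fun φ => phase φ ^ (-(n : ℤ)) * Complex.exp (phase φ * c)) = c ^ n / n.factorial := by
  have hz : ∀ n : ℤ, Continuous fun φ => phase φ ^ n := fun n =>
    continuous_phase.zpow₀ _ fun φ => Or.inl (phase_ne_zero φ)
  have h := hasSum_circAvg (F := fun m φ => c ^ m / m.factorial * phase φ ^ ((m : ℤ) - n))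
    (f := fun φ => phase φ ^ (-(n : ℤ)) * Complex.exp (phase φ * c))
    (fun m => continuous_const.mul (hz _)) (Real.summable_pow_div_factorial ‖c‖) ?_ ?_
  · simp only [circAvg_const_mul, circAvg_phase_zpow] at h
    have h2 := hasSum_single (f := fun m : ℕ =>
      c ^ m / m.factorial * if (m : ℤ) - n = 0 then 1 else (0 : ℂ)) n fun m hm => by
        rw [if_neg (by omega), mul_zero]
    rw [h.unique h2]
    simp
  · intro m φ
    rw [norm_mul, norm_zpow, norm_phase, one_zpow, mul_one, norm_div, norm_pow,
      Complex.norm_natCast]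
  · intro φ
    have := (NormedSpace.expSeries_div_hasSum_exp (𝔸 := ℂ) (phase φ * c)).mul_left
      (phase φ ^ (-(n : ℤ)))
    rw [← Complex.exp_eq_exp_ℂ] at this
    have e : (fun m : ℕ => c ^ m / m.factorial * phase φ ^ ((m : ℤ) - n))
        = fun m : ℕ => phase φ ^ (-(n : ℤ)) * ((phase φ * c) ^ m / m.factorial) := by
      ext m
      rw [sub_eq_neg_add, zpow_add₀ (phase_ne_zero φ), zpow_natCast, mul_pow]
      ring
    rw [e]
    exact this

lemma circAvg_exp_eq_bessel (c c' : ℂ) :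
    circAvg (fun φ => Complex.exp (phase φ * c + (phase φ)⁻¹ * c')) = bessel (c * c') := by
  have hinv : Continuous fun φ => (phase φ)⁻¹ := continuous_phase.inv₀ phase_ne_zero
  have h2 := hasSum_circAvg
    (F := fun (n : ℕ) φ => (phase φ * c + (phase φ)⁻¹ * c') ^ n / (n.factorial : ℂ))
    (f := fun φ => Complex.exp (phase φ * c + (phase φ)⁻¹ * c'))
    (fun n => by fun_prop) (Real.summable_pow_div_factorial (‖c‖ + ‖c'‖)) ?_ ?_
  · have h3 : ∀ n : ℕ, circAvg (fun φ => (phase φ * c + (phase φ)⁻¹ * c') ^ n / (n.factorial : ℂ))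
        = leg n 0 (c * c') / (n.factorial : ℂ) := by
      intro n
      rw [← circAvg_trinomial', circAvg, intervalIntegral.integral_div, ← mul_div_assoc]
      simp only [zero_add]
      rfl
    simp only [h3] at h2
    have h4 := (Function.Injective.hasSum_iff (f := fun n : ℕ =>
      leg n 0 (c * c') / (n.factorial : ℂ)) (g := fun j : ℕ => 2 * j)
      (fun a b hab => by simpa using hab) ?_).2 h2
    · have h5 : ((fun n : ℕ => leg n 0 (c * c') / (n.factorial : ℂ)) ∘ fun j : ℕ => 2 * j)
          = fun j : ℕ => (c * c') ^ j / (j.factorial : ℂ) ^ 2 := by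
        ext j
        have hf : ∀ n : ℕ, (n.factorial : ℂ) ≠ 0 := fun n => by exact_mod_cast n.factorial_ne_zero
        have := hf j; have := hf (2 * j)
        rw [Function.comp_apply, leg_zero_even, Nat.cast_choose ℂ (show j ≤ 2 * j by omega),
          show 2 * j - j = j by omega]
        field_simp
      rw [h5] at h4
      exact h4.tsum_eq.symm
    · intro n hn
      rcases Nat.even_or_odd' n with ⟨j, rfl | rfl⟩
      · exact absurd ⟨j, rfl⟩ hn
      · rw [leg_zero_odd, zero_div]
  · intro n φ
    rw [norm_div, norm_pow, Complex.norm_natCast]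
    gcongr
    refine (norm_add_le _ _).trans_eq ?_
    rw [norm_mul, norm_mul, norm_inv, norm_phase]
    ring
  · intro φ
    rw [Complex.exp_eq_exp_ℂ]
    exact NormedSpace.expSeries_div_hasSum_exp _

lemma continuous_bessel : Continuous bessel := by
  have h : bessel = fun d => circAvg fun φ => Complex.exp (phase φ * d + (phase φ)⁻¹ * 1) := by
    ext d
    rw [circAvg_exp_eq_bessel, mul_one]
  rw [h]
  have hinv : Continuous fun φ => (phase φ)⁻¹ := continuous_phase.inv₀ phase_ne_zero
  refine continuous_circAvg ?_
  exact Complex.continuous_exp.comp (((continuous_phase.comp continuous_snd).mul continuous_fst).add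
    ((hinv.comp continuous_snd).mul continuous_const))

lemma circAvg_exp_cos_sin (a b : ℂ) :
    circAvg (fun φ => Complex.exp (I * (a * Real.cos φ + b * Real.sin φ)))
      = bessel (-(a ^ 2 + b ^ 2) / 4) := by
  have h := circAvg_exp_eq_bessel ((I * a + b) / 2) ((I * a - b) / 2)
  rw [show (I * a + b) / 2 * ((I * a - b) / 2) = -(a ^ 2 + b ^ 2) / 4 by
    linear_combination a ^ 2 / 4 * Complex.I_sq] at h
  rw [← h]
  refine circAvg_congr fun φ => congrArg _ ?_
  rw [phase_inv_eq, phase_eq]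
  ring

/-! ### The limit of the Legendre functions -/

lemma choose_mul_choose_eq (s j : ℕ) : ((s.choose (2 * j) * (2 * j).choose j : ℕ) : ℝ)
    = s.descFactorial (2 * j) / (j.factorial : ℝ) ^ 2 := by
  have h1 : (s.descFactorial (2 * j) : ℝ) = (2 * j).factorial * s.choose (2 * j) := by
    exact_mod_cast Nat.descFactorial_eq_factorial_mul_choose s (2 * j)
  have hf : (j.factorial : ℝ) ≠ 0 := by exact_mod_cast j.factorial_ne_zero
  have h2 := Nat.cast_choose ℝ (show j ≤ 2 * j by omega)
  rw [show 2 * j - j = j by omega] at h2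
  push_cast
  rw [h1, h2]
  field_simp

lemma legScaled_eq_tsum (s : ℕ) (a b c : ℂ) : legScaled s a b c
    = ∑' j : ℕ, ((s.choose (2 * j) * (2 * j).choose j : ℕ) : ℂ) * ((1 - a / s ^ 2) ^ (s - 2 * j)
      * ((b - 2 * a + c + (a ^ 2 - b * c) / s ^ 2) / (4 * s ^ 2)) ^ j) := by
  rw [tsum_eq_sum (s := Finset.range (s / 2 + 1))]
  · rfl
  · intro j hj
    rw [Finset.mem_range] at hj
    rw [Nat.choose_eq_zero_of_lt (show s < 2 * j by omega)]
    simp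

lemma norm_legScaled_term_le {s : ℕ} (hs : s ≠ 0) {C : ℝ} {a b c : ℂ} (ha : ‖a‖ ≤ C) (hb : ‖b‖ ≤ C)
    (hc : ‖c‖ ≤ C) (j : ℕ) :
    ‖((s.choose (2 * j) * (2 * j).choose j : ℕ) : ℂ) * ((1 - a / s ^ 2) ^ (s - 2 * j)
      * ((b - 2 * a + c + (a ^ 2 - b * c) / s ^ 2) / (4 * s ^ 2)) ^ j)‖
      ≤ Real.exp C * ((C + C ^ 2) ^ j / j.factorial) := by
  have hs1 : (1 : ℝ) ≤ s := by exact_mod_cast Nat.one_le_iff_ne_zero.2 hs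
  have hC : 0 ≤ C := (norm_nonneg a).trans ha
  have h1 : ‖(1 - a / s ^ 2 : ℂ) ^ (s - 2 * j)‖ ≤ Real.exp C := by
    have : ‖(1 - a / s ^ 2 : ℂ)‖ ≤ 1 + C / s := by
      refine (norm_sub_le _ _).trans ?_
      rw [norm_one, norm_div, norm_pow, Complex.norm_natCast]
      gcongr
      nlinarith
    rw [norm_pow]
    calc ‖(1 - a / s ^ 2 : ℂ)‖ ^ (s - 2 * j) ≤ (1 + C / s) ^ (s - 2 * j) := by gcongr
      _ ≤ (1 + C / s) ^ s := pow_le_pow_right₀ (by linarith [div_nonneg hC (by linarith : (0 : ℝ) ≤ s)])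
        (Nat.sub_le _ _)
      _ ≤ Real.exp (C / s) ^ s := by
        gcongr
        linarith [Real.add_one_le_exp (C / s)]
      _ = Real.exp C := by
        rw [← Real.exp_nat_mul]
        congr 1
        field_simp
  have h2 : ‖(b - 2 * a + c + (a ^ 2 - b * c) / s ^ 2 : ℂ)‖ ≤ 4 * (C + C ^ 2) := by
    have e1 : ‖((a ^ 2 - b * c) / s ^ 2 : ℂ)‖ ≤ 2 * C ^ 2 := by
      rw [norm_div, norm_pow, Complex.norm_natCast]
      refine (div_le_self (norm_nonneg _) (by nlinarith)).trans ((norm_sub_le _ _).trans ?_)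
      rw [norm_pow, norm_mul]
      nlinarith [norm_nonneg a, norm_nonneg b, norm_nonneg c, mul_le_mul hb hc (norm_nonneg c) hC,
        mul_le_mul ha ha (norm_nonneg a) hC]
    have e2 : ‖(2 * a : ℂ)‖ ≤ 2 * C := by rw [norm_mul]; simpa using ha
    have := norm_add_le (b - 2 * a + c) ((a ^ 2 - b * c) / s ^ 2)
    have := norm_add_le (b - 2 * a) c
    have := norm_sub_le b (2 * a)
    nlinarith
  have h3 : ((s.choose (2 * j) * (2 * j).choose j : ℕ) : ℝ)
      ≤ (s : ℝ) ^ (2 * j) / j.factorial := by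
    rw [choose_mul_choose_eq]
    have e1 : (s.descFactorial (2 * j) : ℝ) ≤ (s : ℝ) ^ (2 * j) := by
      exact_mod_cast Nat.descFactorial_le_pow s (2 * j)
    have e2 : (1 : ℝ) ≤ j.factorial := by exact_mod_cast Nat.factorial_pos j
    gcongr
    nlinarith
  rw [norm_mul, norm_mul, Complex.norm_natCast, norm_pow _ j, norm_div, norm_mul, norm_pow _ 2,
    Complex.norm_natCast]
  calc _ ≤ (s : ℝ) ^ (2 * j) / j.factorial
        * (Real.exp C * (4 * (C + C ^ 2) / (‖(4 : ℂ)‖ * (s : ℝ) ^ 2)) ^ j) := by gcongr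
    _ = Real.exp C * ((C + C ^ 2) ^ j / j.factorial) := by
      rw [show ‖(4 : ℂ)‖ = 4 by norm_num, pow_mul, div_pow, mul_pow, mul_pow]
      field_simp

lemma norm_legScaled_le {s : ℕ} (hs : s ≠ 0) {C : ℝ} {a b c : ℂ} (ha : ‖a‖ ≤ C) (hb : ‖b‖ ≤ C)
    (hc : ‖c‖ ≤ C) : ‖legScaled s a b c‖ ≤ Real.exp C * Real.exp (C + C ^ 2) := by
  rw [legScaled_eq_tsum]
  have hsum := (Real.summable_pow_div_factorial (C + C ^ 2)).mul_left (Real.exp C)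
  refine (tsum_of_norm_bounded hsum.hasSum (norm_legScaled_term_le hs ha hb hc)).trans_eq ?_
  rw [tsum_mul_left]
  congr 1
  rw [Real.exp_eq_exp_ℝ]
  exact (NormedSpace.expSeries_div_hasSum_exp (𝔸 := ℝ) (C + C ^ 2)).tsum_eq

lemma tendsto_legScaled {a b c : ℕ → ℂ} {a₀ b₀ c₀ : ℂ} (ha : Tendsto a atTop (𝓝 a₀))
    (hb : Tendsto b atTop (𝓝 b₀)) (hc : Tendsto c atTop (𝓝 c₀)) :
    Tendsto (fun s => legScaled s (a s) (b s) (c s)) atTop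
      (𝓝 (bessel ((b₀ - 2 * a₀ + c₀) / 4))) := by
  simp only [legScaled_eq_tsum, bessel]
  set C : ℝ := max (max (‖a₀‖ + 1) (‖b₀‖ + 1)) (‖c₀‖ + 1) with hC
  have bd : ∀ {f : ℕ → ℂ} {f₀ : ℂ}, Tendsto f atTop (𝓝 f₀) → ∀ᶠ s in atTop, ‖f s‖ ≤ ‖f₀‖ + 1 :=
    fun h => (h.norm.eventually_le_const (lt_add_one _))
  have hinv : Tendsto (fun s : ℕ => ((s : ℂ))⁻¹) atTop (𝓝 0) := tendsto_inv_atTop_nhds_zero_nat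
  refine tendsto_tsum_of_dominated_convergence
    ((Real.summable_pow_div_factorial (C + C ^ 2)).mul_left (Real.exp C)) (fun j => ?_) ?_
  · have h1 : Tendsto (fun s : ℕ => ((((s.descFactorial (2 * j) : ℝ) / (s : ℝ) ^ (2 * j)) : ℝ) : ℂ))
        atTop (𝓝 1) := by
      exact (Complex.continuous_ofReal.tendsto' 1 1 Complex.ofReal_one).comp
        (tendsto_descFactorial_div_pow (2 * j))
    have hg : Tendsto (fun s : ℕ => (1 + -(a s / s ^ 2) : ℂ)) atTop (𝓝 1) := by
      have := ((ha.mul (hinv.pow 2)).neg).const_add 1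
      simpa [div_eq_mul_inv] using this
    have h2 : Tendsto (fun s : ℕ => (1 - a s / s ^ 2) ^ (s - 2 * j)) atTop (𝓝 1) := by
      have e1 := Complex.tendsto_one_add_pow_exp_of_tendsto (g := fun s => -(a s / s ^ 2)) (t := 0) (by
        have := (ha.mul hinv).neg
        rw [mul_zero, neg_zero] at this
        refine this.congr' ?_
        filter_upwards [eventually_ne_atTop 0] with s hs
        have : (s : ℂ) ≠ 0 := by exact_mod_cast hs
        field_simp)
      rw [Complex.exp_zero] at e1
      have e3 := e1.div (hg.pow (2 * j)) (by simp)
      rw [one_pow, div_one] at e3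
      refine e3.congr' ?_
      filter_upwards [hg.eventually_ne one_ne_zero, eventually_ge_atTop (2 * j)] with s hs hj
      rw [Pi.div_apply, ← sub_eq_add_neg] at *
      rw [pow_sub₀ _ hs hj, div_eq_mul_inv]
    have h3 : Tendsto (fun s : ℕ => ((b s - 2 * a s + c s + (a s ^ 2 - b s * c s) / s ^ 2) / 4) ^ j)
        atTop (𝓝 (((b₀ - 2 * a₀ + c₀) / 4) ^ j)) := by
      have := (((((hb.sub (ha.const_mul 2)).add hc).add
        (((ha.pow 2).sub (hb.mul hc)).mul (hinv.pow 2)))).div_const 4).pow j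
      simpa [div_eq_mul_inv] using this
    have h4 := ((h1.mul (h2.mul h3)).div_const ((j.factorial : ℂ) ^ 2))
    rw [one_mul, one_mul] at h4
    refine h4.congr' ?_
    filter_upwards [eventually_ne_atTop 0] with s hs
    have hs' : (s : ℂ) ≠ 0 := by exact_mod_cast hs
    have e := congrArg (fun x : ℝ => (x : ℂ)) (choose_mul_choose_eq s j)
    simp only [Complex.ofReal_natCast, Complex.ofReal_div, Complex.ofReal_pow] at e
    rw [e]
    simp only [Complex.ofReal_natCast, Complex.ofReal_div, Complex.ofReal_pow]
    rw [pow_mul, div_pow, div_pow, mul_pow]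
    field_simp
  · filter_upwards [bd ha, bd hb, bd hc, eventually_ne_atTop 0] with s h1 h2 h3 hs
    exact norm_legScaled_term_le hs (h1.trans ((le_max_left _ _).trans (le_max_left _ _)))
      (h2.trans ((le_max_right _ _).trans (le_max_left _ _))) (h3.trans (le_max_right _ _))

/-! ### The infinite-spin intertwiners -/

lemma IsLorentz.mink_mulVec_mulVec {L : Matrix (Fin 4) (Fin 4) ℝ} (hL : IsLorentz L) (x y : Vec) :
    mink (Matrix.mulVec L x) (Matrix.mulVec L y) = mink x y := by
  rw [mink_mulVec, hL.rowVec_mulVec]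
  change Matrix.vecMul x eta ⬝ᵥ y = _
  rw [← Matrix.dotProduct_mulVec]
  rfl

lemma Tensor.eval_smul {r : ℕ} (c : ℂ) (X : Tensor r) (v : Vec) :
    Tensor.eval (c • X) v = c * Tensor.eval X v := by
  simp only [Tensor.eval, Pi.smul_apply, smul_eq_mul, Finset.mul_sum]
  exact Finset.sum_congr rfl fun μ _ => by ring

lemma Tensor.eval_sum {r : ℕ} {α : Type*} (S : Finset α) (X : α → Tensor r) (v : Vec) :
    Tensor.eval (∑ k ∈ S, X k) v = ∑ k ∈ S, Tensor.eval (X k) v := by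
  simp only [Tensor.eval, Finset.sum_apply, Finset.mul_sum]
  rw [Finset.sum_comm]

lemma eval_symmetrize {r : ℕ} (X : Tensor r) (v : Vec) :
    Tensor.eval (symmetrize X) v = Tensor.eval X v := by
  have h : ∀ σ : Equiv.Perm (Fin r),
      ∑ μ : Fin r → Fin 4, (∏ i, (v (μ i) : ℂ)) * X (μ ∘ σ) = Tensor.eval X v := by
    intro σ
    rw [Tensor.eval, ← (Equiv.arrowCongr σ (Equiv.refl (Fin 4))).sum_comp]
    refine Finset.sum_congr rfl fun μ _ => ?_
    congr 1
    · rw [← Equiv.prod_comp σ]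
      simp [Equiv.arrowCongr]
    · congr 1
      ext i
      simp [Equiv.arrowCongr]
  have h2 : Tensor.eval (symmetrize X) v = ((r.factorial : ℂ))⁻¹ *
      ∑ σ : Equiv.Perm (Fin r), ∑ μ : Fin r → Fin 4, (∏ i, (v (μ i) : ℂ)) * X (μ ∘ σ) := by
    simp only [Tensor.eval, symmetrize, Finset.mul_sum]
    rw [Finset.sum_comm]
    exact Finset.sum_congr rfl fun σ _ => Finset.sum_congr rfl fun μ _ => by ring
  have hf : (r.factorial : ℂ) ≠ 0 := by exact_mod_cast r.factorial_ne_zero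
  simp only [h2, h, Finset.sum_const, Finset.card_univ, Fintype.card_perm, Fintype.card_fin,
    nsmul_eq_mul]
  field_simp

/-- A multi-index, extended by zero. -/
def extendIndex {r : ℕ} (μ : Fin r → Fin 4) (n : ℕ) : Fin 4 := if h : n < r then μ ⟨n, h⟩ else 0

lemma extendIndex_val {r : ℕ} (μ : Fin r → Fin 4) (i : Fin r) : extendIndex μ i = μ i := by
  simp [extendIndex]

lemma extendIndex_update {r : ℕ} (μ : Fin r → Fin 4) (i : Fin r) (a : Fin 4) (n : ℕ) :
    extendIndex (Function.update μ i a) n = if n = i then a else extendIndex μ n := by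
  unfold extendIndex
  by_cases h : n = i
  · subst h; simp
  · rw [if_neg h]
    split_ifs with h'
    · rw [Function.update_of_ne]
      exact fun e => h (by rw [← e])
    · rfl

lemma extendIndex_cons_zero {r : ℕ} (a : Fin 4) (μ : Fin r → Fin 4) :
    extendIndex (Fin.cons a μ : Fin (r + 1) → Fin 4) 0 = a := by
  simp [extendIndex]

lemma extendIndex_cons_succ {r : ℕ} (a : Fin 4) (μ : Fin r → Fin 4) (n : ℕ) :
    extendIndex (Fin.cons a μ : Fin (r + 1) → Fin 4) (n + 1) = extendIndex μ n := by
  unfold extendIndex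
  by_cases h : n < r
  · rw [dif_pos h, dif_pos (Nat.succ_lt_succ h)]
    exact Fin.cons_succ (α := fun _ => Fin 4) a μ ⟨n, h⟩
  · rw [dif_neg h, dif_neg (by omega)]

lemma pairOps_prod {r : ℕ} (e p : Vec) (c : ℂ) (j : Fin 4 → ℂ) {X : Tensor r}
    (hX : ∀ μ, X μ = c * ∏ i, j (μ i)) (k : ℕ) (hk : 2 * k ≤ r) (μ : Fin r → Fin 4) :
    pairOps e p X k μ = c * (∑ a, ∑ b, (eta a b : ℂ) * (j a * j b)) ^ k
      * ((∏ l ∈ Finset.range k,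
          (EE e p (extendIndex μ (2 * l)) (extendIndex μ (2 * l + 1)) : ℂ))
        * ∏ n ∈ Finset.Ico (2 * k) r, j (extendIndex μ n)) := by
  induction k generalizing μ with
  | zero =>
    rw [pairOps, hX]
    simp only [pow_zero, mul_one, Finset.range_zero, Finset.prod_empty, one_mul, mul_zero,
      Nat.Ico_zero_eq_range]
    rw [← Fin.prod_univ_eq_prod_range (fun n => j (extendIndex μ n))]
    simp only [extendIndex_val]
  | succ k ih =>
    have h : 2 * k + 1 < r := by omega
    rw [pairOps, dif_pos h, pairOp]
    simp only [ih (by omega)]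
    have h1 : ∀ a b : Fin 4, ∀ n, extendIndex (Function.update (Function.update μ
        (⟨2 * k, Nat.lt_of_succ_lt h⟩ : Fin r) a) (⟨2 * k + 1, h⟩ : Fin r) b) n
        = if n = 2 * k + 1 then b else if n = 2 * k then a else extendIndex μ n := by
      intro a b n
      rw [extendIndex_update, extendIndex_update]
    simp only [h1]
    have h2 : ∀ a b : Fin 4, ∏ l ∈ Finset.range k,
        (EE e p (if 2 * l = 2 * k + 1 then b else if 2 * l = 2 * k then a else extendIndex μ (2 * l))
          (if 2 * l + 1 = 2 * k + 1 then b else if 2 * l + 1 = 2 * k then a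
            else extendIndex μ (2 * l + 1)) : ℂ)
        = ∏ l ∈ Finset.range k,
          (EE e p (extendIndex μ (2 * l)) (extendIndex μ (2 * l + 1)) : ℂ) := by
      intro a b
      refine Finset.prod_congr rfl fun l hl => ?_
      rw [Finset.mem_range] at hl
      rw [if_neg (by omega), if_neg (by omega), if_neg (by omega), if_neg (by omega)]
    have h3 : ∀ a b : Fin 4, ∏ n ∈ Finset.Ico (2 * k) r,
        j (if n = 2 * k + 1 then b else if n = 2 * k then a else extendIndex μ n)
        = j a * j b * ∏ n ∈ Finset.Ico (2 * (k + 1)) r, j (extendIndex μ n) := by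
      intro a b
      rw [Finset.prod_eq_prod_Ico_succ_bot (by omega), Finset.prod_eq_prod_Ico_succ_bot h,
        if_neg (by omega), if_pos rfl, if_pos rfl, ← mul_assoc]
      congr 1
      refine Finset.prod_congr rfl fun n hn => ?_
      rw [Finset.mem_Ico] at hn
      rw [if_neg (by omega), if_neg (by omega)]
    simp only [h2, h3]
    rw [Finset.prod_range_succ, pow_succ]
    have h4 : (extendIndex μ (2 * k)) = μ ⟨2 * k, Nat.lt_of_succ_lt h⟩ :=
      extendIndex_val μ ⟨2 * k, Nat.lt_of_succ_lt h⟩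
    have h5 : (extendIndex μ (2 * k + 1)) = μ ⟨2 * k + 1, h⟩ := extendIndex_val μ ⟨2 * k + 1, h⟩
    rw [h4, h5]
    simp only [Finset.mul_sum, Finset.sum_mul]
    refine Finset.sum_congr rfl fun a _ => Finset.sum_congr rfl fun b _ => ?_
    ring

lemma sum_cons (r : ℕ) (f : (Fin (r + 1) → Fin 4) → ℂ) :
    ∑ μ, f μ = ∑ a, ∑ μ : Fin r → Fin 4, f (Fin.cons a μ) := by
  rw [← (Fin.consEquiv fun _ => Fin 4).sum_comp, Fintype.sum_prod_type]
  rfl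

lemma sum_cons_cons (r : ℕ) (f : (Fin (r + 2) → Fin 4) → ℂ) :
    ∑ μ, f μ = ∑ a, ∑ b, ∑ μ : Fin r → Fin 4,
      f (Fin.cons a (Fin.cons b μ : Fin (r + 1) → Fin 4)) := by
  rw [sum_cons]
  exact Finset.sum_congr rfl fun a _ => sum_cons r _

lemma sum_prod_pairs (v j : Fin 4 → ℂ) (E : Fin 4 → Fin 4 → ℂ) (k : ℕ) : ∀ r, 2 * k ≤ r →
    ∑ μ : Fin r → Fin 4, (∏ i, v (μ i)) * ((∏ l ∈ Finset.range k,
        E (extendIndex μ (2 * l)) (extendIndex μ (2 * l + 1)))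
      * ∏ n ∈ Finset.Ico (2 * k) r, j (extendIndex μ n))
    = (∑ a, ∑ b, v a * v b * E a b) ^ k * (∑ a, v a * j a) ^ (r - 2 * k) := by
  induction k with
  | zero =>
    intro r _
    have h1 : ∀ μ : Fin r → Fin 4, ∏ n ∈ Finset.Ico (2 * 0) r, j (extendIndex μ n)
        = ∏ i, j (μ i) := by
      intro μ
      rw [mul_zero, Nat.Ico_zero_eq_range, ← Fin.prod_univ_eq_prod_range
        (fun n => j (extendIndex μ n))]
      simp only [extendIndex_val]
    simp only [h1, Finset.range_zero, Finset.prod_empty, one_mul, pow_zero,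
      ← Finset.prod_mul_distrib]
    rw [← Fintype.piFinset_univ, Finset.sum_prod_piFinset Finset.univ fun _ c => v c * j c]
    simp
  | succ k ih =>
    intro r hr
    obtain ⟨r, rfl⟩ : ∃ r', r = r' + 2 := ⟨r - 2, by omega⟩
    rw [sum_cons_cons]
    have h1 : ∀ (a b : Fin 4) (μ : Fin r → Fin 4),
        ∏ l ∈ Finset.range (k + 1), E
          (extendIndex (Fin.cons a (Fin.cons b μ : Fin (r + 1) → Fin 4) : Fin (r + 2) → Fin 4) (2 * l))
          (extendIndex (Fin.cons a (Fin.cons b μ : Fin (r + 1) → Fin 4) : Fin (r + 2) → Fin 4)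
            (2 * l + 1))
        = E a b * ∏ l ∈ Finset.range k,
          E (extendIndex μ (2 * l)) (extendIndex μ (2 * l + 1)) := by
      intro a b μ
      rw [Finset.prod_range_succ', mul_comm (∏ l ∈ Finset.range k, _)]
      refine congrArg₂ (· * ·) ?_ (Finset.prod_congr rfl fun l _ => ?_)
      · rw [mul_zero, extendIndex_cons_zero, extendIndex_cons_succ, extendIndex_cons_zero]
      · rw [show 2 * (l + 1) = 2 * l + 1 + 1 by ring, extendIndex_cons_succ, extendIndex_cons_succ,
          extendIndex_cons_succ, extendIndex_cons_succ]
    have h2 : ∀ (a b : Fin 4) (μ : Fin r → Fin 4),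
        ∏ n ∈ Finset.Ico (2 * (k + 1)) (r + 2), j
          (extendIndex (Fin.cons a (Fin.cons b μ : Fin (r + 1) → Fin 4) : Fin (r + 2) → Fin 4) n)
        = ∏ n ∈ Finset.Ico (2 * k) r, j (extendIndex μ n) := by
      intro a b μ
      rw [show 2 * (k + 1) = 2 * k + 2 by ring, ← Finset.prod_Ico_add']
      refine Finset.prod_congr rfl fun n _ => ?_
      rw [show n + 2 = n + 1 + 1 by ring, extendIndex_cons_succ, extendIndex_cons_succ]
    simp only [h1, h2, Fin.prod_univ_succ, Fin.cons_zero, Fin.cons_succ]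
    have h3 : ∀ a b, ∑ μ : Fin r → Fin 4, (v a * (v b * ∏ i, v (μ i))) * (E a b *
        (∏ l ∈ Finset.range k, E (extendIndex μ (2 * l)) (extendIndex μ (2 * l + 1)))
        * ∏ n ∈ Finset.Ico (2 * k) r, j (extendIndex μ n))
        = v a * v b * E a b * ((∑ a, ∑ b, v a * v b * E a b) ^ k
          * (∑ a, v a * j a) ^ (r - 2 * k)) := by
      intro a b
      rw [← ih r (by omega), Finset.mul_sum]
      exact Finset.sum_congr rfl fun μ _ => by ring
    simp only [h3, ← Finset.sum_mul]
    rw [show r + 2 - 2 * (k + 1) = r - 2 * k by omega, pow_succ]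
    ring

lemma Ur_eval {κ : ℝ} (hκ : κ ≠ 0) (r : ℕ) {L : Matrix (Fin 4) (Fin 4) ℝ} (hL : IsLorentz L)
    {e p : Vec} (hp : Matrix.mulVec L ![1, 0, 0, 1] = p) {k : Fin 2 → ℝ}
    (hk : k 0 ^ 2 + k 1 ^ 2 = κ ^ 2) (v : Vec) :
    (Ur r κ L e p k).eval v = ((2 : ℝ) ^ ((r : ℝ) / 2) : ℝ) *
      ((∑ l ∈ Finset.range (r / 2 + 1), (gammaCoeff r l : ℂ) * ((-EEval e p v : ℝ) : ℂ) ^ l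
        * (((-κ)⁻¹ * mink (tv e p v) (Ep L k) : ℝ) : ℂ) ^ (r - 2 * l)) * u0 κ L e p k) := by
  set j : Fin 4 → ℝ := fun μ => ∑ ν, J e p μ ν * lower (Ep L k) ν with hj
  have hX : ∀ μ, ur r κ L e p k μ
      = ((((-κ : ℝ) : ℂ)⁻¹ ^ r) * u0 κ L e p k) * ∏ i, ((j (μ i) : ℝ) : ℂ) := by
    intro μ
    simp only [ur, hj]
    ring
  have hj2 : ∀ μ, j μ = lower (Ep L k - (mink e (Ep L k) / mink e p) • p) μ := by
    intro μ
    have : ∑ ν, J e p μ ν * lower (Ep L k) ν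
        = lower (Ep L k) μ - lower p μ * mink e (Ep L k) / mink e p := by
      simp only [J, sub_mul, Finset.sum_sub_distrib, ite_mul, one_mul, zero_mul, Finset.sum_ite_eq,
        Finset.mem_univ, if_true]
      congr 1
      change _ = lower p μ * (∑ ν, e ν * lower (Ep L k) ν) / mink e p
      rw [Finset.mul_sum, Finset.sum_div]
      exact Finset.sum_congr rfl fun ν _ => by ring
    refine this.trans ?_
    simp only [lower, Matrix.mulVec_sub, Matrix.mulVec_smul, Pi.sub_apply, Pi.smul_apply,
      smul_eq_mul]
    ring
  have hjj : ∑ a, ∑ b, (eta a b : ℂ) * ((j a : ℂ) * (j b : ℂ)) = ((-κ ^ 2 : ℝ) : ℂ) := by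
    have h1 : ∀ x : Vec, ∑ a, ∑ b, eta a b * (lower x a * lower x b) = mink x x := by
      intro x
      rw [mink_eq]
      simp [lower, eta, Matrix.mulVec_diagonal, Fin.sum_univ_four, Matrix.diagonal_apply]
      ring
    have h2 : mink (Ep L k) (Ep L k) = -κ ^ 2 := by
      rw [Ep, hL.mink_mulVec_mulVec, mink_eq, ← hk]; simp; ring
    have h3 : mink p p = 0 := by
      rw [← hp, hL.mink_mulVec_mulVec, mink_eq]; simp
    have h4 : mink (Ep L k) p = 0 := by
      rw [← hp, Ep, hL.mink_mulVec_mulVec, mink_eq]; simp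
    have h5 := h1 (Ep L k - (mink e (Ep L k) / mink e p) • p)
    simp only [← hj2] at h5
    have h6 : mink (Ep L k - (mink e (Ep L k) / mink e p) • p)
        (Ep L k - (mink e (Ep L k) / mink e p) • p) = -κ ^ 2 := by
      rw [mink_sub_left, mink_smul_left, mink_comm _ (_ - _), mink_comm _ (_ - _), mink_sub_left,
        mink_sub_left, mink_smul_left, mink_smul_left, h2, h3, mink_comm p, h4]
      ring
    rw [← h6, ← h5]
    push_cast
    rfl
  have hv : ∑ a, (v a : ℂ) * (j a : ℂ) = (mink (tv e p v) (Ep L k) : ℂ) := by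
    have : ∑ a, v a * j a = mink (tv e p v) (Ep L k) := by
      change _ = ∑ ν, tv e p v ν * lower (Ep L k) ν
      simp only [hj, ← sum_mul_J, Finset.mul_sum, Finset.sum_mul]
      rw [Finset.sum_comm]
      exact Finset.sum_congr rfl fun _ _ => Finset.sum_congr rfl fun _ _ => by ring
    rw [← this]
    push_cast
    rfl
  have hE : ∑ a, ∑ b, (v a : ℂ) * (v b : ℂ) * (EE e p a b : ℂ) = (EEval e p v : ℂ) := by
    rw [EEval]
    push_cast
    rfl
  rw [Ur, Tensor.eval_smul, eval_symmetrize, Tensor.eval_sum, Finset.sum_mul]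
  congr 1
  refine Finset.sum_congr rfl fun l hl => ?_
  rw [Finset.mem_range] at hl
  have hl' : 2 * l ≤ r := by omega
  rw [Tensor.eval_smul, Tensor.eval]
  simp only [pairOps_prod e p _ (fun a => (j a : ℂ)) hX l hl', hjj]
  have h7 := sum_prod_pairs (fun a => (v a : ℂ)) (fun a => (j a : ℂ)) (fun a b => (EE e p a b : ℂ))
    l r hl'
  have h8 : ∀ c : ℂ, ∑ μ : Fin r → Fin 4, (∏ i, (v (μ i) : ℂ)) * (c * ((∏ l ∈ Finset.range l,
        (EE e p (extendIndex μ (2 * l)) (extendIndex μ (2 * l + 1)) : ℂ))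
      * ∏ n ∈ Finset.Ico (2 * l) r, (j (extendIndex μ n) : ℂ)))
      = c * ((EEval e p v : ℂ) ^ l * (mink (tv e p v) (Ep L k) : ℂ) ^ (r - 2 * l)) := by
    intro c
    rw [← hE, ← hv, ← h7, Finset.mul_sum]
    exact Finset.sum_congr rfl fun _ _ => by ring
  rw [h8]
  obtain ⟨n, rfl⟩ : ∃ n, r = n + 2 * l := ⟨r - 2 * l, by omega⟩
  rw [Nat.add_sub_cancel, pow_add]
  have hκ' : (κ : ℂ) ≠ 0 := by exact_mod_cast hκ
  have h9 : (((-κ : ℝ) : ℂ)⁻¹) ^ (2 * l) * ((-κ ^ 2 : ℝ) : ℂ) ^ l = (-1) ^ l := by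
    rw [pow_mul, ← mul_pow]
    congr 1
    push_cast
    field_simp
  push_cast at h9 ⊢
  rw [mul_pow, neg_pow (EEval e p v : ℂ)]
  linear_combination ((gammaCoeff (n + 2 * l) l : ℂ) * ((-(κ : ℂ))⁻¹) ^ n * u0 κ L e p k
    * (EEval e p v : ℂ) ^ l * (mink (tv e p v) (Ep L k) : ℂ) ^ n) * h9

/-! ### The infinite-spin two-point kernel -/

/-- The limit of `legScaled`. -/
def besselScaled (a b c : ℂ) : ℂ := bessel ((b - 2 * a + c) / 4)

/-- The product of `u` with the image under `L` of the unit vector at the angle `φ` in the plane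
transverse to the standard momentum. -/
def transverse (L : Matrix (Fin 4) (Fin 4) ℝ) (u : Vec) (φ : ℝ) : ℝ :=
  rowVec L u 1 * Real.cos φ + rowVec L u 2 * Real.sin φ

lemma mink_Ep (L : Matrix (Fin 4) (Fin 4) ℝ) (u : Vec) (κ φ : ℝ) :
    mink u (Ep L ![κ * Real.cos φ, κ * Real.sin φ]) = κ * transverse L u φ := by
  rw [Ep, mink_mulVec, transverse]
  simp [Fin.sum_univ_four]
  ring

lemma continuous_transverse (L : Matrix (Fin 4) (Fin 4) ℝ) (u : Vec) :
    Continuous (transverse L u) := by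
  unfold transverse; fun_prop

lemma massless_boost_rowVec {L : Matrix (Fin 4) (Fin 4) ℝ} {p : Vec}
    (hp : Matrix.mulVec L ![1, 0, 0, 1] = p) (u : Vec) :
    mink u p = rowVec L u 0 + rowVec L u 3 := by
  rw [← hp, mink_mulVec]
  simp [Fin.sum_univ_four]

lemma besselScaled_gram (κ : ℝ) {L : Matrix (Fin 4) (Fin 4) ℝ} (hL : IsLorentz L) {e e' p : Vec}
    (hp : Matrix.mulVec L ![1, 0, 0, 1] = p) (he : mink e p ≠ 0) (he' : mink e' p ≠ 0) (v v' : Vec)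
    (x y : ℂ) :
    besselScaled (gram κ x y (qv e p) (tv e p v) (qv e' p) (tv e' p v'))
      (gram κ x x (qv e p) (tv e p v) (qv e p) (tv e p v))
      (gram κ y y (qv e' p) (tv e' p v') (qv e' p) (tv e' p v'))
      = circAvg fun φ => Complex.exp (I * (κ * (transverse L (qv e p) φ - transverse L (qv e' p) φ)))
        * (Complex.exp (x * (I * transverse L (tv e p v) φ))
          * Complex.exp (y * (-I * transverse L (tv e' p v') φ))) := by
  have h := circAvg_exp_cos_sin
    (κ * (rowVec L (qv e p) 1 - rowVec L (qv e' p) 1) + x * rowVec L (tv e p v) 1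
      - y * rowVec L (tv e' p v') 1)
    (κ * (rowVec L (qv e p) 2 - rowVec L (qv e' p) 2) + x * rowVec L (tv e p v) 2
      - y * rowVec L (tv e' p v') 2)
  have hq := massless_boost_rowVec hp (qv e p)
  have hq' := massless_boost_rowVec hp (qv e' p)
  have ht := massless_boost_rowVec hp (tv e p v)
  have ht' := massless_boost_rowVec hp (tv e' p v')
  rw [mink_qv he] at hq
  rw [mink_qv he'] at hq'
  rw [mink_tv he] at ht
  rw [mink_tv he'] at ht'
  have hq3 : rowVec L (qv e p) 3 = 1 - rowVec L (qv e p) 0 := by linarith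
  have hq3' : rowVec L (qv e' p) 3 = 1 - rowVec L (qv e' p) 0 := by linarith
  have ht3 : rowVec L (tv e p v) 3 = -rowVec L (tv e p v) 0 := by linarith
  have ht3' : rowVec L (tv e' p v') 3 = -rowVec L (tv e' p v') 0 := by linarith
  rw [besselScaled]
  refine Eq.trans (congrArg bessel ?_) (h.symm.trans (circAvg_congr fun φ => ?_))
  · have hm : ∀ x y, mink x y = rowVec L x 0 * rowVec L y 0 - rowVec L x 1 * rowVec L y 1
        - rowVec L x 2 * rowVec L y 2 - rowVec L x 3 * rowVec L y 3 := fun x y => by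
      rw [← hL.mink_rowVec, mink_eq]
    simp only [gram, hm, hq3, hq3', ht3, ht3']
    push_cast
    ring
  · rw [← Complex.exp_add, ← Complex.exp_add]
    congr 1
    simp only [transverse]
    push_cast
    ring

lemma taylorCoeff_bessel (κ : ℝ) {L : Matrix (Fin 4) (Fin 4) ℝ} (hL : IsLorentz L) {e e' p : Vec}
    (hp : Matrix.mulVec L ![1, 0, 0, 1] = p) (he : mink e p ≠ 0) (he' : mink e' p ≠ 0) (v v' : Vec)
    (k k' : ℕ) :
    taylorCoeff k k' κ besselScaled e e' p v v'
      = circAvg fun φ => Complex.exp (I * (κ * (transverse L (qv e p) φ - transverse L (qv e' p) φ)))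
        * ((I * transverse L (tv e p v) φ) ^ k / k.factorial
          * ((-I * transverse L (tv e' p v') φ) ^ k' / k'.factorial)) := by
  have c1 := continuous_transverse L (qv e p)
  have c2 := continuous_transverse L (qv e' p)
  have c3 := continuous_transverse L (tv e p v)
  have c4 := continuous_transverse L (tv e' p v')
  have hz : ∀ n : ℤ, Continuous fun φ => phase φ ^ n := fun n =>
    continuous_phase.zpow₀ _ fun φ => Or.inl (phase_ne_zero φ)
  simp only [taylorCoeff, besselScaled_gram κ hL hp he he', ← circAvg_const_mul]
  have h1 : ∀ α, (circAvg fun β => circAvg fun φ => phase α ^ (-(k : ℤ)) * phase β ^ (-(k' : ℤ)) *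
        (Complex.exp (I * (κ * (transverse L (qv e p) φ - transverse L (qv e' p) φ)))
        * (Complex.exp (phase α * (I * transverse L (tv e p v) φ))
          * Complex.exp (phase β * (-I * transverse L (tv e' p v') φ)))))
      = circAvg fun φ => (Complex.exp (I * (κ * (transverse L (qv e p) φ - transverse L (qv e' p) φ)))
        * ((-I * transverse L (tv e' p v') φ) ^ k' / k'.factorial))
        * (phase α ^ (-(k : ℤ)) * Complex.exp (phase α * (I * transverse L (tv e p v) φ))) := by
    intro α
    rw [circAvg_swap]
    · refine circAvg_congr fun φ => ?_
      rw [← circAvg_zpow_mul_exp, ← circAvg_const_mul, mul_comm (circAvg _), ← circAvg_const_mul]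
      exact circAvg_congr fun β => by ring
    · refine (continuous_const.mul ((hz _).comp continuous_fst)).mul ?_
      fun_prop
  simp only [h1]
  rw [circAvg_swap]
  · refine circAvg_congr fun φ => ?_
    rw [circAvg_const_mul, circAvg_zpow_mul_exp]
    ring
  · refine Continuous.mul (by fun_prop) (((hz _).comp continuous_fst).mul ?_)
    fun_prop

/-- The limit of the powers of `stringFactor`. -/
def limitPhase (κ : ℝ) (e p : Vec) : ℂ :=
  Complex.exp (-(I * ((κ * (√(-mink e e) / mink e p) : ℝ) : ℂ)))

lemma conj_u0_mul_u0 (κ : ℝ) (L : Matrix (Fin 4) (Fin 4) ℝ) (e e' p : Vec) (φ : ℝ) :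
    (starRingEnd ℂ) (u0 κ L (-e) p ![κ * Real.cos φ, κ * Real.sin φ])
      * u0 κ L e' p ![κ * Real.cos φ, κ * Real.sin φ]
      = limitPhase κ e p * limitPhase κ e' p * Complex.exp (I * (κ *
        (transverse L (qv e p) φ - transverse L (qv e' p) φ))) := by
  have hq : ∀ f, transverse L (qv f p) φ = transverse L f φ / mink f p := fun f => by
    simp only [transverse, rowVec, qv, Pi.smul_apply, smul_eq_mul, mul_assoc, ← Finset.mul_sum]
    field_simp
  have a1 : mink (-e) (-e) = mink e e := by rw [mink_neg_left, mink_neg_right, neg_neg]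
  simp only [u0, map_mul, map_add, ← Complex.exp_conj, limitPhase, ← Complex.exp_add, hq, mink_Ep,
    a1, mink_neg_left e, map_neg, Complex.conj_I, Complex.conj_ofReal]
  congr 1
  push_cast
  rw [div_neg, neg_div_neg_eq]
  ring

/-- The contribution of two transverse components to the infinite-spin kernel. -/
def spinTerm (L : Matrix (Fin 4) (Fin 4) ℝ) (κ : ℝ) (u w w' : Vec) (k k' : ℕ) (φ : ℝ) : ℂ :=
  Complex.exp (I * (κ * transverse L u φ))
    * (((-transverse L w φ : ℝ) : ℂ) ^ k * ((-transverse L w' φ : ℝ) : ℂ) ^ k')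

lemma transverse_sub (L : Matrix (Fin 4) (Fin 4) ℝ) (u u' : Vec) (φ : ℝ) :
    transverse L (u - u') φ = transverse L u φ - transverse L u' φ := by
  simp only [transverse, rowVec, Pi.sub_apply, sub_mul, Finset.sum_sub_distrib]
  ring

lemma taylorCoeff_eq_spinTerm (κ : ℝ) {L : Matrix (Fin 4) (Fin 4) ℝ} (hL : IsLorentz L)
    {e e' p : Vec} (hp : Matrix.mulVec L ![1, 0, 0, 1] = p) (he : mink e p ≠ 0)
    (he' : mink e' p ≠ 0) (v v' : Vec) (k k' : ℕ) :
    (k.factorial * I ^ k) * (k'.factorial * (-I) ^ k')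
        * taylorCoeff k k' κ besselScaled e e' p v v'
      = circAvg (spinTerm L κ (qv e p - qv e' p) (tv e p v) (tv e' p v') k k') := by
  rw [taylorCoeff_bessel κ hL hp he he', ← circAvg_const_mul]
  refine circAvg_congr fun φ => ?_
  have hf : ∀ n : ℕ, (n.factorial : ℂ) ≠ 0 := fun n => by exact_mod_cast n.factorial_ne_zero
  have f1 := hf k
  have f2 := hf k'
  have e1 : ((-transverse L (tv e p v) φ : ℝ) : ℂ) ^ k
      = I ^ k * (I * transverse L (tv e p v) φ) ^ k := by
    rw [← mul_pow, ← mul_assoc, Complex.I_mul_I]; push_cast; ring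
  have e2 : ((-transverse L (tv e' p v') φ : ℝ) : ℂ) ^ k'
      = (-I) ^ k' * (-I * transverse L (tv e' p v') φ) ^ k' := by
    rw [← mul_pow, ← mul_assoc, neg_mul_neg, Complex.I_mul_I]; push_cast; ring
  rw [spinTerm, e1, e2, transverse_sub]
  generalize I * (transverse L (tv e p v) φ : ℂ) = t1
  generalize -I * (transverse L (tv e' p v') φ : ℂ) = t2
  push_cast
  field_simp

lemma continuous_spinTerm (L : Matrix (Fin 4) (Fin 4) ℝ) (κ : ℝ) (u w w' : Vec) (k k' : ℕ) :
    Continuous (spinTerm L κ u w w' k k') := by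
  have c1 := continuous_transverse L u
  have c2 := continuous_transverse L w
  have c3 := continuous_transverse L w'
  unfold spinTerm
  fun_prop

lemma infiniteSpinKernel_eq {r r' : ℕ} {κ : ℝ} (hκ : κ ≠ 0) {B : Vec → Matrix (Fin 4) (Fin 4) ℝ}
    (hB : IsMasslessBoost B) {e e' p : Vec} (hp : p ∈ massShell 0) (he : mink e p ≠ 0)
    (he' : mink e' p ≠ 0) (v v' : Vec) :
    infiniteSpinKernel r r' κ B (-e) e' p v v'
      = limitPhase κ e p * limitPhase κ e' p
        * kernelForm r r' (fun k => limitCoeff r k * I ^ (r - 2 * k))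
          (fun k => limitCoeff r' k * (-I) ^ (r' - 2 * k)) κ besselScaled e e' p v v' := by
  obtain ⟨hL, hLp⟩ := hB p hp
  have hk : ∀ φ : ℝ, (![κ * Real.cos φ, κ * Real.sin φ] : Fin 2 → ℝ) 0 ^ 2
      + (![κ * Real.cos φ, κ * Real.sin φ] : Fin 2 → ℝ) 1 ^ 2 = κ ^ 2 := fun φ => by
    have := Real.sin_sq_add_cos_sq φ
    simp
    linear_combination κ ^ 2 * this
  have h1 : ∀ w φ, ((-κ)⁻¹ * (κ * transverse (B p) w φ) : ℝ)
      = -transverse (B p) w φ := fun w φ => by field_simp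
  have hEn : EEval (-e) p v = EEval e p v := by rw [EEval_eq, EEval_eq, tv_neg]
  set A : ℕ × ℕ → ℂ := fun x =>
    ((2 : ℝ) ^ ((r : ℝ) / 2) : ℝ) * ((2 : ℝ) ^ ((r' : ℝ) / 2) : ℝ)
    * gammaCoeff r x.1 * gammaCoeff r' x.2
    * ((-EEval e p v : ℝ) : ℂ) ^ x.1 * ((-EEval e' p v' : ℝ) : ℂ) ^ x.2 with hA
  set G : ℕ × ℕ → ℝ → ℂ := fun x => spinTerm (B p) κ (qv e p - qv e' p) (tv e p v) (tv e' p v')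
    (r - 2 * x.1) (r' - 2 * x.2) with hG
  have hR : kernelForm r r' (fun k => limitCoeff r k * I ^ (r - 2 * k))
      (fun k => limitCoeff r' k * (-I) ^ (r' - 2 * k)) κ besselScaled e e' p v v'
      = circAvg fun φ => ∑ x ∈ Finset.range (r / 2 + 1) ×ˢ Finset.range (r' / 2 + 1),
        A x * G x φ := by
    rw [circAvg_finset_sum _ (fun x φ => A x * G x φ) fun x _ =>
      continuous_const.mul (continuous_spinTerm _ _ _ _ _ _ _)]
    rw [Finset.sum_product, kernelForm]
    refine Finset.sum_congr rfl fun k _ => Finset.sum_congr rfl fun k' _ => ?_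
    rw [circAvg_const_mul, hG, ← taylorCoeff_eq_spinTerm κ hL hLp he he', hA, limitCoeff,
      limitCoeff]
    push_cast
    ring
  rw [hR, ← circAvg_const_mul]
  change circAvg _ = _
  refine circAvg_congr fun φ => ?_
  rw [Ur_eval hκ r hL hLp (hk _), Ur_eval hκ r' hL hLp (hk _)]
  simp only [mink_Ep, tv_neg, h1, hEn, map_mul, map_sum, map_pow, Complex.conj_ofReal]
  have h2 : ∀ a b f g x y : ℂ, a * (f * x) * (b * (g * y)) = x * y * (a * b * (f * g)) :=
    fun a b f g x y => by ring
  rw [h2, conj_u0_mul_u0, mul_assoc (limitPhase κ e p * limitPhase κ e' p)]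
  congr 1
  rw [Finset.sum_mul_sum, Finset.sum_product, Finset.mul_sum, Finset.mul_sum]
  refine Finset.sum_congr rfl fun k _ => ?_
  rw [Finset.mul_sum, Finset.mul_sum]
  refine Finset.sum_congr rfl fun k' _ => ?_
  rw [hG, hA]
  simp only [spinTerm, transverse_sub, Complex.ofReal_sub]
  ring

/-! ### Bounds and continuity -/

lemma abs_mink_le (x y : Vec) : |mink x y| ≤ 4 * (‖x‖ * ‖y‖) := by
  have h : ∀ i, |x i * y i| ≤ ‖x‖ * ‖y‖ := fun i => by
    rw [abs_mul]
    exact mul_le_mul (norm_le_pi_norm x i) (norm_le_pi_norm y i) (abs_nonneg _) (norm_nonneg _)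
  rw [mink_eq]
  have h0 := abs_le.1 (h 0); have h1 := abs_le.1 (h 1); have h2 := abs_le.1 (h 2)
  have h3 := abs_le.1 (h 3)
  rw [abs_le]
  constructor <;> linarith [h0.1, h0.2, h1.1, h1.2, h2.1, h2.2, h3.1, h3.2]

@[fun_prop]
lemma Continuous.mink {X : Type*} [TopologicalSpace X] {f g : X → Vec} (hf : Continuous f)
    (hg : Continuous g) : Continuous fun x => mink (f x) (g x) := by
  simp only [mink_eq]; fun_prop

lemma Tendsto.mink {α : Type*} {l : Filter α} {f g : α → Vec} {x y : Vec}
    (hf : Tendsto f l (𝓝 x)) (hg : Tendsto g l (𝓝 y)) :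
    Tendsto (fun a => mink (f a) (g a)) l (𝓝 (mink x y)) :=
  ((Continuous.mink continuous_fst continuous_snd).tendsto (x, y)).comp (hf.prodMk_nhds hg)

lemma tendsto_qv {α : Type*} {l : Filter α} {P : α → Vec} {e p : Vec} (hP : Tendsto P l (𝓝 p))
    (h : mink e p ≠ 0) : Tendsto (fun a => qv e (P a)) l (𝓝 (qv e p)) :=
  ((Tendsto.mink tendsto_const_nhds hP).inv₀ h).smul_const e

lemma tendsto_tv {α : Type*} {l : Filter α} {P : α → Vec} {e p : Vec} (hP : Tendsto P l (𝓝 p))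
    (h : mink e p ≠ 0) (v : Vec) : Tendsto (fun a => tv e (P a) v) l (𝓝 (tv e p v)) :=
  tendsto_const_nhds.sub ((Tendsto.mink tendsto_const_nhds hP).smul (tendsto_qv hP h))

/-- The arguments of the kernels are bounded by `R`. -/
def ArgBound (R : ℝ) (e e' p v v' : Vec) : Prop :=
  ‖qv e p‖ ≤ R ∧ ‖tv e p v‖ ≤ R ∧ ‖qv e' p‖ ≤ R ∧ ‖tv e' p v'‖ ≤ R

lemma norm_gram_le {K R κ : ℝ} (hκ : |κ| ≤ K) {x y : ℂ} (hx : ‖x‖ = 1) (hy : ‖y‖ = 1)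
    {u w u' w' : Vec} (hu : ‖u‖ ≤ R) (hw : ‖w‖ ≤ R) (hu' : ‖u'‖ ≤ R) (hw' : ‖w'‖ ≤ R) :
    ‖gram κ x y u w u' w'‖ ≤ (K + 1) ^ 2 * (4 * R ^ 2) := by
  have hR : 0 ≤ R := (norm_nonneg u).trans hu
  have hK : 0 ≤ K := (abs_nonneg κ).trans hκ
  have hm : ∀ {a b : Vec}, ‖a‖ ≤ R → ‖b‖ ≤ R → |mink a b| ≤ 4 * R ^ 2 := fun {a b} ha hb => by
    refine (abs_mink_le a b).trans ?_
    rw [sq]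
    gcongr
  have h1 : ‖((κ ^ 2 * mink u u' : ℝ) : ℂ)‖ ≤ K ^ 2 * (4 * R ^ 2) := by
    rw [Complex.norm_real, Real.norm_eq_abs, abs_mul, abs_pow]
    gcongr
    exact hm hu hu'
  have h2 : ‖x * ((κ * mink w u' : ℝ) : ℂ)‖ ≤ K * (4 * R ^ 2) := by
    rw [norm_mul, hx, one_mul, Complex.norm_real, Real.norm_eq_abs, abs_mul]
    gcongr
    exact hm hw hu'
  have h3 : ‖y * ((κ * mink u w' : ℝ) : ℂ)‖ ≤ K * (4 * R ^ 2) := by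
    rw [norm_mul, hy, one_mul, Complex.norm_real, Real.norm_eq_abs, abs_mul]
    gcongr
    exact hm hu hw'
  have h4 : ‖x * y * ((mink w w' : ℝ) : ℂ)‖ ≤ 4 * R ^ 2 := by
    rw [norm_mul, norm_mul, hx, hy, one_mul, one_mul, Complex.norm_real, Real.norm_eq_abs]
    exact hm hw hw'
  rw [gram]
  refine (norm_add_le _ _).trans ?_
  refine (add_le_add ((norm_add_le _ _).trans (add_le_add (norm_add_le _ _) le_rfl)) le_rfl).trans ?_
  nlinarith

/-- The bound of `legScaled` on the arguments occurring in the kernels. -/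
def legBound (K R : ℝ) : ℝ :=
  Real.exp ((K + 1) ^ 2 * (4 * R ^ 2))
    * Real.exp ((K + 1) ^ 2 * (4 * R ^ 2) + ((K + 1) ^ 2 * (4 * R ^ 2)) ^ 2)

lemma norm_taylor_integrand_le {s : ℕ} (hs : s ≠ 0) {K R κ : ℝ} (hκ : |κ| ≤ K) {e e' p v v' : Vec}
    (h : ArgBound R e e' p v v') (k k' : ℕ) (α β : ℝ) :
    ‖phase α ^ (-(k : ℤ)) * phase β ^ (-(k' : ℤ)) *
      legScaled s (gram κ (phase α) (phase β) (qv e p) (tv e p v) (qv e' p) (tv e' p v'))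
        (gram κ (phase α) (phase α) (qv e p) (tv e p v) (qv e p) (tv e p v))
        (gram κ (phase β) (phase β) (qv e' p) (tv e' p v') (qv e' p) (tv e' p v'))‖
      ≤ legBound K R := by
  obtain ⟨h1, h2, h3, h4⟩ := h
  rw [norm_mul, norm_mul, norm_zpow, norm_zpow, norm_phase, norm_phase, one_zpow, one_zpow, one_mul,
    one_mul]
  exact norm_legScaled_le hs (norm_gram_le hκ (norm_phase α) (norm_phase β) h1 h2 h3 h4)
    (norm_gram_le hκ (norm_phase α) (norm_phase α) h1 h2 h1 h2)
    (norm_gram_le hκ (norm_phase β) (norm_phase β) h3 h4 h3 h4)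

lemma continuous_legScaled (s : ℕ) :
    Continuous fun x : ℂ × ℂ × ℂ => legScaled s x.1 x.2.1 x.2.2 := by
  simp only [legScaled, leg]
  fun_prop

lemma continuous_besselScaled :
    Continuous fun x : ℂ × ℂ × ℂ => besselScaled x.1 x.2.1 x.2.2 := by
  simp only [besselScaled]
  exact continuous_bessel.comp (by fun_prop)

@[fun_prop]
lemma continuous_phase_zpow (n : ℤ) : Continuous fun φ => phase φ ^ n :=
  continuous_phase.zpow₀ _ fun φ => Or.inl (phase_ne_zero φ)

lemma Continuous.gram {X : Type*} [TopologicalSpace X] {κ : ℝ} {x y : X → ℂ} {u w u' w' : X → Vec}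
    (hx : Continuous x) (hy : Continuous y) (hu : Continuous u) (hw : Continuous w)
    (hu' : Continuous u') (hw' : Continuous w') :
    Continuous fun a => gram κ (x a) (y a) (u a) (w a) (u' a) (w' a) := by
  simp only [PauliLubanski.gram]
  fun_prop

/-- The set where the kernels are regular. -/
def regularSet : Set (Vec × Vec × Vec) := {z | mink z.1 z.2.2 ≠ 0 ∧ mink z.2.1 z.2.2 ≠ 0}

lemma isOpen_regularSet : IsOpen regularSet :=
  (isOpen_ne_fun (by fun_prop) continuous_const).inter (isOpen_ne_fun (by fun_prop) continuous_const)

lemma continuous_taylor_integrand {X : Type*} [TopologicalSpace X] {F : ℂ → ℂ → ℂ → ℂ}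
    (hF : Continuous fun x : ℂ × ℂ × ℂ => F x.1 x.2.1 x.2.2) (κ : ℝ) (k k' : ℕ) {α β : X → ℝ}
    {q t q' t' : X → Vec} (hα : Continuous α) (hβ : Continuous β) (hq : Continuous q)
    (ht : Continuous t) (hq' : Continuous q') (ht' : Continuous t') :
    Continuous fun x => phase (α x) ^ (-(k : ℤ)) * phase (β x) ^ (-(k' : ℤ)) *
      F (gram κ (phase (α x)) (phase (β x)) (q x) (t x) (q' x) (t' x))
        (gram κ (phase (α x)) (phase (α x)) (q x) (t x) (q x) (t x))
        (gram κ (phase (β x)) (phase (β x)) (q' x) (t' x) (q' x) (t' x)) := by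
  have pa := continuous_phase.comp hα
  have pb := continuous_phase.comp hβ
  refine Continuous.mul (((continuous_phase_zpow _).comp hα).mul
    ((continuous_phase_zpow _).comp hβ)) ?_
  exact hF.comp ((Continuous.gram pa pb hq ht hq' ht').prodMk
    ((Continuous.gram pa pa hq ht hq ht).prodMk (Continuous.gram pb pb hq' ht' hq' ht')))

lemma continuousOn_taylorCoeff {F : ℂ → ℂ → ℂ → ℂ}
    (hF : Continuous fun x : ℂ × ℂ × ℂ => F x.1 x.2.1 x.2.2) (κ : ℝ) (k k' : ℕ) (v v' : Vec) :
    ContinuousOn (fun z : Vec × Vec × Vec => taylorCoeff k k' κ F z.1 z.2.1 z.2.2 v v')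
      regularSet := by
  rw [continuousOn_iff_continuous_domRestrict]
  have hm : Continuous fun z : regularSet => mink z.1.1 z.1.2.2 := by fun_prop
  have hm' : Continuous fun z : regularSet => mink z.1.2.1 z.1.2.2 := by fun_prop
  have hq : Continuous fun z : regularSet => qv z.1.1 z.1.2.2 :=
    (hm.inv₀ fun z => z.2.1).smul (by fun_prop)
  have hq' : Continuous fun z : regularSet => qv z.1.2.1 z.1.2.2 :=
    (hm'.inv₀ fun z => z.2.2).smul (by fun_prop)
  have hv : Continuous fun z : regularSet => mink v z.1.2.2 := by fun_prop
  have hv' : Continuous fun z : regularSet => mink v' z.1.2.2 := by fun_prop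
  have ht : Continuous fun z : regularSet => tv z.1.1 z.1.2.2 v :=
    continuous_const.sub (hv.smul hq)
  have ht' : Continuous fun z : regularSet => tv z.1.2.1 z.1.2.2 v' :=
    continuous_const.sub (hv'.smul hq')
  refine continuous_circAvg (X := regularSet) ?_
  refine continuous_circAvg (X := regularSet × ℝ) ?_
  have c : Continuous fun x : (regularSet × ℝ) × ℝ => x.1.1 := by fun_prop
  exact continuous_taylor_integrand hF κ k k' (X := (regularSet × ℝ) × ℝ) (α := fun x => x.1.2)
    (β := fun x => x.2) (by fun_prop) (by fun_prop) (hq.comp c) (ht.comp c) (hq'.comp c)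
    (ht'.comp c)

lemma continuousOn_EEval (v : Vec) :
    ContinuousOn (fun z : Vec × Vec => EEval z.1 z.2 v) {z | mink z.1 z.2 ≠ 0} := by
  simp only [EEval_eq]
  rw [continuousOn_iff_continuous_domRestrict]
  have hm : Continuous fun z : {z : Vec × Vec | mink z.1 z.2 ≠ 0} => mink z.1.1 z.1.2 := by
    fun_prop
  have hq : Continuous fun z : {z : Vec × Vec | mink z.1 z.2 ≠ 0} => qv z.1.1 z.1.2 :=
    (hm.inv₀ fun z => z.2).smul (by fun_prop)
  have hv : Continuous fun z : {z : Vec × Vec | mink z.1 z.2 ≠ 0} => mink v z.1.2 := by fun_prop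
  have ht : Continuous fun z : {z : Vec × Vec | mink z.1 z.2 ≠ 0} => tv z.1.1 z.1.2 v :=
    continuous_const.sub (hv.smul hq)
  exact Continuous.mink ht ht

lemma continuousOn_kernelForm {F : ℂ → ℂ → ℂ → ℂ}
    (hF : Continuous fun x : ℂ × ℂ × ℂ => F x.1 x.2.1 x.2.2) (κ : ℝ) (r r' : ℕ) (c c' : ℕ → ℂ)
    (v v' : Vec) :
    ContinuousOn (fun z : Vec × Vec × Vec => kernelForm r r' c c' κ F z.1 z.2.1 z.2.2 v v')
      regularSet := by
  have h1 : ContinuousOn (fun z : Vec × Vec × Vec => EEval z.1 z.2.2 v) regularSet :=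
    (continuousOn_EEval v).comp (f := fun z : Vec × Vec × Vec => (z.1, z.2.2)) (by fun_prop)
      fun z hz => hz.1
  have h2 : ContinuousOn (fun z : Vec × Vec × Vec => EEval z.2.1 z.2.2 v') regularSet :=
    (continuousOn_EEval v').comp (f := fun z : Vec × Vec × Vec => (z.2.1, z.2.2)) (by fun_prop)
      fun z hz => hz.2
  refine continuousOn_finsetSum _ fun k _ => continuousOn_finsetSum _ fun k' _ => ?_
  refine ContinuousOn.mul ?_ (continuousOn_taylorCoeff hF κ _ _ v v')
  refine (continuousOn_const.mul ?_).mul ?_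
  · exact (Complex.continuous_ofReal.comp_continuousOn h1.neg).pow _
  · exact (Complex.continuous_ofReal.comp_continuousOn h2.neg).pow _

lemma abs_stringRatio_le {R : ℝ} {e p : Vec} (h : ‖qv e p‖ ≤ R) :
    |√(-mink e e) / mink e p| ≤ 2 * R := by
  have hR : 0 ≤ R := (norm_nonneg _).trans h
  refine abs_le_of_sq_le_sq ?_ (by positivity)
  have h1 : |mink (qv e p) (qv e p)| ≤ 4 * R ^ 2 := by
    refine (abs_mink_le _ _).trans ?_
    rw [sq]
    gcongr
  have h2 : mink (qv e p) (qv e p) = mink e e / mink e p ^ 2 := by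
    rw [qv, mink_smul_left, mink_comm e (_ • e), mink_smul_left]
    ring
  rw [h2, abs_div, abs_pow, sq_abs] at h1
  rw [div_pow, Real.sq_sqrt']
  calc max (-mink e e) 0 / mink e p ^ 2 ≤ |mink e e| / mink e p ^ 2 := by
        gcongr
        exact max_le (neg_le_abs _) (abs_nonneg _)
    _ ≤ (2 * R) ^ 2 := by rw [mul_pow]; linarith

lemma norm_stringFactor_pow_le {s : ℕ} {K R m : ℝ} (hm : 0 ≤ m) (hK : s * m ≤ K) {e p : Vec}
    (h : ‖qv e p‖ ≤ R) : ‖stringFactor m e p ^ s‖ ≤ Real.exp (K * (2 * R)) := by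
  have hR : 0 ≤ R := (norm_nonneg _).trans h
  have h1 : ‖stringFactor m e p‖ ≤ Real.exp (m * (2 * R)) := by
    have : ‖stringFactor m e p‖ ≤ 1 + m * (2 * R) := by
      rw [stringFactor]
      refine (norm_sub_le _ _).trans ?_
      rw [norm_one, norm_mul, Complex.norm_I, one_mul, Complex.norm_real, Real.norm_eq_abs, abs_mul,
        abs_of_nonneg hm]
      gcongr
      exact abs_stringRatio_le h
    linarith [Real.add_one_le_exp (m * (2 * R))]
  rw [norm_pow]
  calc ‖stringFactor m e p‖ ^ s ≤ Real.exp (m * (2 * R)) ^ s := by gcongr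
    _ = Real.exp (s * m * (2 * R)) := by rw [← Real.exp_nat_mul]; ring_nf
    _ ≤ Real.exp (K * (2 * R)) := by gcongr

lemma norm_kernelForm_le {s : ℕ} (hs : s ≠ 0) {K R κ : ℝ} (hκ : |κ| ≤ K) {e e' p v v' : Vec}
    (h : ArgBound R e e' p v v') {r r' : ℕ} {c c' : ℕ → ℂ} {C C' : ℕ → ℝ}
    (hc : ∀ k ∈ Finset.range (r / 2 + 1), ‖c k‖ ≤ C k)
    (hc' : ∀ k ∈ Finset.range (r' / 2 + 1), ‖c' k‖ ≤ C' k) :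
    ‖kernelForm r r' c c' κ (legScaled s) e e' p v v'‖
      ≤ ∑ k ∈ Finset.range (r / 2 + 1), ∑ k' ∈ Finset.range (r' / 2 + 1),
        C k * C' k' * (4 * R ^ 2) ^ k * (4 * R ^ 2) ^ k' * legBound K R := by
  have hE : ∀ {e p v : Vec}, ‖tv e p v‖ ≤ R → ‖((-EEval e p v : ℝ) : ℂ)‖ ≤ 4 * R ^ 2 := by
    intro e p v ht
    rw [Complex.norm_real, norm_neg, Real.norm_eq_abs, EEval_eq]
    refine (abs_mink_le _ _).trans ?_
    have hR : 0 ≤ R := (norm_nonneg _).trans ht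
    rw [sq]
    gcongr
  have hT : ∀ k k', ‖taylorCoeff k k' κ (legScaled s) e e' p v v'‖ ≤ legBound K R :=
    fun k k' => norm_circAvg_le fun α => norm_circAvg_le fun β =>
      norm_taylor_integrand_le hs hκ h k k' α β
  refine (norm_sum_le _ _).trans (Finset.sum_le_sum fun k hk => ?_)
  refine (norm_sum_le _ _).trans (Finset.sum_le_sum fun k' hk' => ?_)
  rw [norm_mul, norm_mul, norm_mul, norm_mul, norm_pow, norm_pow]
  have := (norm_nonneg _).trans (hc k hk)
  have := (norm_nonneg _).trans (hc' k' hk')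
  have := hc k hk
  have := hc' k' hk'
  have := hE h.2.1
  have := hE h.2.2.2
  have := hT (r - 2 * k) (r' - 2 * k')
  gcongr

/-! ### Pointwise convergence -/

lemma tendsto_taylorCoeff {κs : ℕ → ℝ} {κ : ℝ} (hκ : Tendsto κs atTop (𝓝 κ)) {P : ℕ → Vec}
    {e e' p : Vec} (hP : Tendsto P atTop (𝓝 p)) (he : mink e p ≠ 0) (he' : mink e' p ≠ 0)
    (v v' : Vec) (k k' : ℕ) :
    Tendsto (fun s => taylorCoeff k k' (κs s) (legScaled s) e e' (P s) v v') atTop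
      (𝓝 (taylorCoeff k k' κ besselScaled e e' p v v')) := by
  have hq := tendsto_qv hP he
  have hq' := tendsto_qv hP he'
  have ht := tendsto_tv hP he v
  have ht' := tendsto_tv hP he' v'
  have bd : ∀ {E : Type} [SeminormedAddCommGroup E] {f : ℕ → E} {x : E}, Tendsto f atTop (𝓝 x) →
      ∀ᶠ s in atTop, ‖f s‖ ≤ ‖x‖ + 1 := fun h => h.norm.eventually_le_const (lt_add_one _)
  set R := ‖qv e p‖ + ‖tv e p v‖ + ‖qv e' p‖ + ‖tv e' p v'‖ + 1 with hR
  have hb : ∀ᶠ s in atTop, s ≠ 0 ∧ |κs s| ≤ |κ| + 1 ∧ ArgBound R e e' (P s) v v' := by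
    filter_upwards [eventually_ne_atTop 0, bd hκ, bd hq, bd ht, bd hq', bd ht']
      with s h0 h1 h2 h3 h4 h5
    have n1 := norm_nonneg (qv e p)
    have n2 := norm_nonneg (tv e p v)
    have n3 := norm_nonneg (qv e' p)
    have n4 := norm_nonneg (tv e' p v')
    exact ⟨h0, h1, by linarith, by linarith, by linarith, by linarith⟩
  have hg : ∀ (x y : ℂ) {u w u' w' : ℕ → Vec} {u₀ w₀ u₀' w₀' : Vec}, Tendsto u atTop (𝓝 u₀) →
      Tendsto w atTop (𝓝 w₀) → Tendsto u' atTop (𝓝 u₀') → Tendsto w' atTop (𝓝 w₀') →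
      Tendsto (fun s => gram (κs s) x y (u s) (w s) (u' s) (w' s)) atTop
        (𝓝 (gram κ x y u₀ w₀ u₀' w₀')) := by
    intro x y u w u' w' u₀ w₀ u₀' w₀' hu hw hu' hw'
    have co : ∀ {f : ℕ → ℝ} {a : ℝ}, Tendsto f atTop (𝓝 a) →
        Tendsto (fun s => ((f s : ℝ) : ℂ)) atTop (𝓝 (a : ℂ)) := fun h =>
      (Complex.continuous_ofReal.tendsto _).comp h
    exact (((co ((hκ.pow 2).mul (Tendsto.mink hu hu'))).add
      ((co (hκ.mul (Tendsto.mink hw hu'))).const_mul x)).add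
      ((co (hκ.mul (Tendsto.mink hu hw'))).const_mul y)).add
      ((co (Tendsto.mink hw hw')).const_mul (x * y))
  refine tendsto_circAvg (legBound (|κ| + 1) R) ?_ ?_ fun α => ?_
  · refine Filter.Eventually.of_forall fun s => continuous_circAvg ?_
    exact continuous_taylor_integrand (continuous_legScaled s) _ k k' continuous_fst continuous_snd
      continuous_const continuous_const continuous_const continuous_const
  · filter_upwards [hb] with s hs α
    exact norm_circAvg_le fun β => norm_taylor_integrand_le hs.1 hs.2.1 hs.2.2 k k' α β
  · refine tendsto_circAvg (legBound (|κ| + 1) R) ?_ ?_ fun β => ?_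
    · refine Filter.Eventually.of_forall fun s => ?_
      exact continuous_taylor_integrand (continuous_legScaled s) _ k k' continuous_const
        continuous_id continuous_const continuous_const continuous_const continuous_const
    · filter_upwards [hb] with s hs β
      exact norm_taylor_integrand_le hs.1 hs.2.1 hs.2.2 k k' α β
    · exact (tendsto_legScaled (hg _ _ hq ht hq' ht') (hg _ _ hq ht hq ht)
        (hg _ _ hq' ht' hq' ht')).const_mul _

lemma tendsto_stringFactor_pow {ms : ℕ → ℝ} {κ : ℝ}
    (hκ : Tendsto (fun s : ℕ => s * ms s) atTop (𝓝 κ)) {P : ℕ → Vec} {e p : Vec}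
    (hP : Tendsto P atTop (𝓝 p)) (he : mink e p ≠ 0) :
    Tendsto (fun s => stringFactor (ms s) e (P s) ^ s) atTop (𝓝 (limitPhase κ e p)) := by
  have h1 : Tendsto (fun s : ℕ => s * ms s * (√(-mink e e) / mink e (P s))) atTop
      (𝓝 (κ * (√(-mink e e) / mink e p))) :=
    hκ.mul (tendsto_const_nhds.div (Tendsto.mink tendsto_const_nhds hP) he)
  have h2 := (((Complex.continuous_ofReal.tendsto _).comp h1).const_mul I).neg
  have h3 := Complex.tendsto_one_add_pow_exp_of_tendsto
    (g := fun s => -(I * ((ms s * (√(-mink e e) / mink e (P s)) : ℝ) : ℂ))) (t := _)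
    (h2.congr fun s => by simp only [Function.comp_apply]; push_cast; ring)
  exact h3

lemma tendsto_kernelForm {κs : ℕ → ℝ} {κ : ℝ} (hκ : Tendsto κs atTop (𝓝 κ)) {P : ℕ → Vec}
    {e e' p : Vec} (hP : Tendsto P atTop (𝓝 p)) (he : mink e p ≠ 0) (he' : mink e' p ≠ 0)
    (v v' : Vec) {r r' : ℕ} {c c' : ℕ → ℕ → ℂ} {c₀ c₀' : ℕ → ℂ}
    (hc : ∀ k, Tendsto (fun s => c s k) atTop (𝓝 (c₀ k)))
    (hc' : ∀ k, Tendsto (fun s => c' s k) atTop (𝓝 (c₀' k))) :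
    Tendsto (fun s => kernelForm r r' (c s) (c' s) (κs s) (legScaled s) e e' (P s) v v') atTop
      (𝓝 (kernelForm r r' c₀ c₀' κ besselScaled e e' p v v')) := by
  have hE : ∀ {e v : Vec}, mink e p ≠ 0 → Tendsto (fun s => ((-EEval e (P s) v : ℝ) : ℂ)) atTop
      (𝓝 ((-EEval e p v : ℝ) : ℂ)) := by
    intro e v he
    simp only [EEval_eq]
    exact (Complex.continuous_ofReal.tendsto _).comp
      (Tendsto.mink (tendsto_tv hP he v) (tendsto_tv hP he v)).neg
  refine tendsto_finsetSum _ fun k _ => tendsto_finsetSum _ fun k' _ => ?_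
  exact ((((hc k).mul (hc' k')).mul ((hE he).pow k)).mul ((hE he').pow k')).mul
    (tendsto_taylorCoeff hκ hP he he' v v' _ _)

/-! ### The masses of the Pauli-Lubanski limit -/

lemma plMass_pos {κ : ℝ} (hκ : 0 < κ) {s : ℕ} (hs : s ≠ 0) : 0 < plMass κ s := by
  have : (0 : ℝ) < s := by exact_mod_cast Nat.pos_of_ne_zero hs
  unfold plMass
  positivity

lemma mul_plMass_le {κ : ℝ} (hκ : 0 ≤ κ) (s : ℕ) : s * plMass κ s ≤ κ := by
  rcases Nat.eq_zero_or_pos s with rfl | h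
  · simpa using hκ
  have h0 : (0 : ℝ) < s := by exact_mod_cast h
  have h1 : (s : ℝ) ≤ √(s * (s + 1)) := Real.le_sqrt_of_sq_le (by nlinarith)
  rw [plMass, mul_div_assoc', div_le_iff₀ (h0.trans_le h1), mul_comm]
  gcongr

lemma tendsto_mul_plMass {κ : ℝ} (hκ : 0 ≤ κ) :
    Tendsto (fun s : ℕ => s * plMass κ s) atTop (𝓝 κ) := by
  have h := (tendsto_natCast_div_add_atTop (1 : ℝ)).mul_const κ
  rw [one_mul] at h
  refine tendsto_of_tendsto_of_tendsto_of_le_of_le h tendsto_const_nhds (fun s => ?_)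
    fun s => mul_plMass_le hκ s
  rcases Nat.eq_zero_or_pos s with rfl | hs
  · simp
  have h0 : (0 : ℝ) < s := by exact_mod_cast hs
  have h1 : √(s * (s + 1)) ≤ s + 1 := Real.sqrt_le_iff.2 ⟨by positivity, by nlinarith⟩
  change (s : ℝ) / (s + 1) * κ ≤ s * (κ / √(s * (s + 1)))
  rw [div_mul_eq_mul_div, ← mul_div_assoc]
  gcongr

lemma tendsto_plMass {κ : ℝ} (hκ : 0 ≤ κ) : Tendsto (plMass κ) atTop (𝓝 0) := by
  have h := (tendsto_mul_plMass hκ).mul (tendsto_inv_atTop_nhds_zero_nat (𝕜 := ℝ))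
  rw [mul_zero] at h
  refine h.congr' ?_
  filter_upwards [eventually_ne_atTop 0] with s hs
  have : (s : ℝ) ≠ 0 := by exact_mod_cast hs
  field_simp

/-! ### The kernels as functions on the regular set -/

/-- The explicit form of the massive kernels. -/
def massiveForm (κ : ℝ) (s r r' : ℕ) (v v' : Vec) (z : Vec × Vec × Vec) : ℂ :=
  stringFactor (plMass κ s) z.1 z.2.2 ^ s * stringFactor (plMass κ s) z.2.1 z.2.2 ^ s *
    kernelForm r r' (fun k => massiveCoeff s r k * I ^ (r - 2 * k))
      (fun k => massiveCoeff s r' k * (-I) ^ (r' - 2 * k)) (s * plMass κ s) (legScaled s)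
      z.1 z.2.1 z.2.2 v v'

/-- The explicit form of the infinite-spin kernels. -/
def infiniteSpinForm (κ : ℝ) (r r' : ℕ) (v v' : Vec) (z : Vec × Vec × Vec) : ℂ :=
  limitPhase κ z.1 z.2.2 * limitPhase κ z.2.1 z.2.2 *
    kernelForm r r' (fun k => limitCoeff r k * I ^ (r - 2 * k))
      (fun k => limitCoeff r' k * (-I) ^ (r' - 2 * k)) κ besselScaled z.1 z.2.1 z.2.2 v v'

lemma continuousOn_stringRatio :
    ContinuousOn (fun z : Vec × Vec => √(-mink z.1 z.1) / mink z.1 z.2) {z | mink z.1 z.2 ≠ 0} :=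
  ContinuousOn.div (Continuous.continuousOn (by fun_prop)) (Continuous.continuousOn (by fun_prop))
    fun _ hz => hz

lemma continuousOn_stringRatio_left :
    ContinuousOn (fun z : Vec × Vec × Vec => √(-mink z.1 z.1) / mink z.1 z.2.2) regularSet :=
  continuousOn_stringRatio.comp (f := fun z : Vec × Vec × Vec => (z.1, z.2.2)) (by fun_prop)
    fun _ hz => hz.1

lemma continuousOn_stringRatio_right :
    ContinuousOn (fun z : Vec × Vec × Vec => √(-mink z.2.1 z.2.1) / mink z.2.1 z.2.2) regularSet :=
  continuousOn_stringRatio.comp (f := fun z : Vec × Vec × Vec => (z.2.1, z.2.2)) (by fun_prop)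
    fun _ hz => hz.2

lemma continuousOn_massiveForm (κ : ℝ) (s r r' : ℕ) (v v' : Vec) :
    ContinuousOn (massiveForm κ s r r' v v') regularSet := by
  have h : Continuous fun x : ℝ => (1 - I * ((plMass κ s * x : ℝ) : ℂ)) ^ s := by fun_prop
  exact ((h.comp_continuousOn continuousOn_stringRatio_left).mul
    (h.comp_continuousOn continuousOn_stringRatio_right)).mul
    (continuousOn_kernelForm (continuous_legScaled s) _ r r' _ _ v v')

lemma continuousOn_infiniteSpinForm (κ : ℝ) (r r' : ℕ) (v v' : Vec) :
    ContinuousOn (infiniteSpinForm κ r r' v v') regularSet := by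
  have h : Continuous fun x : ℝ => Complex.exp (-(I * ((κ * x : ℝ) : ℂ))) := by fun_prop
  exact ((h.comp_continuousOn continuousOn_stringRatio_left).mul
    (h.comp_continuousOn continuousOn_stringRatio_right)).mul
    (continuousOn_kernelForm continuous_besselScaled _ r r' _ _ v v')

lemma tendsto_massiveForm {κ : ℝ} (hκ : 0 ≤ κ) (r r' : ℕ) (v v' : Vec) {P : ℕ → Vec}
    {e e' p : Vec} (hP : Tendsto P atTop (𝓝 p)) (he : mink e p ≠ 0) (he' : mink e' p ≠ 0) :
    Tendsto (fun s => massiveForm κ s r r' v v' (e, e', P s)) atTop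
      (𝓝 (infiniteSpinForm κ r r' v v' (e, e', p))) := by
  have hm := tendsto_mul_plMass hκ
  exact ((tendsto_stringFactor_pow hm hP he).mul (tendsto_stringFactor_pow hm hP he')).mul
    (tendsto_kernelForm hm hP he he' v v'
      (fun k => ((Complex.continuous_ofReal.tendsto _).comp (tendsto_massiveCoeff r k)).mul_const _)
      (fun k => ((Complex.continuous_ofReal.tendsto _).comp
        (tendsto_massiveCoeff r' k)).mul_const _))

lemma exists_massiveForm_bound {κ : ℝ} (hκ : 0 < κ) (r r' : ℕ) (v v' : Vec) (R : ℝ) :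
    ∃ C, ∀ᶠ s in atTop, ∀ z : Vec × Vec × Vec, ArgBound R z.1 z.2.1 z.2.2 v v' →
      ‖massiveForm κ s r r' v v' z‖ ≤ C := by
  have hc : ∀ r : ℕ, ∀ᶠ s in atTop, ∀ k ∈ Finset.range (r / 2 + 1),
      |massiveCoeff s r k| ≤ |limitCoeff r k| + 1 := fun r =>
    (Filter.eventually_all_finset _).2 fun k _ =>
      (tendsto_massiveCoeff r k).abs.eventually_le_const (lt_add_one _)
  refine ⟨Real.exp (κ * (2 * R)) * Real.exp (κ * (2 * R)) *
    ∑ k ∈ Finset.range (r / 2 + 1), ∑ k' ∈ Finset.range (r' / 2 + 1),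
      (|limitCoeff r k| + 1) * (|limitCoeff r' k'| + 1) * (4 * R ^ 2) ^ k * (4 * R ^ 2) ^ k'
        * legBound κ R, ?_⟩
  filter_upwards [hc r, hc r', eventually_ne_atTop 0] with s h1 h2 hs z hz
  have hm := (plMass_pos hκ hs).le
  have hK := mul_plMass_le hκ.le s
  have ha : |s * plMass κ s| ≤ κ := by rwa [abs_of_nonneg (by positivity)]
  rw [massiveForm, norm_mul, norm_mul]
  have b1 := norm_stringFactor_pow_le hm hK hz.1
  have b2 := norm_stringFactor_pow_le hm hK hz.2.2.1
  have b3 := norm_kernelForm_le hs ha hz (r := r) (r' := r')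
    (c := fun k => massiveCoeff s r k * I ^ (r - 2 * k))
    (c' := fun k => massiveCoeff s r' k * (-I) ^ (r' - 2 * k))
    (C := fun k => |limitCoeff r k| + 1) (C' := fun k => |limitCoeff r' k| + 1)
    (fun k hk => by simpa using h1 k hk) (fun k hk => by simpa using h2 k hk)
  gcongr

/-! ### Smearing -/

lemma energy_nonneg (m : ℝ) (k : Fin 3 → ℝ) : 0 ≤ energy m k := Real.sqrt_nonneg _

lemma energy_sq (m : ℝ) (k : Fin 3 → ℝ) : energy m k ^ 2 = m ^ 2 + ∑ i, k i ^ 2 :=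
  Real.sq_sqrt (by positivity)

lemma continuous_energy : Continuous fun x : ℝ × (Fin 3 → ℝ) => energy x.1 x.2 := by
  simp only [energy]; fun_prop

lemma continuous_onShell : Continuous fun x : ℝ × (Fin 3 → ℝ) => onShell x.1 x.2 := by
  refine continuous_pi fun i => ?_
  refine Fin.cases ?_ (fun j => ?_) i
  · exact continuous_energy
  · simp only [onShell, Fin.cons_succ]; fun_prop

lemma mink_onShell (m : ℝ) (k : Fin 3 → ℝ) : mink (onShell m k) (onShell m k) = m ^ 2 := by
  have h := energy_sq m k
  rw [Fin.sum_univ_three] at h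
  rw [mink_eq]
  change energy m k * energy m k - k 0 * k 0 - k 1 * k 1 - k 2 * k 2 = m ^ 2
  linarith

lemma norm_onShell_le (m : ℝ) (k : Fin 3 → ℝ) : ‖onShell m k‖ ≤ energy m k := by
  refine (pi_norm_le_iff_of_nonneg (energy_nonneg m k)).2 fun i => ?_
  refine Fin.cases ?_ (fun j => ?_) i
  · exact (abs_of_nonneg (energy_nonneg m k)).le
  · refine Real.abs_le_sqrt ?_
    have := Finset.single_le_sum (f := fun i => k i ^ 2) (fun i _ => sq_nonneg (k i))
      (Finset.mem_univ j)
    simp only [onShell, Fin.cons_succ]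
    nlinarith [sq_nonneg m]

lemma norm_le_norm_onShell (m : ℝ) (k : Fin 3 → ℝ) : ‖k‖ ≤ ‖onShell m k‖ :=
  (pi_norm_le_iff_of_nonneg (norm_nonneg _)).2 fun i => norm_le_pi_norm (onShell m k) i.succ

lemma energy_pos_of_mink_ne_zero {m : ℝ} {k : Fin 3 → ℝ} {e : Vec}
    (h : mink e (onShell m k) ≠ 0) : 0 < energy m k := by
  refine (energy_nonneg m k).lt_of_ne fun h0 => h ?_
  have h1 : onShell m k = 0 := norm_le_zero_iff.1 (h0 ▸ norm_onShell_le m k)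
  simp [h1, mink_eq]

lemma onShell_mem_massShell {m : ℝ} {k : Fin 3 → ℝ} {e : Vec} (h : mink e (onShell m k) ≠ 0) :
    onShell m k ∈ massShell m :=
  ⟨mink_onShell m k, energy_pos_of_mink_ne_zero h⟩

/-- The argument of the test function over a point of integration. -/
def shellPoint (m : ℝ) (z : Vec × Vec × (Fin 3 → ℝ)) : Vec × Vec × Vec :=
  (z.1, z.2.1, onShell m z.2.2)

lemma continuous_shellPoint :
    Continuous fun x : ℝ × Vec × Vec × (Fin 3 → ℝ) => shellPoint x.1 x.2 := by
  have h : Continuous fun x : ℝ × Vec × Vec × (Fin 3 → ℝ) => onShell x.1 x.2.2.2 :=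
    continuous_onShell.comp (f := fun x : ℝ × Vec × Vec × (Fin 3 → ℝ) => (x.1, x.2.2.2))
      (by fun_prop)
  simp only [shellPoint]
  fun_prop

lemma norm_le_norm_shellPoint (m : ℝ) (z : Vec × Vec × (Fin 3 → ℝ)) : ‖z‖ ≤ ‖shellPoint m z‖ := by
  simp only [shellPoint, Prod.norm_def]
  have := norm_le_norm_onShell m z.2.2
  gcongr

lemma smearIntegrand_eq_zero {m : ℝ} {f : Vec × Vec × Vec → ℂ} {M : Vec → Vec → Vec → ℂ}
    {z : Vec × Vec × (Fin 3 → ℝ)} (h : shellPoint m z ∉ tsupport f) :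
    smearIntegrand m f M z = 0 := by
  have h0 : f (z.1, z.2.1, onShell m z.2.2) = 0 := image_eq_zero_of_notMem_tsupport h
  rw [smearIntegrand, h0, mul_zero, zero_mul]

lemma continuous_smearIntegrand {m : ℝ} {f : Vec × Vec × Vec → ℂ} (hf : Continuous f)
    (hr : ∀ z, shellPoint m z ∈ tsupport f → shellPoint m z ∈ regularSet)
    {M : Vec → Vec → Vec → ℂ} {G : Vec × Vec × Vec → ℂ} (hG : ContinuousOn G regularSet)
    (hM : ∀ z, shellPoint m z ∈ regularSet → M z.1 z.2.1 (onShell m z.2.2) = G (shellPoint m z)) :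
    Continuous (smearIntegrand m f M) := by
  have hs : Continuous (shellPoint m) := continuous_shellPoint.comp (.prodMk_right m)
  refine continuous_iff_continuousAt.2 fun z => ?_
  by_cases hz : shellPoint m z ∈ tsupport f
  · have hz' := hr z hz
    have hev : ∀ᶠ y in 𝓝 z, shellPoint m y ∈ regularSet :=
      hs.continuousAt.eventually_mem (isOpen_regularSet.mem_nhds hz')
    have hE : Continuous fun z : Vec × Vec × (Fin 3 → ℝ) => energy m z.2.2 :=
      continuous_energy.comp (f := fun z : Vec × Vec × (Fin 3 → ℝ) => (m, z.2.2)) (by fun_prop)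
    have hE0 : 0 < energy m z.2.2 := energy_pos_of_mink_ne_zero hz'.1
    have hc : ContinuousAt (fun z => ((1 / ((2 * Real.pi) ^ 3 * (2 * energy m z.2.2)) : ℝ) : ℂ)
        * f (shellPoint m z) * G (shellPoint m z)) z := by
      refine ContinuousAt.mul (ContinuousAt.mul ?_ (hf.comp hs).continuousAt) ?_
      · refine Complex.continuous_ofReal.continuousAt.comp ?_
        refine continuousAt_const.div
          (continuousAt_const.mul (continuousAt_const.mul hE.continuousAt)) ?_
        have := Real.pi_pos
        positivity
      · exact (hG.continuousAt (isOpen_regularSet.mem_nhds hz')).comp hs.continuousAt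
    refine hc.congr ?_
    filter_upwards [hev] with y hy
    rw [smearIntegrand, hM y hy]
    rfl
  · have hev : ∀ᶠ y in 𝓝 z, shellPoint m y ∉ tsupport f :=
      hs.continuousAt.eventually_mem ((isClosed_tsupport f).isOpen_compl.mem_nhds hz)
    refine (continuousAt_const (y := (0 : ℂ))).congr ?_
    filter_upwards [hev] with y hy using (smearIntegrand_eq_zero hy).symm

lemma integrable_smearIntegrand {m : ℝ} {f : Vec × Vec × Vec → ℂ} (hf : Continuous f)
    (hc : HasCompactSupport f)
    (hr : ∀ z, shellPoint m z ∈ tsupport f → shellPoint m z ∈ regularSet)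
    {M : Vec → Vec → Vec → ℂ} {G : Vec × Vec × Vec → ℂ} (hG : ContinuousOn G regularSet)
    (hM : ∀ z, shellPoint m z ∈ regularSet → M z.1 z.2.1 (onShell m z.2.2) = G (shellPoint m z)) :
    MeasureTheory.Integrable (smearIntegrand m f M) := by
  obtain ⟨ρ, hρ⟩ := hc.isCompact.isBounded.subset_closedBall 0
  refine (continuous_smearIntegrand hf hr hG hM).integrable_of_hasCompactSupport ?_
  refine HasCompactSupport.intro (isCompact_closedBall 0 ρ) fun z hz => ?_
  refine smearIntegrand_eq_zero fun h => hz ?_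
  exact mem_closedBall_zero_iff.2
    ((norm_le_norm_shellPoint m z).trans (mem_closedBall_zero_iff.1 (hρ h)))

/-- On the support of a test function, `(ep)` and `(e'p)` stay away from zero near the closed
forward light cone. -/
lemma IsTestFunction.exists_lower_bound {f : Vec × Vec × Vec → ℂ} (hf : IsTestFunction f) :
    ∃ a > 0, ∀ z ∈ tsupport f, 0 ≤ z.2.2 0 → |mink z.2.2 z.2.2| < a →
      a ≤ |mink z.1 z.2.2| ∧ a ≤ |mink z.2.1 z.2.2| := by
  have hK : IsCompact (tsupport f ∩ {z | 0 ≤ z.2.2 0}) :=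
    hf.compact.isCompact.inter_right (isClosed_le continuous_const (by fun_prop))
  have hg : Continuous fun z : Vec × Vec × Vec =>
      max |mink z.2.2 z.2.2| (min |mink z.1 z.2.2| |mink z.2.1 z.2.2|) := by fun_prop
  obtain ⟨a, ha, h⟩ := hK.exists_forall_le' hg.continuousOn (a := 0) fun z hz => by
    rcases eq_or_ne (mink z.2.2 z.2.2) 0 with h0 | h0
    · have := hf.regular z hz.1 h0 hz.2
      exact lt_max_of_lt_right (lt_min (abs_pos.2 this.1) (abs_pos.2 this.2))
    · exact lt_max_of_lt_left (abs_pos.2 h0)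
  refine ⟨a, ha, fun z hz h0 hlt => ?_⟩
  have := (le_max_iff.1 (h z ⟨hz, h0⟩)).resolve_left (not_le.2 hlt)
  exact le_min_iff.1 this

lemma norm_qv_le {a ρ : ℝ} (ha : 0 < a) {e p : Vec} (he : ‖e‖ ≤ ρ) (h : a ≤ |mink e p|) :
    ‖qv e p‖ ≤ ρ / a := by
  rw [qv, norm_smul, norm_inv, Real.norm_eq_abs, inv_mul_eq_div]
  have := (norm_nonneg e).trans he
  gcongr

lemma norm_tv_le {q ρ : ℝ} {e p : Vec} (hq : ‖qv e p‖ ≤ q) (hp : ‖p‖ ≤ ρ) (v : Vec) :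
    ‖tv e p v‖ ≤ ‖v‖ + 4 * (‖v‖ * ρ) * q := by
  rw [tv]
  refine (norm_sub_le _ _).trans ?_
  rw [norm_smul, Real.norm_eq_abs]
  have := abs_mink_le v p
  have := (norm_nonneg p).trans hp
  have : |mink v p| ≤ 4 * (‖v‖ * ρ) := (abs_mink_le v p).trans (by gcongr)
  gcongr

lemma argBound_of_le {a ρ : ℝ} (ha : 0 < a) {z : Vec × Vec × Vec} (hz : ‖z‖ ≤ ρ)
    (h : a ≤ |mink z.1 z.2.2| ∧ a ≤ |mink z.2.1 z.2.2|) (v v' : Vec) :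
    ArgBound (ρ / a + (‖v‖ + 4 * (‖v‖ * ρ) * (ρ / a)) + (‖v'‖ + 4 * (‖v'‖ * ρ) * (ρ / a)))
      z.1 z.2.1 z.2.2 v v' := by
  have hρ : 0 ≤ ρ := (norm_nonneg _).trans hz
  have hp : ‖z.2.2‖ ≤ ρ := ((norm_snd_le z.2).trans (norm_snd_le z)).trans hz
  have h1 := norm_qv_le ha ((norm_fst_le z).trans hz) h.1
  have h2 := norm_qv_le ha (((norm_fst_le z.2).trans (norm_snd_le z)).trans hz) h.2
  have h3 := norm_tv_le h1 hp v
  have h4 := norm_tv_le h2 hp v'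
  have p0 : 0 ≤ ρ / a := by positivity
  have p1 : 0 ≤ ‖v‖ + 4 * (‖v‖ * ρ) * (ρ / a) := by positivity
  have p2 : 0 ≤ ‖v'‖ + 4 * (‖v'‖ * ρ) * (ρ / a) := by positivity
  exact ⟨by linarith, by linarith, by linarith, by linarith⟩

lemma energy_ge_of_le {a ρ m : ℝ} (hρ : 0 < ρ) {z : Vec × Vec × (Fin 3 → ℝ)}
    (hz : ‖shellPoint m z‖ ≤ ρ) (h : a ≤ |mink z.1 (onShell m z.2.2)|) :
    a / (4 * ρ) ≤ energy m z.2.2 := by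
  have h1 := abs_mink_le z.1 (onShell m z.2.2)
  have h2 := norm_onShell_le m z.2.2
  have h3 : ‖z.1‖ ≤ ρ := (norm_fst_le (shellPoint m z)).trans hz
  rw [div_le_iff₀ (by positivity)]
  have : ‖z.1‖ * ‖onShell m z.2.2‖ ≤ ρ * energy m z.2.2 := by gcongr
  linarith

/-! ### The Pauli-Lubanski limit -/

lemma massiveKernel_eq_massiveForm {κ : ℝ} (hκ : 0 < κ) {s r r' : ℕ} (hs : s ≠ 0) (hr : r ≤ s)
    (hr' : r' ≤ s) {B : Vec → Matrix (Fin 4) (Fin 4) ℝ} (hB : IsMassiveBoost (plMass κ s) B)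
    {ι : Type} [Fintype ι] (T : OrthonormalBasis ι ℝ (STF s)) {e e' p : Vec}
    (hp : p ∈ massShell (plMass κ s)) (he : mink e p ≠ 0) (he' : mink e' p ≠ 0) (v v' : Vec) :
    massiveKernel s r r' (plMass κ s) B T (-e) e' p v v'
      = massiveForm κ s r r' v v' (e, e', p) :=
  massiveKernel_eq hs hr hr' (plMass_pos hκ hs) hB T hp he he' v v'

lemma infiniteSpinKernel_eq_infiniteSpinForm {κ : ℝ} (hκ : 0 < κ) (r r' : ℕ)
    {B : Vec → Matrix (Fin 4) (Fin 4) ℝ} (hB : IsMasslessBoost B) {e e' p : Vec}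
    (hp : p ∈ massShell 0) (he : mink e p ≠ 0) (he' : mink e' p ≠ 0) (v v' : Vec) :
    infiniteSpinKernel r r' κ B (-e) e' p v v' = infiniteSpinForm κ r r' v v' (e, e', p) :=
  infiniteSpinKernel_eq hκ.ne' hB hp he he' v v'

lemma tendsto_massiveKernel {κ : ℝ} (hκ : 0 < κ) {B₀ : Vec → Matrix (Fin 4) (Fin 4) ℝ}
    (hB₀ : IsMasslessBoost B₀) {B : ℝ → Vec → Matrix (Fin 4) (Fin 4) ℝ}
    (hB : ∀ m : ℝ, 0 < m → IsMassiveBoost m (B m)) {ι : ℕ → Type} [∀ s, Fintype (ι s)]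
    (T : ∀ s, OrthonormalBasis (ι s) ℝ (STF s)) (r r' : ℕ) {e e' p : Vec} (v v' : Vec)
    (hp : p ∈ massShell 0) (he : mink e p ≠ 0) (he' : mink e' p ≠ 0) {P : ℕ → Vec}
    (hPs : ∀ᶠ s in atTop, P s ∈ massShell (plMass κ s)) (hP : Tendsto P atTop (𝓝 p)) :
    Tendsto (fun s : ℕ => massiveKernel s r r' (plMass κ s) (B (plMass κ s)) (T s) (-e) e' (P s) v v')
      atTop (𝓝 (infiniteSpinKernel r r' κ B₀ (-e) e' p v v')) := by
  rw [infiniteSpinKernel_eq_infiniteSpinForm hκ r r' hB₀ hp he he']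
  refine (tendsto_massiveForm hκ.le r r' v v' hP he he').congr' ?_
  filter_upwards [hPs, eventually_ne_atTop 0, eventually_ge_atTop r, eventually_ge_atTop r',
    (Tendsto.mink tendsto_const_nhds hP).eventually_ne he,
    (Tendsto.mink tendsto_const_nhds hP).eventually_ne he'] with s h1 hs hr hr' h2 h3
  exact (massiveKernel_eq_massiveForm hκ hs hr hr' (hB _ (plMass_pos hκ hs)) (T s) h1 h2 h3 v v').symm

/-- The integrands of the smeared kernels have a common integrable bound. -/
lemma exists_smearIntegrand_bound {f : Vec × Vec × Vec → ℂ} (hf : IsTestFunction f) {κ : ℝ}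
    (hκ : 0 < κ) (r r' : ℕ) (v v' : Vec) :
    ∃ C ρ : ℝ, ∀ᶠ s in atTop,
      (∀ z, shellPoint (plMass κ s) z ∈ tsupport f → shellPoint (plMass κ s) z ∈ regularSet) ∧
      ∀ M : Vec → Vec → Vec → ℂ, (∀ z, shellPoint (plMass κ s) z ∈ regularSet →
        M z.1 z.2.1 (onShell (plMass κ s) z.2.2)
          = massiveForm κ s r r' v v' (shellPoint (plMass κ s) z)) →
      ∀ z, ‖smearIntegrand (plMass κ s) f M z‖
        ≤ (Metric.closedBall (0 : Vec × Vec × (Fin 3 → ℝ)) ρ).indicator (fun _ => C) z := by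
  obtain ⟨a, ha, hlow⟩ := hf.exists_lower_bound
  obtain ⟨ρ, hρ0, hρ⟩ := hf.compact.isCompact.isBounded.subset_closedBall_lt 0 0
  obtain ⟨Cf, hCf⟩ := hf.compact.exists_bound_of_continuous hf.smooth.continuous
  obtain ⟨CM, hCM⟩ := exists_massiveForm_bound hκ r r' v v'
    (ρ / a + (‖v‖ + 4 * (‖v‖ * ρ) * (ρ / a)) + (‖v'‖ + 4 * (‖v'‖ * ρ) * (ρ / a)))
  refine ⟨|1 / ((2 * Real.pi) ^ 3 * (2 * (a / (4 * ρ)))) * Cf * CM|, ρ, ?_⟩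
  have hm : ∀ᶠ s in atTop, plMass κ s ^ 2 < a := by
    have h := (tendsto_plMass hκ.le).pow 2
    rw [zero_pow two_ne_zero] at h
    exact h.eventually_lt_const ha
  filter_upwards [hm, hCM] with s hs hM
  have hlow' : ∀ z, shellPoint (plMass κ s) z ∈ tsupport f →
      a ≤ |mink z.1 (onShell (plMass κ s) z.2.2)| ∧
        a ≤ |mink z.2.1 (onShell (plMass κ s) z.2.2)| := fun z hz => by
    refine hlow _ hz (energy_nonneg _ _) ?_
    change |mink (onShell _ _) (onShell _ _)| < a
    rwa [mink_onShell, abs_of_nonneg (sq_nonneg _)]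
  have hreg : ∀ z, shellPoint (plMass κ s) z ∈ tsupport f →
      shellPoint (plMass κ s) z ∈ regularSet := fun z hz =>
    ⟨abs_pos.1 (ha.trans_le (hlow' z hz).1), abs_pos.1 (ha.trans_le (hlow' z hz).2)⟩
  refine ⟨hreg, fun M hMG z => ?_⟩
  by_cases hz : shellPoint (plMass κ s) z ∈ tsupport f
  · have hn : ‖shellPoint (plMass κ s) z‖ ≤ ρ := mem_closedBall_zero_iff.1 (hρ hz)
    rw [Set.indicator_of_mem (mem_closedBall_zero_iff.2 ((norm_le_norm_shellPoint _ z).trans hn)),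
      smearIntegrand, hMG z (hreg z hz), norm_mul, norm_mul, Complex.norm_real, Real.norm_eq_abs]
    have hE := energy_ge_of_le hρ0 hn (hlow' z hz).1
    have hE0 : 0 < a / (4 * ρ) := by positivity
    have hpi := Real.pi_pos
    have h1 : |1 / ((2 * Real.pi) ^ 3 * (2 * energy (plMass κ s) z.2.2))|
        ≤ 1 / ((2 * Real.pi) ^ 3 * (2 * (a / (4 * ρ)))) := by
      rw [abs_of_nonneg (by have := energy_nonneg (plMass κ s) z.2.2; positivity)]
      gcongr
    have h2 := hM _ (argBound_of_le ha hn (hlow' z hz) v v')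
    have h3 := hCf (shellPoint (plMass κ s) z)
    have h4 := (norm_nonneg _).trans h3
    exact (mul_le_mul (mul_le_mul h1 h3 (norm_nonneg _) (by positivity)) h2 (norm_nonneg _)
      (by positivity)).trans (le_abs_self _)
  · rw [smearIntegrand_eq_zero hz, norm_zero]
    exact Set.indicator_nonneg (fun _ _ => abs_nonneg _) z

lemma tendsto_shellPoint {κ : ℝ} (hκ : 0 < κ) (z : Vec × Vec × (Fin 3 → ℝ)) :
    Tendsto (fun s => shellPoint (plMass κ s) z) atTop (𝓝 (shellPoint 0 z)) :=
  (continuous_shellPoint.tendsto (0, z)).comp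
    ((tendsto_plMass hκ.le).prodMk_nhds tendsto_const_nhds)

lemma tendsto_onShell {κ : ℝ} (hκ : 0 < κ) (k : Fin 3 → ℝ) :
    Tendsto (fun s => onShell (plMass κ s) k) atTop (𝓝 (onShell 0 k)) := by
  have h : Tendsto (fun s => (plMass κ s, k)) atTop (𝓝 (0, k)) :=
    (tendsto_plMass hκ.le).prodMk_nhds tendsto_const_nhds
  have h' := (continuous_onShell.tendsto (0, k)).comp h
  simpa only [Function.comp_def] using h'

lemma IsTestFunction.mem_regularSet {f : Vec × Vec × Vec → ℂ} (hf : IsTestFunction f)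
    (z : Vec × Vec × (Fin 3 → ℝ)) (hz : shellPoint 0 z ∈ tsupport f) :
    shellPoint 0 z ∈ regularSet :=
  hf.regular _ hz ((mink_onShell 0 z.2.2).trans (zero_pow two_ne_zero)) (energy_nonneg 0 z.2.2)

lemma tendsto_smearIntegrand {f : Vec × Vec × Vec → ℂ} (hf : IsTestFunction f) {κ : ℝ}
    (hκ : 0 < κ) {M : ℕ → Vec → Vec → Vec → ℂ} {M₀ : Vec → Vec → Vec → ℂ}
    (z : Vec × Vec × (Fin 3 → ℝ))
    (h : shellPoint 0 z ∈ regularSet → Tendsto (fun s => M s z.1 z.2.1 (onShell (plMass κ s) z.2.2))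
      atTop (𝓝 (M₀ z.1 z.2.1 (onShell 0 z.2.2)))) :
    Tendsto (fun s => smearIntegrand (plMass κ s) f (M s) z) atTop
      (𝓝 (smearIntegrand 0 f M₀ z)) := by
  have hsp := tendsto_shellPoint hκ z
  by_cases hz : shellPoint 0 z ∈ tsupport f
  · have hr := hf.mem_regularSet z hz
    have hE0 : 0 < energy 0 z.2.2 := energy_pos_of_mink_ne_zero hr.1
    have hE : Tendsto (fun s => energy (plMass κ s) z.2.2) atTop (𝓝 (energy 0 z.2.2)) :=
      (continuous_energy.tendsto (0, z.2.2)).comp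
        ((tendsto_plMass hκ.le).prodMk_nhds tendsto_const_nhds)
    refine Tendsto.mul (Tendsto.mul ?_ ((hf.smooth.continuous.tendsto _).comp hsp)) (h hr)
    refine (Complex.continuous_ofReal.tendsto _).comp ?_
    refine tendsto_const_nhds.div (tendsto_const_nhds.mul (tendsto_const_nhds.mul hE)) ?_
    have := Real.pi_pos
    positivity
  · rw [smearIntegrand_eq_zero hz]
    refine tendsto_const_nhds.congr' ?_
    filter_upwards [hsp.eventually_mem ((isClosed_tsupport f).isOpen_compl.mem_nhds hz)]
      with s hs using (smearIntegrand_eq_zero hs).symm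

end

end PauliLubanski

open PauliLubanski in
theorem corollaryc (κ : ℝ) (hκ : 0 < κ)
    (B₀ : Vec → Matrix (Fin 4) (Fin 4) ℝ) (hB₀ : IsMasslessBoost B₀)
    (B : ℝ → Vec → Matrix (Fin 4) (Fin 4) ℝ) (hB : ∀ m : ℝ, 0 < m → IsMassiveBoost m (B m))
    {ι : ℕ → Type} [∀ s, Fintype (ι s)] (T : ∀ s, OrthonormalBasis (ι s) ℝ (STF s))
    (r r' : ℕ) :
    Tendsto (fun s : ℕ => N0 s r / N0 s 0) atTop (𝓝 ((2 : ℝ) ^ ((r : ℝ) / 2))) ∧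
    (∀ e e' p v v' : Vec, mink e e < 0 → mink e' e' < 0 → p ∈ massShell 0 →
      mink e p ≠ 0 → mink e' p ≠ 0 →
      ∀ P : ℕ → Vec, (∀ᶠ s in atTop, P s ∈ massShell (plMass κ s)) → Tendsto P atTop (𝓝 p) →
        Tendsto (fun s : ℕ =>
            massiveKernel s r r' (plMass κ s) (B (plMass κ s)) (T s) (-e) e' (P s) v v')
          atTop (𝓝 (infiniteSpinKernel r r' κ B₀ (-e) e' p v v'))) ∧
    (∀ (f : Vec × Vec × Vec → ℂ) (v v' : Vec), IsTestFunction f →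
      (∀ᶠ s : ℕ in atTop, MeasureTheory.Integrable (smearIntegrand (plMass κ s) f
        (fun e e' p =>
          massiveKernel s r r' (plMass κ s) (B (plMass κ s)) (T s) (-e) e' p v v'))) ∧
      MeasureTheory.Integrable (smearIntegrand 0 f
        (fun e e' p => infiniteSpinKernel r r' κ B₀ (-e) e' p v v')) ∧
      Tendsto (fun s : ℕ => ∫ z, smearIntegrand (plMass κ s) f
          (fun e e' p =>
            massiveKernel s r r' (plMass κ s) (B (plMass κ s)) (T s) (-e) e' p v v') z)
        atTop (𝓝 (∫ z, smearIntegrand 0 f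
          (fun e e' p => infiniteSpinKernel r r' κ B₀ (-e) e' p v v') z))) := by
  refine ⟨tendsto_N0_div_N0 r, fun e e' p v v' _ _ hp he he' P hPs hP =>
    tendsto_massiveKernel hκ hB₀ hB T r r' v v' hp he he' hPs hP, fun f v v' hf => ?_⟩
  obtain ⟨C, ρ, hb⟩ := exists_smearIntegrand_bound hf hκ r r' v v'
  have hform : ∀ᶠ s in atTop, ∀ z, shellPoint (plMass κ s) z ∈ regularSet →
      massiveKernel s r r' (plMass κ s) (B (plMass κ s)) (T s) (-z.1) z.2.1
        (onShell (plMass κ s) z.2.2) v v' = massiveForm κ s r r' v v' (shellPoint (plMass κ s) z) := by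
    filter_upwards [eventually_ne_atTop 0, eventually_ge_atTop r, eventually_ge_atTop r']
      with s hs hr hr' z hz
    exact massiveKernel_eq_massiveForm hκ hs hr hr' (hB _ (plMass_pos hκ hs)) (T s)
      (onShell_mem_massShell hz.1) hz.1 hz.2 v v'
  have hint : ∀ᶠ s : ℕ in atTop, MeasureTheory.Integrable (smearIntegrand (plMass κ s) f
      (fun e e' p =>
        massiveKernel s r r' (plMass κ s) (B (plMass κ s)) (T s) (-e) e' p v v')) := by
    filter_upwards [hb, hform] with s h1 h2
    exact integrable_smearIntegrand hf.smooth.continuous hf.compact h1.1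
      (continuousOn_massiveForm κ s r r' v v') h2
  refine ⟨hint, integrable_smearIntegrand hf.smooth.continuous hf.compact hf.mem_regularSet
    (continuousOn_infiniteSpinForm κ r r' v v') fun z hz =>
      infiniteSpinKernel_eq_infiniteSpinForm hκ r r' hB₀ (onShell_mem_massShell hz.1) hz.1 hz.2 v v',
    ?_⟩
  refine MeasureTheory.tendsto_integral_filter_of_dominated_convergence
    ((Metric.closedBall (0 : Vec × Vec × (Fin 3 → ℝ)) ρ).indicator fun _ => C) ?_ ?_ ?_ ?_
  · filter_upwards [hint] with s hs using hs.aestronglyMeasurable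
  · filter_upwards [hb, hform] with s h1 h2
    have h3 := h1.2 (fun e e' p => massiveKernel s r r' (plMass κ s) (B (plMass κ s)) (T s) (-e) e'
      p v v') h2
    exact Eventually.of_forall h3
  · refine (MeasureTheory.integrable_indicator_iff Metric.isClosed_closedBall.measurableSet).2 ?_
    exact MeasureTheory.integrableOn_const (isCompact_closedBall _ _).measure_lt_top.ne
  · refine Eventually.of_forall fun z => tendsto_smearIntegrand hf hκ z fun hz => ?_
    refine tendsto_massiveKernel hκ hB₀ hB T r r' v v' (onShell_mem_massShell hz.1) hz.1 hz.2
      ?_ ?_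
    · filter_upwards [(tendsto_shellPoint hκ z).eventually_mem (isOpen_regularSet.mem_nhds hz)]
        with s hs using
          onShell_mem_massShell (m := plMass κ s) (k := z.2.2) (e := z.1) hs.1
    · exact tendsto_onShell hκ z.2.2
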